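/- Let $n_1,n_2\ge 0$ be integers, $n=n_1+n_2+1$ and $\rho>0$. On $\mathbb{C}^{n+1}$ consider the Hermitian form $(z,w)=\sum_{i=1}^{n}z_i\bar w_i-z_{n+1}\bar w_{n+1}$, let $\mathbb{H}^{2n+1}_1=\{z\in\mathbb{C}^{n+1}: (z,z)=-1\}$ be the anti-de Sitter space and $\Pi:\mathbb{H}^{2n+1}_1\to\mathbb{CH}^n$, $\Pi(z)=[z]$, the Hopf fibration, i.e. the quotient by the action of the unit circle $\mathbb{S}^1\subset\mathbb{C}$ by scalar multiplication, onto the complex hyperbolic space with its complex structure $J$, its Kähler metric $\langle\,,\rangle$ of constant holomorphic sectional curvature $-4$ (the metric that makes $\Pi$ a Riemannian submersion for $\mathrm{Re}(\,,)$) and its Kähler form $\omega(u,v)=\langle Ju,v\rangle$. Let $\mathbb{RH}^{n_2}=\{y\in\mathbb{R}^{n_2+1}:\sum_{i=1}^{n_2}y_i^2-y_{n_2+1}^2=-1,\ y_{n_2+1}>0\}$, and let $\mathbb{Z}_2$ act on $\mathbb{S}^1\times\mathbb{S}^{n_1}\times\mathbb{RH}^{n_2}$ with generator $$h(e^{is},x,y)=(-e^{is},-x,y).$$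 Then $$\frac{\mathbb{S}^1\times\mathbb{S}^{n_1}\times\mathbb{RH}^{n_2}}{\mathbb{Z}_2}\longrightarrow\mathbb{CH}^n,\qquad \overline{(e^{is},x,y)}\longmapsto\left[\left(\sinh\rho\,\exp(is\cosh^2\rho)\,x,\ \cosh\rho\,\exp(is\sinh^2\rho)\,y\right)\right]$$ is a well-defined H-minimal Lagrangian embedding. Here an immersion $\psi$ of an $n$-dimensional manifold $M$ into $\mathbb{CH}^n$ is Lagrangian if $\psi^*\omega=0$, and a Lagrangian immersion $\psi$ is H-minimal (Hamiltonian minimal) if it is a critical point of the volume functional for compactly supported variations whose variation field is $J\nabla f$ with $f\in C_0^\infty(M)$: for every smooth variation $\psi_t$ of $\psi=\psi_0$, fixed outside a compact set $K\subset M$, with $\frac{d}{dt}\big|_{t=0}\psi_t=J\nabla f$ ($\nabla f$ the gradient for the induced metric), one has $\frac{d}{dt}\big|_{t=0}\mathrm{vol}(K,\psi_t^*\langle\,,\rangle)=0$. -/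

import Mathlib

open scoped Manifold ContDiff ENNReal Topology

noncomputable section

namespace HMinLag

/-! ### The anti-de Sitter space and the Hopf fibration onto complex hyperbolic space -/

/-- The indefinite Hermitian form
`(z, w) = ∑_{i ≤ n} z_i conj(w_i) - z_{n+1} conj(w_{n+1})` on `ℂ^{n+1}`. -/
def herm {n : ℕ} (z w : EuclideanSpace ℂ (Fin (n + 1))) : ℂ :=
  ∑ i : Fin n, z i.castSucc * star (w i.castSucc) - z (Fin.last n) * star (w (Fin.last n))

/-- The anti-de Sitter space `{z ∈ ℂ^{n+1} | (z, z) = -1}`. -/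
abbrev AntiDeSitter (n : ℕ) : Type :=
  {z : EuclideanSpace ℂ (Fin (n + 1)) // herm z z = -1}

theorem herm_smul_smul {n : ℕ} (a : ℂ) (z w : EuclideanSpace ℂ (Fin (n + 1))) :
    herm (a • z) (a • w) = (a * star a) * herm z w := by
  simp only [herm, PiLp.smul_apply, smul_eq_mul, star_mul', mul_sub, Finset.mul_sum]
  congr 1
  · exact Finset.sum_congr rfl fun i _ => by ring
  · ring

theorem circle_mul_star (c : Circle) : (c : ℂ) * star (c : ℂ) = 1 := by
  have := Complex.mul_conj (c : ℂ)
  simpa [Circle.normSq_coe] using this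

/-- The unit circle acts on the anti-de Sitter space by scalar multiplication. -/
instance (n : ℕ) : MulAction Circle (AntiDeSitter n) where
  smul c z := ⟨(c : ℂ) • z.1, by rw [herm_smul_smul, circle_mul_star, z.2, one_mul]⟩
  one_smul z := Subtype.ext (one_smul ℂ z.1)
  mul_smul c d z := Subtype.ext (by
    change ((c * d : Circle) : ℂ) • z.1 = (c : ℂ) • ((d : ℂ) • z.1)
    rw [Circle.coe_mul, mul_smul])

theorem coe_circle_smul {n : ℕ} (c : Circle) (z : AntiDeSitter n) :
    ((c • z : AntiDeSitter n) : EuclideanSpace ℂ (Fin (n + 1))) = (c : ℂ) • z.1 := rfl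

/-- The complex hyperbolic space, the quotient of the anti-de Sitter space by the circle action,
with the quotient topology. -/
def CH (n : ℕ) : Type := MulAction.orbitRel.Quotient Circle (AntiDeSitter n)

instance (n : ℕ) : TopologicalSpace (CH n) :=
  inferInstanceAs (TopologicalSpace (Quotient (MulAction.orbitRel Circle (AntiDeSitter n))))

/-- The Hopf fibration `z ↦ [z]`. -/
def hopf {n : ℕ} (z : AntiDeSitter n) : CH n :=
  (Quotient.mk (MulAction.orbitRel Circle (AntiDeSitter n)) z :
    Quotient (MulAction.orbitRel Circle (AntiDeSitter n)))

theorem herm_self {n : ℕ} (z : EuclideanSpace ℂ (Fin (n + 1))) :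
    herm z z = ((∑ i : Fin n, ‖z i.castSucc‖ ^ 2 - ‖z (Fin.last n)‖ ^ 2 : ℝ) : ℂ) := by
  simp only [herm, Complex.star_def, Complex.mul_conj, Complex.normSq_eq_norm_sq]
  push_cast
  rfl

theorem AntiDeSitter.norm_eq {n : ℕ} (z : AntiDeSitter n) :
    ∑ i : Fin n, ‖z.1 i.castSucc‖ ^ 2 - ‖z.1 (Fin.last n)‖ ^ 2 = -1 := by
  have h := z.2
  rw [herm_self] at h
  exact_mod_cast h

theorem AntiDeSitter.last_ne_zero {n : ℕ} (z : AntiDeSitter n) : z.1 (Fin.last n) ≠ 0 := by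
  intro h
  have h1 := z.norm_eq
  have h2 : (0 : ℝ) ≤ ∑ i : Fin n, ‖z.1 i.castSucc‖ ^ 2 := by positivity
  rw [h] at h1
  norm_num at h1
  linarith

/-- The affine coordinates `z_i / z_{n+1}` on the anti-de Sitter space. -/
def affine {n : ℕ} (z : AntiDeSitter n) : EuclideanSpace ℂ (Fin n) :=
  WithLp.toLp 2 fun i => z.1 i.castSucc / z.1 (Fin.last n)

theorem continuous_affine {n : ℕ} : Continuous (affine (n := n)) := by
  refine (PiLp.continuous_toLp 2 _).comp (continuous_pi fun i => ?_)
  exact Continuous.div (by fun_prop) (by fun_prop) fun z => z.last_ne_zero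

/-- The affine coordinates `[z] ↦ (z_i / z_{n+1})_{i ≤ n}` on complex hyperbolic space. -/
def affineCoord {n : ℕ} : CH n → EuclideanSpace ℂ (Fin n) :=
  Quotient.lift affine (by
    rintro _ z ⟨c, rfl⟩
    ext i
    simp only [affine, coe_circle_smul, PiLp.smul_apply, smul_eq_mul]
    exact mul_div_mul_left _ _ c.coe_ne_zero)

/-- The vector `(v, a)` of `ℂ^{n+1} = ℂ^n × ℂ`. -/
def snoc {n : ℕ} (v : EuclideanSpace ℂ (Fin n)) (a : ℂ) : EuclideanSpace ℂ (Fin (n + 1)) :=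
  WithLp.toLp 2 (Fin.snoc (α := fun _ => ℂ) v a)

/-- The point `(w, 1) / √(1 - |w|²)` of the anti-de Sitter space lying over the point of complex
hyperbolic space with affine coordinates `w` in the unit ball. -/
def ballLift {n : ℕ} (w : EuclideanSpace ℂ (Fin n)) : EuclideanSpace ℂ (Fin (n + 1)) :=
  (((√(1 - ‖w‖ ^ 2))⁻¹ : ℝ) : ℂ) • snoc w 1

theorem herm_ballLift {n : ℕ} {w : EuclideanSpace ℂ (Fin n)} (hw : ‖w‖ < 1) :
    herm (ballLift w) (ballLift w) = -1 := by
  have h0 : 0 < 1 - ‖w‖ ^ 2 := by nlinarith [norm_nonneg w]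
  rw [ballLift, herm_smul_smul, herm_self, Complex.star_def, Complex.conj_ofReal]
  have h2 : ∑ i : Fin n, ‖(snoc w 1) i.castSucc‖ ^ 2 - ‖(snoc w 1) (Fin.last n)‖ ^ 2
      = -(1 - ‖w‖ ^ 2) := by
    simp [snoc, EuclideanSpace.norm_sq_eq]
  rw [h2]
  have h3 : (√(1 - ‖w‖ ^ 2))⁻¹ * (√(1 - ‖w‖ ^ 2))⁻¹ * -(1 - ‖w‖ ^ 2) = -1 := by
    rw [← mul_inv, Real.mul_self_sqrt h0.le]
    field_simp
  exact_mod_cast h3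

theorem norm_affine_lt {n : ℕ} (z : AntiDeSitter n) : ‖affine z‖ < 1 := by
  have h1 := z.norm_eq
  have h2 : 0 < ‖z.1 (Fin.last n)‖ := norm_pos_iff.mpr z.last_ne_zero
  have h3 : ‖affine z‖ ^ 2 < 1 := by
    rw [EuclideanSpace.norm_sq_eq]
    simp only [affine, norm_div, div_pow]
    rw [← Finset.sum_div, div_lt_one (by positivity)]
    linarith
  nlinarith [norm_nonneg (affine z)]

theorem affine_ballLift {n : ℕ} {w : EuclideanSpace ℂ (Fin n)} (hw : ‖w‖ < 1) :
    affine ⟨ballLift w, herm_ballLift hw⟩ = w := by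
  have h0 : 0 < 1 - ‖w‖ ^ 2 := by nlinarith [norm_nonneg w]
  have h1 : (((√(1 - ‖w‖ ^ 2))⁻¹ : ℝ) : ℂ) ≠ 0 := by
    exact_mod_cast (inv_pos.mpr (Real.sqrt_pos.mpr h0)).ne'
  ext i
  simp only [affine, ballLift, snoc, PiLp.smul_apply, smul_eq_mul, Fin.snoc_castSucc,
    Fin.snoc_last]
  rw [mul_div_mul_left _ _ h1, div_one]

/-- The point of complex hyperbolic space with given affine coordinates (the value outside the
unit ball is irrelevant). -/
def ofBall {n : ℕ} (w : EuclideanSpace ℂ (Fin n)) : CH n :=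
  if hw : ‖w‖ < 1 then hopf ⟨ballLift w, herm_ballLift hw⟩
  else hopf ⟨ballLift 0, herm_ballLift (by simp)⟩

theorem affineCoord_hopf {n : ℕ} (z : AntiDeSitter n) : affineCoord (hopf z) = affine z := rfl

theorem ofBall_affine {n : ℕ} (z : AntiDeSitter n) : ofBall (affine z) = hopf z := by
  have hw := norm_affine_lt z
  have hz := z.last_ne_zero
  have h0 : 0 < ‖z.1 (Fin.last n)‖ := norm_pos_iff.mpr hz
  have h1 : 1 - ‖affine z‖ ^ 2 = (‖z.1 (Fin.last n)‖⁻¹) ^ 2 := by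
    have h2 := z.norm_eq
    rw [EuclideanSpace.norm_sq_eq]
    simp only [affine, norm_div, div_pow]
    rw [← Finset.sum_div]
    field_simp
    linarith
  rw [ofBall, dif_pos hw]
  refine Quotient.sound (s := MulAction.orbitRel Circle (AntiDeSitter n)) ?_
  have h3 : √(1 - ‖affine z‖ ^ 2) = ‖z.1 (Fin.last n)‖⁻¹ := by
    rw [h1, Real.sqrt_sq (by positivity)]
  have hc : (‖z.1 (Fin.last n)‖ : ℂ) / z.1 (Fin.last n) ∈ Submonoid.unitSphere ℂ := by
    rw [Submonoid.unitSphere, Submonoid.mem_mk]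
    simp [h0.ne']
  refine ⟨(⟨_, hc⟩ : Circle), Subtype.ext ?_⟩
  change ((‖z.1 (Fin.last n)‖ : ℂ) / z.1 (Fin.last n)) • z.1 = ballLift (affine z)
  rw [ballLift, h3]
  ext i
  refine Fin.lastCases ?_ (fun j => ?_) i
  · simp [snoc, hz]
  · simp [snoc, affine]
    ring

/-- The global chart of complex hyperbolic space: the affine coordinates, which identify it with
the open unit ball of `ℂ^n`. -/
def ballChart (n : ℕ) : OpenPartialHomeomorph (CH n) (EuclideanSpace ℂ (Fin n)) where
  toFun := affineCoord
  invFun := ofBall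
  source := Set.univ
  target := Metric.ball 0 1
  map_source' := by
    intro q _
    induction q using Quotient.inductionOn with
    | h z => exact mem_ball_zero_iff.mpr (norm_affine_lt z)
  map_target' := fun _ _ => Set.mem_univ _
  left_inv' := by
    intro q _
    induction q using Quotient.inductionOn with
    | h z => exact ofBall_affine z
  right_inv' := by
    intro w hw
    have hw' : ‖w‖ < 1 := mem_ball_zero_iff.mp hw
    rw [ofBall, dif_pos hw', affineCoord_hopf, affine_ballLift hw']
  open_source := isOpen_univ
  open_target := Metric.isOpen_ball
  continuousOn_toFun := (continuous_affine.quotient_lift _).continuousOn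
  continuousOn_invFun := by
    rw [continuousOn_iff_continuous_domRestrict]
    have h : (Metric.ball (0 : EuclideanSpace ℂ (Fin n)) 1).domRestrict ofBall =
        fun w => hopf ⟨ballLift w.1, herm_ballLift (mem_ball_zero_iff.mp w.2)⟩ := by
      funext w
      simp only [Set.domRestrict_apply, ofBall, dif_pos (mem_ball_zero_iff.mp w.2)]
    rw [h]
    refine continuous_quotient_mk'.comp (Continuous.subtype_mk ?_ _)
    have h1 : Continuous fun w : Metric.ball (0 : EuclideanSpace ℂ (Fin n)) 1 =>
        (((√(1 - ‖w.1‖ ^ 2))⁻¹ : ℝ) : ℂ) := by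
      refine Complex.continuous_ofReal.comp (Continuous.inv₀ (by fun_prop) fun w => ?_)
      have h1 : ‖w.1‖ < 1 := mem_ball_zero_iff.mp w.2
      exact (Real.sqrt_pos.mpr (by nlinarith [norm_nonneg w.1])).ne'
    have h2 : Continuous fun w : Metric.ball (0 : EuclideanSpace ℂ (Fin n)) 1 => snoc w.1 1 := by
      refine (PiLp.continuous_toLp 2 _).comp (Continuous.finSnoc ?_ continuous_const)
      exact (PiLp.continuous_ofLp 2 _).comp continuous_subtype_val
    exact h1.smul h2

instance (n : ℕ) : ChartedSpace (EuclideanSpace ℂ (Fin n)) (CH n) :=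
  (ballChart n).singletonChartedSpace rfl

instance (n : ℕ) : IsManifold 𝓘(ℝ, EuclideanSpace ℂ (Fin n)) ∞ (CH n) :=
  (ballChart n).isManifold_singleton rfl

/-! ### The Kähler structure of complex hyperbolic space

As the chart is global, a tangent vector of `CH n` is a vector of `ℂ^n`, namely its expression in
the affine coordinates. The complex structure `J` is multiplication by `i`. -/

/-- The horizontal lift at `z = ballLift w` of a tangent vector `u` at the point with affine
coordinates `w`: the vector `(u, 0) / √(1 - |w|²)` of `T_z ℂ^{n+1}` is a lift of `u`, and
`v + (v, z) z` is the component of `v` that is Hermitian orthogonal to `z`, as `(z, z) = -1`. -/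
def horLift {n : ℕ} (w u : EuclideanSpace ℂ (Fin n)) : EuclideanSpace ℂ (Fin (n + 1)) :=
  let v := (((√(1 - ‖w‖ ^ 2))⁻¹ : ℝ) : ℂ) • snoc u 0
  v + herm v (ballLift w) • ballLift w

/-- The Riemannian metric of complex hyperbolic space, of constant holomorphic sectional curvature
`-4`, for which the Hopf fibration is a Riemannian submersion: the real part of the Hermitian form
on horizontal lifts. -/
def chMetric {n : ℕ} (q : CH n) (u v : EuclideanSpace ℂ (Fin n)) : ℝ :=
  (herm (horLift (affineCoord q) u) (horLift (affineCoord q) v)).re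

/-- The complex structure of complex hyperbolic space. -/
def chJ {n : ℕ} (u : EuclideanSpace ℂ (Fin n)) : EuclideanSpace ℂ (Fin n) := Complex.I • u

/-- The Kähler form `ω(u, v) = ⟨J u, v⟩` of complex hyperbolic space. -/
def chKahler {n : ℕ} (q : CH n) (u v : EuclideanSpace ℂ (Fin n)) : ℝ := chMetric q (chJ u) v

/-! ### Lagrangian and Hamiltonian minimal immersions into complex hyperbolic space -/

section Immersions

variable {E : Type*} [NormedAddCommGroup E] [NormedSpace ℝ E] [FiniteDimensional ℝ E]
  {H : Type*} [TopologicalSpace H] (I : ModelWithCorners ℝ E H)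
  {M : Type*} [TopologicalSpace M] [ChartedSpace H M] {n : ℕ}

/-- The differential of a map into complex hyperbolic space. -/
abbrev dmap (ψ : M → CH n) (p : M) (u : TangentSpace I p) : EuclideanSpace ℂ (Fin n) :=
  mfderiv I 𝓘(ℝ, EuclideanSpace ℂ (Fin n)) ψ p u

/-- `ψ` is a Lagrangian immersion: an immersion of an `n`-dimensional manifold with
`ψ^* ω = 0`. -/
structure IsLagrangianImmersion (ψ : M → CH n) : Prop where
  isImmersion : Manifold.IsImmersion I 𝓘(ℝ, EuclideanSpace ℂ (Fin n)) ∞ ψ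
  finrank_eq : Module.finrank ℝ E = n
  pullback_kahler : ∀ (p : M) (u v : TangentSpace I p),
    chKahler (ψ p) (dmap I ψ p u) (dmap I ψ p v) = 0

/-- The density `√(det (ψ^*⟨∂_i, ∂_j⟩))` of the volume induced by `ψ` in the local parametrization
`φ : E → M`, with respect to the coordinates given by the basis `b` of `E`. -/
def volDensity {ι : Type*} [Fintype ι] [DecidableEq ι] (b : Module.Basis ι ℝ E) (ψ : M → CH n)
    (φ : E → M) (x : E) : ℝ :=
  √(Matrix.det (Matrix.of fun i j => chMetric (ψ (φ x))
    (dmap 𝓘(ℝ, E) (ψ ∘ φ) x (b i)) (dmap 𝓘(ℝ, E) (ψ ∘ φ) x (b j))))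

variable [MeasurableSpace E] [BorelSpace E]

/-- `vol (K, ψ^*⟨,⟩)`, the volume of `K ⊆ M` for the Riemannian measure of the metric induced
by `ψ`. A chart `e` of `M` carries the measure `√det(g_ij) dx`, transported to the source of `e`;
these measures agree on overlaps and the Riemannian measure is the measure obtained by glueing
them, which is their least upper bound in the lattice of Borel measures on `M`. -/
def vol (ψ : M → CH n) (K : Set M) : ℝ≥0∞ :=
  letI : MeasurableSpace M := borel M
  let b := Module.finBasis ℝ E
  (⨆ e ∈ atlas H M, ((b.addHaar.restrict (e.extend I).target).withDensity
    fun x => ENNReal.ofReal (volDensity b ψ (e.extend I).symm x)).map (e.extend I).symm) K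

/-- `X` is the gradient of `f` for the metric induced by `ψ`. -/
def IsInducedGradient (ψ : M → CH n) (f : M → ℝ) (X : (p : M) → TangentSpace I p) : Prop :=
  ∀ (p : M) (u : TangentSpace I p),
    chMetric (ψ p) (dmap I ψ p (X p)) (dmap I ψ p u) = mfderiv I 𝓘(ℝ, ℝ) f p u

/-- `Ψ` is a smooth variation of `ψ`, defined for times `|t| < ε` and supported in `K`. -/
structure IsVariation (ψ : M → CH n) (Ψ : ℝ → M → CH n) (ε : ℝ) (K : Set M) : Prop where
  pos : 0 < ε
  smooth : ContMDiffOn (𝓘(ℝ, ℝ).prod I) 𝓘(ℝ, EuclideanSpace ℂ (Fin n)) ∞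
    (fun x : ℝ × M => Ψ x.1 x.2) (Set.Ioo (-ε) ε ×ˢ Set.univ)
  zero : Ψ 0 = ψ
  eq_off : ∀ t ∈ Set.Ioo (-ε) ε, ∀ p ∉ K, Ψ t p = ψ p

/-- `ψ` is Hamiltonian minimal (H-minimal): it is a Lagrangian immersion which is a critical
point of the volume functional for all compactly supported variations whose variation field is a
Hamiltonian normal field `J ∇f`, where `f` is a smooth compactly supported function on `M` and `∇f`
is its gradient for the induced metric. -/
structure IsHMinimal (ψ : M → CH n) : Prop where
  isLagrangianImmersion : IsLagrangianImmersion I ψ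
  critical : ∀ (f : M → ℝ) (X : (p : M) → TangentSpace I p) (Ψ : ℝ → M → CH n) (ε : ℝ) (K : Set M),
    ContMDiff I 𝓘(ℝ, ℝ) ∞ f → HasCompactSupport f → IsInducedGradient I ψ f X →
    IsCompact K → IsVariation I ψ Ψ ε K →
    (∀ p, dmap 𝓘(ℝ, ℝ) (fun t => Ψ t p) 0 (1 : ℝ) = chJ (dmap I ψ p (X p))) →
    HasDerivAt (fun t => (vol I (Ψ t) K).toReal) 0 0

end Immersions

/-! ### The quotient of `S^1 × S^{n₁} × RH^{n₂}` by `Z_2` -/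

/-- The real hyperbolic space
`{y ∈ ℝ^{n+1} | ∑_{i ≤ n} y_i² - y_{n+1}² = -1, y_{n+1} > 0}`. -/
abbrev RH (n : ℕ) : Type :=
  {y : EuclideanSpace ℝ (Fin (n + 1)) //
    ∑ i : Fin n, y i.castSucc ^ 2 - y (Fin.last n) ^ 2 = -1 ∧ 0 < y (Fin.last n)}

/-- The global chart `y ↦ (y_1, …, y_n)` of real hyperbolic space. -/
def rhHomeo (n : ℕ) : RH n ≃ₜ EuclideanSpace ℝ (Fin n) where
  toFun y := WithLp.toLp 2 fun i => y.1 i.castSucc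
  invFun u := ⟨WithLp.toLp 2 (Fin.snoc (α := fun _ => ℝ) u √(1 + ∑ i, u i ^ 2)), by
    have h : 0 < 1 + ∑ i, u i ^ 2 := by positivity
    constructor
    · simp only [Fin.snoc_castSucc, Fin.snoc_last]
      rw [Real.sq_sqrt h.le]
      ring
    · simp only [Fin.snoc_last]
      exact Real.sqrt_pos.mpr h⟩
  left_inv y := by
    obtain ⟨y, h1, h2⟩ := y
    apply Subtype.ext
    ext i
    refine Fin.lastCases ?_ (fun j => ?_) i
    · simp only [Fin.snoc_last]
      rw [show 1 + ∑ i : Fin n, y i.castSucc ^ 2 = y (Fin.last n) ^ 2 by linarith,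
        Real.sqrt_sq h2.le]
    · simp only [Fin.snoc_castSucc]
  right_inv u := by
    ext i
    simp only [Fin.snoc_castSucc]
  continuous_toFun := by
    refine (PiLp.continuous_toLp 2 _).comp (continuous_pi fun i => ?_)
    fun_prop
  continuous_invFun := by
    refine Continuous.subtype_mk ((PiLp.continuous_toLp 2 _).comp (Continuous.finSnoc ?_ ?_)) _
    · exact PiLp.continuous_ofLp 2 _
    · fun_prop

instance (n : ℕ) : ChartedSpace (EuclideanSpace ℝ (Fin n)) (RH n) :=
  (rhHomeo n).toOpenPartialHomeomorph.singletonChartedSpace rfl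

instance (n : ℕ) : IsManifold (𝓡 n) ∞ (RH n) :=
  (rhHomeo n).toOpenPartialHomeomorph.isManifold_singleton rfl

instance (n : ℕ) : LocallyCompactSpace (RH n) :=
  (rhHomeo n).isClosedEmbedding.locallyCompactSpace

/-- The product `S^1 × S^{n₁} × RH^{n₂}`. -/
abbrev Prod3 (n₁ n₂ : ℕ) : Type :=
  Circle × Metric.sphere (0 : EuclideanSpace ℝ (Fin (n₁ + 1))) 1 × RH n₂

/-- The involution `h(e^{is}, x, y) = (-e^{is}, -x, y)`. -/
def invol {n₁ n₂ : ℕ} (p : Prod3 n₁ n₂) : Prod3 n₁ n₂ := (-p.1, -p.2.1, p.2.2)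

theorem invol_invol {n₁ n₂ : ℕ} (p : Prod3 n₁ n₂) : invol (invol p) = p := by
  simp [invol]

theorem invol_ne {n₁ n₂ : ℕ} (p : Prod3 n₁ n₂) : invol p ≠ p := by
  intro h
  have h1 : -p.2.1 = p.2.1 := congrArg (fun q => q.2.1) h
  exact ne_neg_of_mem_unit_sphere ℝ p.2.1 h1.symm

/-- The group `Z_2 = {1, -1}` acts on `S^1 × S^{n₁} × RH^{n₂}`, the generator acting as
`invol`. -/
instance (n₁ n₂ : ℕ) : MulAction ℤˣ (Prod3 n₁ n₂) where
  smul u p := if u = 1 then p else invol p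
  one_smul p := if_pos rfl
  mul_smul u v p := by
    change (if u * v = 1 then p else invol p) =
      if u = 1 then (if v = 1 then p else invol p) else invol (if v = 1 then p else invol p)
    rcases Int.units_eq_one_or u with rfl | rfl <;> rcases Int.units_eq_one_or v with rfl | rfl <;>
      simp [invol_invol]

theorem neg_one_smul_eq {n₁ n₂ : ℕ} (p : Prod3 n₁ n₂) : (-1 : ℤˣ) • p = invol p :=
  if_neg (by decide)

/-- The model with corners of `S^1 × S^{n₁} × RH^{n₂}` and of its quotient. -/
abbrev model3 (n₁ n₂ : ℕ) := (𝓡 1).prod ((𝓡 n₁).prod (𝓡 n₂))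

theorem contMDiff_invol {n₁ n₂ : ℕ} :
    ContMDiff (model3 n₁ n₂) (model3 n₁ n₂) ∞ (invol (n₁ := n₁) (n₂ := n₂)) := by
  have h1 : ContMDiff (𝓡 1) (𝓡 1) ∞ (fun z : Circle => -z) := by
    have h : (fun z : Circle => -z) = fun z => -1 * z := by funext z; simp
    rw [h]
    exact contMDiff_mul_left.of_le le_top
  have h2 : ContMDiff (𝓡 n₁) (𝓡 n₁) ∞
      (fun x : Metric.sphere (0 : EuclideanSpace ℝ (Fin (n₁ + 1))) 1 => -x) :=
    haveI := Fact.mk (@finrank_euclideanSpace_fin ℝ _ (n₁ + 1))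
    contMDiff_neg_sphere
  exact h1.prodMap (h2.prodMap contMDiff_id)

instance (n₁ n₂ : ℕ) : ContinuousConstSMul ℤˣ (Prod3 n₁ n₂) where
  continuous_const_smul u := by
    rcases Int.units_eq_one_or u with rfl | rfl
    · simpa only [one_smul] using continuous_id'
    · simpa only [neg_one_smul_eq] using contMDiff_invol.continuous

instance (n₁ n₂ : ℕ) : IsCancelSMul ℤˣ (Prod3 n₁ n₂) where
  left_cancel' u p q h := smul_left_cancel u h
  right_cancel' u v p h := by
    rcases Int.units_eq_one_or u with rfl | rfl <;> rcases Int.units_eq_one_or v with rfl | rfl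
    · rfl
    · rw [one_smul, neg_one_smul_eq] at h
      exact absurd h.symm (invol_ne p)
    · rw [one_smul, neg_one_smul_eq] at h
      exact absurd h (invol_ne p)
    · rfl

/-- The quotient of `S^1 × S^{n₁} × RH^{n₂}` by the action of `Z_2`, with its quotient topology and
the manifold structure given by Mathlib for quotients by free properly discontinuous actions. -/
abbrev Quot3 (n₁ n₂ : ℕ) : Type := MulAction.orbitRel.Quotient ℤˣ (Prod3 n₁ n₂)

/-- The projection `p ↦ [p]` onto the quotient. -/
def proj3 {n₁ n₂ : ℕ} (p : Prod3 n₁ n₂) : Quot3 n₁ n₂ := Quotient.mk _ p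

theorem isManifold_quotient {E H X G : Type*} [NormedAddCommGroup E] [NormedSpace ℝ E]
    [TopologicalSpace H] (I : ModelWithCorners ℝ E H) [TopologicalSpace X] [ChartedSpace H X]
    [IsManifold I ∞ X] [Group G] [MulAction G X] [ProperlyDiscontinuousSMul G X]
    [ContinuousConstSMul G X] [IsCancelSMul G X] [T2Space X] [LocallyCompactSpace X]
    (hG : ∀ g : G, ContMDiff I I ∞ fun x : X => g • x) :
    IsManifold I ∞ (MulAction.orbitRel.Quotient G X) := by
  have hf : IsLocalHomeomorph (Quotient.mk (MulAction.orbitRel G X)) :=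
    isQuotientCoveringMap_quotientMk_of_properlyDiscontinuousSMul.isCoveringMap.isLocalHomeomorph
  have key : ∀ a a' : X, ContDiffOn ℝ ∞
      (I ∘ ((hf.localInverseAt a).trans (chartAt H a)).symm.trans
        ((hf.localInverseAt a').trans (chartAt H a')) ∘ I.symm)
      (I.symm ⁻¹' (((hf.localInverseAt a).trans (chartAt H a)).symm.trans
        ((hf.localInverseAt a').trans (chartAt H a'))).source ∩ Set.range I) := by
    rintro a a' y ⟨hy, hyI⟩
    simp only [Set.mem_preimage, OpenPartialHomeomorph.trans_source,
      OpenPartialHomeomorph.symm_source, OpenPartialHomeomorph.trans_target,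
      OpenPartialHomeomorph.coe_trans_symm, Set.mem_inter_iff, Function.comp_apply,
      hf.localInverseAt_symm] at hy
    obtain ⟨⟨hy1, hy2⟩, hy3, hy4⟩ := hy
    set x : X := (chartAt H a).symm (I.symm y) with hx
    have hxx : Quotient.mk (MulAction.orbitRel G X) (hf.localInverseAt a' (Quotient.mk _ x)) =
        Quotient.mk _ x := hf.apply_localInverseAt_of_mem hy3
    obtain ⟨g, hg⟩ : ∃ g : G, g • x = hf.localInverseAt a' (Quotient.mk _ x) :=
      Quotient.exact hxx
    have hgq : ∀ z : X, Quotient.mk (MulAction.orbitRel G X) (g • z) = Quotient.mk _ z :=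
      fun z => Quotient.sound ⟨g, rfl⟩
    have hya : y ∈ (extChartAt I a).target := by
      rw [extChartAt_target]
      exact ⟨hy1, hyI⟩
    have hsm : ContMDiffWithinAt 𝓘(ℝ, E) 𝓘(ℝ, E) ∞
        (fun y => extChartAt I a' (g • (extChartAt I a).symm y)) (extChartAt I a).target y := by
      have h1 := contMDiffOn_extChartAt_symm (I := I) (n := ∞) a y hya
      have h3 : ContMDiffAt I 𝓘(ℝ, E) ∞ (extChartAt I a') (g • x) :=
        contMDiffAt_extChartAt' (by rw [hg]; exact hy4)
      have h4 : ContMDiffAt I 𝓘(ℝ, E) ∞ (fun z => extChartAt I a' (g • z)) x :=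
        h3.comp x (hG g x)
      exact ContMDiffAt.comp_contMDiffWithinAt
        (g := fun z => extChartAt I a' (g • z)) (f := (extChartAt I a).symm) y h4 h1
    rw [contMDiffWithinAt_iff_contDiffWithinAt] at hsm
    have hmono : ContDiffWithinAt ℝ ∞
        (fun y => extChartAt I a' (g • (extChartAt I a).symm y))
        (I.symm ⁻¹' (((hf.localInverseAt a).trans (chartAt H a)).symm.trans
          ((hf.localInverseAt a').trans (chartAt H a'))).source ∩ Set.range I) y := by
      refine hsm.mono ?_
      rintro z ⟨hz, hzI⟩
      rw [extChartAt_target]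
      simp only [Set.mem_preimage, OpenPartialHomeomorph.trans_source,
        OpenPartialHomeomorph.symm_source, OpenPartialHomeomorph.trans_target,
        Set.mem_inter_iff] at hz
      exact ⟨hz.1.1, hzI⟩
    have hcont : ContinuousWithinAt (fun z => g • (extChartAt I a).symm z)
        (I.symm ⁻¹' (((hf.localInverseAt a).trans (chartAt H a)).symm.trans
          ((hf.localInverseAt a').trans (chartAt H a'))).source ∩ Set.range I) y :=
      ((continuousAt_extChartAt_symm'' hya).const_smul g).continuousWithinAt
    have hmem : (hf.localInverseAt a').target ∈ 𝓝 (g • (extChartAt I a).symm y) := by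
      refine (hf.localInverseAt a').open_target.mem_nhds ?_
      change g • x ∈ _
      rw [hg]
      exact (hf.localInverseAt a').map_source hy3
    have hloc : ∀ z, g • (extChartAt I a).symm z ∈ (hf.localInverseAt a').target →
        (I ∘ ((hf.localInverseAt a).trans (chartAt H a)).symm.trans
          ((hf.localInverseAt a').trans (chartAt H a')) ∘ I.symm) z =
        extChartAt I a' (g • (extChartAt I a).symm z) := by
      intro z hz
      have h1 := (hf.localInverseAt a').right_inv hz
      rw [hf.localInverseAt_symm, hgq] at h1
      change I (chartAt H a' (hf.localInverseAt a' ((hf.localInverseAt a).symm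
        ((chartAt H a).symm (I.symm z))))) = I (chartAt H a' (g • (extChartAt I a).symm z))
      rw [hf.localInverseAt_symm]
      exact congrArg (fun w => I (chartAt H a' w)) h1
    refine hmono.congr_of_eventuallyEq ?_ (hloc y (mem_of_mem_nhds hmem))
    filter_upwards [hcont hmem] with z hz using hloc z hz
  refine isManifold_of_contDiffOn I ∞ _ ?_
  rintro _ _ ⟨q, rfl⟩ ⟨q', rfl⟩
  exact key _ _

instance (n₁ n₂ : ℕ) : IsManifold (model3 n₁ n₂) ∞ (Quot3 n₁ n₂) :=
  isManifold_quotient _ fun u => by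
    rcases Int.units_eq_one_or u with rfl | rfl
    · simpa only [one_smul] using! contMDiff_id
    · simpa only [neg_one_smul_eq] using contMDiff_invol

/-! ### The lift of the immersion to the anti-de Sitter space -/

/-- The vector `(sinh ρ exp(i s cosh² ρ) x, cosh ρ exp(i s sinh² ρ) y)` of
`ℂ^{n+1} = ℂ^{n₁+1} × ℂ^{n₂+1}`, where `n = n₁ + n₂ + 1`. -/
def liftVec {n₁ n₂ : ℕ} (ρ s : ℝ) (x : EuclideanSpace ℝ (Fin (n₁ + 1)))
    (y : EuclideanSpace ℝ (Fin (n₂ + 1))) : EuclideanSpace ℂ (Fin (n₁ + n₂ + 1 + 1)) :=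
  WithLp.toLp 2 fun k => Fin.append
    (fun i => (Real.sinh ρ : ℂ) * Complex.exp (Complex.I * s * (Real.cosh ρ : ℂ) ^ 2) * (x i : ℂ))
    (fun j => (Real.cosh ρ : ℂ) * Complex.exp (Complex.I * s * (Real.sinh ρ : ℂ) ^ 2) * (y j : ℂ))
    (Fin.cast (by omega : n₁ + n₂ + 1 + 1 = (n₁ + 1) + (n₂ + 1)) k)

theorem herm_liftVec {n₁ n₂ : ℕ} (ρ s : ℝ)
    (x : Metric.sphere (0 : EuclideanSpace ℝ (Fin (n₁ + 1))) 1) (y : RH n₂) :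
    herm (liftVec ρ s x.1 y.1) (liftVec ρ s x.1 y.1) = -1 := by
  have hx : ∑ i, x.1 i ^ 2 = 1 := by
    have h : ‖x.1‖ = 1 := mem_sphere_zero_iff_norm.mp x.2
    have h2 := EuclideanSpace.real_norm_sq_eq x.1
    rw [h] at h2
    linarith
  have hy := y.2.1
  have hsum : ∑ k : Fin (n₁ + n₂ + 1), ‖(liftVec ρ s x.1 y.1) k.castSucc‖ ^ 2 +
      ‖(liftVec ρ s x.1 y.1) (Fin.last _)‖ ^ 2 =
      ∑ k : Fin (n₁ + n₂ + 1 + 1), ‖(liftVec ρ s x.1 y.1) k‖ ^ 2 :=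
    (Fin.sum_univ_castSucc fun k => ‖(liftVec ρ s x.1 y.1) k‖ ^ 2).symm
  have hexp : ∀ a b : ℝ, ‖Complex.exp (Complex.I * a * (b : ℂ) ^ 2)‖ = 1 := by
    intro a b
    rw [show Complex.I * a * (b : ℂ) ^ 2 = ((a * b ^ 2 : ℝ) : ℂ) * Complex.I by push_cast; ring]
    exact Complex.norm_exp_ofReal_mul_I _
  have htot : ∑ k : Fin (n₁ + n₂ + 1 + 1), ‖(liftVec ρ s x.1 y.1) k‖ ^ 2 =
      Real.sinh ρ ^ 2 + Real.cosh ρ ^ 2 * ∑ j, y.1 j ^ 2 := by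
    have h := (finCongr (by omega : n₁ + n₂ + 1 + 1 = (n₁ + 1) + (n₂ + 1))).sum_comp
      fun k => ‖Fin.append
        (fun i => (Real.sinh ρ : ℂ) * Complex.exp (Complex.I * s * (Real.cosh ρ : ℂ) ^ 2) *
          (x.1 i : ℂ))
        (fun j => (Real.cosh ρ : ℂ) * Complex.exp (Complex.I * s * (Real.sinh ρ : ℂ) ^ 2) *
          (y.1 j : ℂ)) k‖ ^ 2
    refine h.trans ?_
    rw [Fin.sum_univ_add]
    simp only [Fin.append_left, Fin.append_right, norm_mul, hexp, Complex.norm_real,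
      Real.norm_eq_abs, mul_one, mul_pow, sq_abs]
    rw [← Finset.mul_sum, ← Finset.mul_sum, hx, mul_one]
  have hlast : ‖(liftVec ρ s x.1 y.1) (Fin.last _)‖ ^ 2 =
      Real.cosh ρ ^ 2 * y.1 (Fin.last n₂) ^ 2 := by
    have h : (Fin.cast (by omega : n₁ + n₂ + 1 + 1 = (n₁ + 1) + (n₂ + 1))
        (Fin.last (n₁ + n₂ + 1))) = Fin.natAdd (n₁ + 1) (Fin.last n₂) := by
      ext
      simp
    simp only [liftVec, h, Fin.append_right, norm_mul, hexp, Complex.norm_real,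
      Real.norm_eq_abs, mul_one, mul_pow, sq_abs]
  have hy2 : ∑ j, y.1 j ^ 2 = ∑ j : Fin n₂, y.1 j.castSucc ^ 2 + y.1 (Fin.last n₂) ^ 2 :=
    Fin.sum_univ_castSucc fun j => y.1 j ^ 2
  rw [htot, hy2] at hsum
  have hfin : ∑ k : Fin (n₁ + n₂ + 1), ‖(liftVec ρ s x.1 y.1) k.castSucc‖ ^ 2 -
      ‖(liftVec ρ s x.1 y.1) (Fin.last _)‖ ^ 2 = -1 := by
    rw [hlast] at hsum ⊢
    have h := Real.cosh_sq ρ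
    linear_combination hsum + Real.cosh ρ ^ 2 * hy - h
  rw [herm_self, hfin]
  norm_num

/-- The Legendrian lift
`(sinh ρ exp(i s cosh² ρ) x, cosh ρ exp(i s sinh² ρ) y)` in the anti-de Sitter space. -/
def lift {n₁ n₂ : ℕ} (ρ s : ℝ) (x : Metric.sphere (0 : EuclideanSpace ℝ (Fin (n₁ + 1))) 1)
    (y : RH n₂) : AntiDeSitter (n₁ + n₂ + 1) :=
  ⟨liftVec ρ s x.1 y.1, herm_liftVec ρ s x y⟩

end HMinLag

namespace HMinLag

/-! ### The Bergman form -/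

/-- The Hermitian metric of complex hyperbolic space in affine coordinates. -/
def bergman {n : ℕ} (w u v : EuclideanSpace ℂ (Fin n)) : ℂ :=
  (((1 - ‖w‖ ^ 2)⁻¹ : ℝ) : ℂ) * inner ℂ v u +
    (((1 - ‖w‖ ^ 2)⁻¹ : ℝ) : ℂ) ^ 2 * (inner ℂ w u * inner ℂ v w)

theorem herm_snoc {n : ℕ} (u v : EuclideanSpace ℂ (Fin n)) (a b : ℂ) :
    herm (snoc u a) (snoc v b) = inner ℂ v u - a * star b := by
  simp [herm, snoc, PiLp.inner_apply]

theorem herm_add_left {n : ℕ} (u v w : EuclideanSpace ℂ (Fin (n + 1))) :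
    herm (u + v) w = herm u w + herm v w := by
  simp only [herm, PiLp.add_apply, add_mul, Finset.sum_add_distrib]
  ring

theorem herm_smul_left {n : ℕ} (a : ℂ) (u w : EuclideanSpace ℂ (Fin (n + 1))) :
    herm (a • u) w = a * herm u w := by
  simp only [herm, PiLp.smul_apply, smul_eq_mul, mul_sub, Finset.mul_sum, mul_assoc]

theorem herm_star {n : ℕ} (u w : EuclideanSpace ℂ (Fin (n + 1))) :
    star (herm u w) = herm w u := by
  simp [herm, mul_comm]

theorem herm_add_right {n : ℕ} (u v w : EuclideanSpace ℂ (Fin (n + 1))) :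
    herm w (u + v) = herm w u + herm w v := by
  rw [← herm_star, herm_add_left, star_add, herm_star, herm_star]

theorem herm_smul_right {n : ℕ} (a : ℂ) (u w : EuclideanSpace ℂ (Fin (n + 1))) :
    herm w (a • u) = star a * herm w u := by
  rw [← herm_star, herm_smul_left, star_mul', herm_star]

theorem herm_add_horizontal {n : ℕ} {z : EuclideanSpace ℂ (Fin (n + 1))} (hz : herm z z = -1)
    (a b : EuclideanSpace ℂ (Fin (n + 1))) :
    herm (a + herm a z • z) (b + herm b z • z) = herm a b + herm a z * herm z b := by
  simp only [herm_add_left, herm_add_right, herm_smul_left, herm_smul_right, hz, herm_star]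
  ring

theorem one_sub_norm_sq_pos {n : ℕ} {w : EuclideanSpace ℂ (Fin n)} (hw : ‖w‖ < 1) :
    0 < 1 - ‖w‖ ^ 2 := by
  nlinarith [norm_nonneg w]

theorem herm_horLift {n : ℕ} {w : EuclideanSpace ℂ (Fin n)} (hw : ‖w‖ < 1)
    (u v : EuclideanSpace ℂ (Fin n)) : herm (horLift w u) (horLift w v) = bergman w u v := by
  have h0 := one_sub_norm_sq_pos hw
  have hz := herm_ballLift hw
  set c : ℝ := (√(1 - ‖w‖ ^ 2))⁻¹ with hc
  have hcc : (c : ℂ) * c = (((1 - ‖w‖ ^ 2)⁻¹ : ℝ) : ℂ) := by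
    have : c * c = (1 - ‖w‖ ^ 2)⁻¹ := by rw [hc, ← mul_inv, Real.mul_self_sqrt h0.le]
    exact_mod_cast this
  have h1 : ∀ u, herm ((c : ℂ) • snoc u 0) (ballLift w) =
      (((1 - ‖w‖ ^ 2)⁻¹ : ℝ) : ℂ) * inner ℂ w u := by
    intro u
    rw [ballLift, ← hc, herm_smul_smul, herm_snoc, Complex.star_def, Complex.conj_ofReal, hcc]
    ring
  have h2 : ∀ u v : EuclideanSpace ℂ (Fin n), herm ((c : ℂ) • snoc u 0) ((c : ℂ) • snoc v 0) =
      (((1 - ‖w‖ ^ 2)⁻¹ : ℝ) : ℂ) * inner ℂ v u := by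
    intro u v
    rw [herm_smul_smul, herm_snoc, Complex.star_def, Complex.conj_ofReal, hcc]
    ring
  have h3 : ∀ u, herm (ballLift w) ((c : ℂ) • snoc u 0) =
      (((1 - ‖w‖ ^ 2)⁻¹ : ℝ) : ℂ) * inner ℂ u w := by
    intro u
    rw [← herm_star, h1, star_mul', Complex.star_def, Complex.conj_ofReal,
      inner_conj_symm]
  change herm (_ + _ • _) (_ + _ • _) = _
  rw [← hc, herm_add_horizontal hz, h1, h2, h3, bergman]
  ring

theorem norm_affineCoord_lt {n : ℕ} (q : CH n) : ‖affineCoord q‖ < 1 := by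
  induction q using Quotient.inductionOn with
  | h z => exact norm_affine_lt z

theorem chMetric_eq {n : ℕ} (q : CH n) (u v : EuclideanSpace ℂ (Fin n)) :
    chMetric q u v = (bergman (affineCoord q) u v).re := by
  rw [chMetric, herm_horLift (norm_affineCoord_lt q)]

theorem bergman_smul_left {n : ℕ} (a : ℂ) (w u v : EuclideanSpace ℂ (Fin n)) :
    bergman w (a • u) v = a * bergman w u v := by
  simp only [bergman, inner_smul_right]
  ring

theorem bergman_add_left {n : ℕ} (w u u' v : EuclideanSpace ℂ (Fin n)) :
    bergman w (u + u') v = bergman w u v + bergman w u' v := by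
  simp only [bergman, inner_add_right]
  ring

theorem star_bergman {n : ℕ} (w u v : EuclideanSpace ℂ (Fin n)) :
    star (bergman w u v) = bergman w v u := by
  simp only [bergman, star_add, star_mul', star_pow, Complex.star_def, Complex.conj_ofReal,
    inner_conj_symm]
  ring

theorem chKahler_eq {n : ℕ} (q : CH n) (u v : EuclideanSpace ℂ (Fin n)) :
    chKahler q u v = -(bergman (affineCoord q) u v).im := by
  rw [chKahler, chMetric_eq, chJ, bergman_smul_left]
  simp

/-- The Gram matrix of a family of vectors for the Riemannian metric at the point with affine
coordinates `w`. -/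
def gram {n : ℕ} {ι : Type*} (w : EuclideanSpace ℂ (Fin n))
    (u : ι → EuclideanSpace ℂ (Fin n)) : Matrix ι ι ℝ :=
  Matrix.of fun i j => (bergman w (u i) (u j)).re

/-- The Gram matrix of a family of vectors for the Hermitian metric at the point with affine
coordinates `w`. -/
def hermGram {n : ℕ} {ι : Type*} (w : EuclideanSpace ℂ (Fin n))
    (u : ι → EuclideanSpace ℂ (Fin n)) : Matrix ι ι ℂ :=
  Matrix.of fun i j => bergman w (u i) (u j)

/-- The matrix whose columns are the given vectors. -/
def colMatrix {n : ℕ} {ι : Type*} (u : ι → EuclideanSpace ℂ (Fin n)) : Matrix (Fin n) ι ℂ :=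
  Matrix.of fun a i => u i a

theorem hermGram_eq {n : ℕ} {ι : Type*} (w : EuclideanSpace ℂ (Fin n))
    (u : ι → EuclideanSpace ℂ (Fin n)) :
    hermGram w u = (colMatrix u).transpose *
      ((((1 - ‖w‖ ^ 2)⁻¹ : ℝ) : ℂ) • (1 + Matrix.replicateCol Unit
        (fun a => (((1 - ‖w‖ ^ 2)⁻¹ : ℝ) : ℂ) * star (w a)) *
          Matrix.replicateRow Unit (fun a => w a))) * (colMatrix u).map star := by
  ext i j
  rw [Matrix.mul_smul, Matrix.smul_mul, Matrix.mul_add, Matrix.add_mul, Matrix.mul_one,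
    ← Matrix.mul_assoc, Matrix.mul_assoc _ (Matrix.replicateRow Unit _)]
  simp only [hermGram, Matrix.of_apply, bergman, Matrix.smul_apply, Matrix.add_apply,
    Matrix.mul_apply, colMatrix, Matrix.transpose_apply, Matrix.map_apply,
    Matrix.replicateCol_apply, Matrix.replicateRow_apply, Finset.univ_unique, Finset.sum_singleton,
    PiLp.inner_apply, RCLike.inner_apply, smul_eq_mul, mul_add]
  congr 1
  have h : ∑ a, (u i) a * ((((1 - ‖w‖ ^ 2)⁻¹ : ℝ) : ℂ) * star (w a)) =
      (((1 - ‖w‖ ^ 2)⁻¹ : ℝ) : ℂ) * ∑ a, (u i) a * star (w a) := by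
    rw [Finset.mul_sum]
    exact Finset.sum_congr rfl fun _ _ => by ring
  rw [h, sq, mul_assoc, mul_assoc]
  rfl

theorem det_hermGram {n : ℕ} {w : EuclideanSpace ℂ (Fin n)} (hw : ‖w‖ < 1)
    (u : Fin n → EuclideanSpace ℂ (Fin n)) :
    (hermGram w u).det = (colMatrix u).det * star (colMatrix u).det *
      (((1 - ‖w‖ ^ 2)⁻¹ : ℝ) : ℂ) ^ (n + 1) := by
  have h0 := one_sub_norm_sq_pos hw
  rw [hermGram_eq, Matrix.det_mul, Matrix.det_mul, Matrix.det_transpose, Matrix.det_smul,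
    Matrix.det_one_add_replicateCol_mul_replicateRow]
  have h1 : (1 + (fun a => w a) ⬝ᵥ fun a => (((1 - ‖w‖ ^ 2)⁻¹ : ℝ) : ℂ) * star (w a)) =
      (((1 - ‖w‖ ^ 2)⁻¹ : ℝ) : ℂ) := by
    have h2 : ((fun a => w a) ⬝ᵥ fun a => (((1 - ‖w‖ ^ 2)⁻¹ : ℝ) : ℂ) * star (w a)) =
        (((1 - ‖w‖ ^ 2)⁻¹ * ‖w‖ ^ 2 : ℝ) : ℂ) := by
      rw [EuclideanSpace.norm_sq_eq]
      simp only [dotProduct, Complex.ofReal_mul, Complex.ofReal_sum, Finset.mul_sum]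
      refine Finset.sum_congr rfl fun a _ => ?_
      rw [mul_left_comm, Complex.star_def, Complex.mul_conj, Complex.normSq_eq_norm_sq]
    rw [h2, ← Complex.ofReal_one, ← Complex.ofReal_add]
    congr 1
    field_simp
    ring
  have h3 : ((colMatrix u).map star).det = star (colMatrix u).det := by
    have := (RingHom.map_det (starRingEnd ℂ) (colMatrix u)).symm
    simpa using this
  rw [h1, h3, Fintype.card_fin]
  ring

/-! ### Smooth maps into complex hyperbolic space -/

theorem contMDiff_affineCoord {n : ℕ} :
    ContMDiff 𝓘(ℝ, EuclideanSpace ℂ (Fin n)) 𝓘(ℝ, EuclideanSpace ℂ (Fin n)) ∞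
      (affineCoord (n := n)) := fun q =>
  contMDiffAt_of_mem_maximalAtlas (IsManifold.chart_mem_maximalAtlas q)
    (mem_chart_source _ q)

theorem contMDiffOn_ofBall {n : ℕ} :
    ContMDiffOn 𝓘(ℝ, EuclideanSpace ℂ (Fin n)) 𝓘(ℝ, EuclideanSpace ℂ (Fin n)) ∞
      (ofBall (n := n)) (Metric.ball 0 1) :=
  contMDiffOn_symm_of_mem_maximalAtlas (e := ballChart n)
    (IsManifold.chart_mem_maximalAtlas (ofBall 0))

theorem mfderiv_affineCoord {n : ℕ} (q : CH n) (u : EuclideanSpace ℂ (Fin n)) :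
    mfderiv 𝓘(ℝ, EuclideanSpace ℂ (Fin n)) 𝓘(ℝ, EuclideanSpace ℂ (Fin n))
      (affineCoord (n := n)) q u = u := by
  have h : MDifferentiableAt 𝓘(ℝ, EuclideanSpace ℂ (Fin n)) 𝓘(ℝ, EuclideanSpace ℂ (Fin n))
      (affineCoord (n := n)) q := (contMDiff_affineCoord q).mdifferentiableAt (by simp)
  rw [h.mfderiv]
  have h2 : writtenInExtChartAt 𝓘(ℝ, EuclideanSpace ℂ (Fin n)) 𝓘(ℝ, EuclideanSpace ℂ (Fin n)) q
      (affineCoord (n := n)) =ᶠ[𝓝 (extChartAt 𝓘(ℝ, EuclideanSpace ℂ (Fin n)) q q)] id := by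
    filter_upwards [(ballChart n).open_target.mem_nhds ((ballChart n).map_source
      (Set.mem_univ q))] with x hx
    exact (ballChart n).right_inv hx
  rw [modelWithCornersSelf_coe, Set.range_id, fderivWithin_univ, h2.fderiv_eq, fderiv_id]
  rfl

section

variable {E : Type*} [NormedAddCommGroup E] [NormedSpace ℝ E]
  {H : Type*} [TopologicalSpace H] {I : ModelWithCorners ℝ E H}
  {M : Type*} [TopologicalSpace M] [ChartedSpace H M] {n : ℕ}

theorem dmap_eq {ψ : M → CH n} {p : M}
    (h : MDifferentiableAt I 𝓘(ℝ, EuclideanSpace ℂ (Fin n)) ψ p) (u : TangentSpace I p) :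
    dmap I ψ p u = mfderiv I 𝓘(ℝ, EuclideanSpace ℂ (Fin n)) (affineCoord ∘ ψ) p u := by
  rw [mfderiv_comp p ((contMDiff_affineCoord (ψ p)).mdifferentiableAt (by simp)) h]
  exact (mfderiv_affineCoord (ψ p) _).symm

theorem dmap_eq_fderiv {ψ : E → CH n} {x : E}
    (h : MDifferentiableAt 𝓘(ℝ, E) 𝓘(ℝ, EuclideanSpace ℂ (Fin n)) ψ x) (u : E) :
    dmap 𝓘(ℝ, E) ψ x u = fderiv ℝ (affineCoord ∘ ψ) x u := by
  exact (dmap_eq h u).trans (by rw [mfderiv_eq_fderiv]; rfl)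

theorem volDensity_eq {M ι : Type*} [Fintype ι] [DecidableEq ι] (b : Module.Basis ι ℝ E)
    {ψ : M → CH n} {φ : E → M} {x : E}
    (h : MDifferentiableAt 𝓘(ℝ, E) 𝓘(ℝ, EuclideanSpace ℂ (Fin n)) (ψ ∘ φ) x) :
    volDensity b ψ φ x = √(gram (affineCoord (ψ (φ x)))
      fun i => fderiv ℝ (affineCoord ∘ ψ ∘ φ) x (b i)).det := by
  simp only [volDensity, chMetric_eq, dmap_eq_fderiv h]
  rfl

theorem contMDiffAt_of_affineCoord {m : ℕ∞} {g : M → EuclideanSpace ℂ (Fin n)} {p : M}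
    (hg : ContMDiffAt I 𝓘(ℝ, EuclideanSpace ℂ (Fin n)) m g p) (hp : ‖g p‖ < 1) :
    ContMDiffAt I 𝓘(ℝ, EuclideanSpace ℂ (Fin n)) m (fun q => ofBall (g q)) p := by
  have h : ContMDiffAt 𝓘(ℝ, EuclideanSpace ℂ (Fin n)) 𝓘(ℝ, EuclideanSpace ℂ (Fin n)) m
      (ofBall (n := n)) (g p) :=
    (contMDiffOn_ofBall.contMDiffAt (Metric.isOpen_ball.mem_nhds
      (mem_ball_zero_iff.mpr hp))).of_le (by exact_mod_cast le_top)
  exact h.comp p hg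

end

/-! ### Gram determinants -/

theorem bergman_sum_left {n : ℕ} {ι : Type*} (s : Finset ι) (c : ι → ℝ)
    (w v : EuclideanSpace ℂ (Fin n)) (u : ι → EuclideanSpace ℂ (Fin n)) :
    bergman w (∑ i ∈ s, c i • u i) v = ∑ i ∈ s, (c i : ℂ) * bergman w (u i) v := by
  classical
  induction s using Finset.induction_on with
  | empty => simp [bergman]
  | insert a s ha ih =>
    rw [Finset.sum_insert ha, Finset.sum_insert ha, bergman_add_left, ih,
      ← Complex.coe_smul (c a), bergman_smul_left]

theorem bergman_sum_right {n : ℕ} {ι : Type*} (s : Finset ι) (c : ι → ℝ)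
    (w v : EuclideanSpace ℂ (Fin n)) (u : ι → EuclideanSpace ℂ (Fin n)) :
    bergman w v (∑ i ∈ s, c i • u i) = ∑ i ∈ s, (c i : ℂ) * bergman w v (u i) := by
  rw [← star_bergman, bergman_sum_left, star_sum]
  simp only [star_mul', star_bergman, Complex.star_def, Complex.conj_ofReal]

theorem bergman_sum_smul {n : ℕ} {ι : Type*} (s : Finset ι) (c d : ι → ℝ)
    (w : EuclideanSpace ℂ (Fin n)) (u : ι → EuclideanSpace ℂ (Fin n)) :
    (bergman w (∑ i ∈ s, c i • u i) (∑ j ∈ s, d j • u j)).re =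
      ∑ i ∈ s, ∑ j ∈ s, c i * (bergman w (u i) (u j)).re * d j := by
  rw [bergman_sum_left, Complex.re_sum]
  refine Finset.sum_congr rfl fun i _ => ?_
  rw [bergman_sum_right, Finset.mul_sum, Complex.re_sum]
  refine Finset.sum_congr rfl fun j _ => ?_
  rw [Complex.re_ofReal_mul, Complex.re_ofReal_mul]
  ring

theorem gram_sum_smul {n : ℕ} {ι κ : Type*} [Fintype ι] (w : EuclideanSpace ℂ (Fin n))
    (u : ι → EuclideanSpace ℂ (Fin n)) (P : Matrix ι κ ℝ) :
    (gram w fun j => ∑ i, P i j • u i) = P.transpose * gram w u * P := by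
  ext i j
  simp only [gram, Matrix.of_apply, bergman_sum_smul, Matrix.mul_apply, Matrix.transpose_apply,
    Finset.sum_mul]
  exact Finset.sum_comm

section

variable {E E' F : Type*} [AddCommGroup E] [Module ℝ E] [AddCommGroup E'] [Module ℝ E']
  {n : ℕ} {ι ι' : Type*} [Fintype ι] [DecidableEq ι] [Fintype ι'] [DecidableEq ι']

theorem gram_det_comp (b : Module.Basis ι ℝ E) (A : E →ₗ[ℝ] E) (w : EuclideanSpace ℂ (Fin n))
    (L : E →ₗ[ℝ] EuclideanSpace ℂ (Fin n)) :
    (gram w fun i => L (A (b i))).det =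
      LinearMap.det A ^ 2 * (gram w fun i => L (b i)).det := by
  have h : (fun i => L (A (b i))) =
      fun j => ∑ i, (LinearMap.toMatrix b b A) i j • L (b i) := by
    funext j
    rw [← b.sum_repr (A (b j)), map_sum]
    simp [LinearMap.toMatrix_apply]
  rw [h, gram_sum_smul, Matrix.det_mul, Matrix.det_mul, Matrix.det_transpose,
    LinearMap.det_toMatrix]
  ring

theorem exists_gram_det_eq (b : Module.Basis ι ℝ E) (b' : Module.Basis ι' ℝ E') (A : E' ≃ₗ[ℝ] E) :
    ∃ c : ℝ, 0 < c ∧ ∀ (w : EuclideanSpace ℂ (Fin n)) (L : E →ₗ[ℝ] EuclideanSpace ℂ (Fin n)),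
      (gram w fun i => L (A (b' i))).det = c * (gram w fun i => L (b i)).det := by
  let e : ι' ≃ ι := (b'.map A).indexEquiv b
  let b'' : Module.Basis ι ℝ E := (b'.map A).reindex e
  have hb : ∀ i, b'' (e i) = A (b' i) := by simp [b'']
  let B : E ≃ₗ[ℝ] E := b.equiv b'' (Equiv.refl ι)
  have hB : ∀ i, B (b i) = b'' i := by simp [B]
  refine ⟨LinearMap.det (B : E →ₗ[ℝ] E) ^ 2, ?_, fun w L => ?_⟩
  · have := (LinearEquiv.isUnit_det' B).ne_zero
    positivity
  · rw [← gram_det_comp b B w L]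
    have h : (gram w fun i => L (A (b' i))) = (gram w fun i => L (B (b i))).submatrix e e := by
      ext i j
      simp [gram, hB, hb]
    rw [h, Matrix.det_submatrix_equiv_self]
    rfl

end

/-! ### The inverse function theorem as a statement about partial homeomorphisms -/

/-- A smooth map on an open set with invertible derivative at a point restricts to a partial
homeomorphism which is smooth with smooth inverse. -/
theorem exists_openPartialHomeomorph_contDiffOn {E F : Type*} [NormedAddCommGroup E]
    [NormedSpace ℝ E] [CompleteSpace E] [NormedAddCommGroup F] [NormedSpace ℝ F]
    {f : E → F} {s : Set E} (hs : IsOpen s) (hf : ContDiffOn ℝ ∞ f s) {a : E} (ha : a ∈ s)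
    (f' : E ≃L[ℝ] F) (hf' : HasFDerivAt f (f' : E →L[ℝ] F) a) :
    ∃ g : OpenPartialHomeomorph E F, a ∈ g.source ∧ g.source ⊆ s ∧ (∀ x, g x = f x) ∧
      ContDiffOn ℝ ∞ g g.source ∧ ContDiffOn ℝ ∞ g.symm g.target := by
  have hfa : ContDiffAt ℝ ∞ f a := hf.contDiffAt (hs.mem_nhds ha)
  let g₀ := hfa.toOpenPartialHomeomorph f hf' (by simp)
  have hg₀ : ∀ x, g₀ x = f x := fun x =>
    congrFun (hfa.toOpenPartialHomeomorph_coe hf' (by simp)) x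
  have hcont : ContinuousOn (fderiv ℝ f) s := hf.continuousOn_fderiv_of_isOpen hs (by simp)
  let t : Set E := s ∩ fderiv ℝ f ⁻¹' Set.range ((↑) : (E ≃L[ℝ] F) → E →L[ℝ] F)
  have ht : IsOpen t := hcont.isOpen_inter_preimage hs ContinuousLinearEquiv.isOpen
  have hat : a ∈ t := ⟨ha, f', hf'.fderiv.symm⟩
  let g := g₀.restrOpen t ht
  have hgf : ∀ x, g x = f x := hg₀
  have hgs : g.source ⊆ t := fun x hx => by
    rw [OpenPartialHomeomorph.restrOpen_source] at hx
    exact hx.2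
  have hgfun : (g : E → F) = f := funext hgf
  refine ⟨g, ?_, fun x hx => (hgs hx).1, hgf, ?_, ?_⟩
  · rw [OpenPartialHomeomorph.restrOpen_source]
    exact ⟨hfa.mem_toOpenPartialHomeomorph_source hf' (by simp), hat⟩
  · rw [hgfun]
    exact hf.mono fun x hx => (hgs hx).1
  · intro y hy
    have hx : g.symm y ∈ g.source := g.map_target hy
    obtain ⟨hxs, e, he⟩ := hgs hx
    refine (g.contDiffAt_symm hy (f₀' := e) ?_ ?_).contDiffWithinAt
    · rw [hgfun, he]
      exact ((hf.contDiffAt (hs.mem_nhds hxs)).differentiableAt (by simp)).hasFDerivAt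
    · rw [hgfun]
      exact hf.contDiffAt (hs.mem_nhds hxs)

/-- An injective linear map into a finite dimensional space extends to an isomorphism from a
product. -/
theorem exists_continuousLinearEquiv_prod {E F G : Type*} [NormedAddCommGroup E] [NormedSpace ℝ E]
    [FiniteDimensional ℝ E] [NormedAddCommGroup F] [NormedSpace ℝ F] [FiniteDimensional ℝ F]
    [NormedAddCommGroup G] [NormedSpace ℝ G] [FiniteDimensional ℝ G] (L : E →L[ℝ] G)
    (hL : Function.Injective L)
    (hd : Module.finrank ℝ E + Module.finrank ℝ F = Module.finrank ℝ G) :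
    ∃ e : (E × F) ≃L[ℝ] G, ∀ u, e (u, 0) = L u := by
  obtain ⟨S, hS⟩ := Submodule.exists_isCompl (LinearMap.range (L : E →ₗ[ℝ] G))
  have h1 := Submodule.finrank_add_eq_of_isCompl hS
  rw [LinearMap.finrank_range_of_inj hL] at h1
  let i : F ≃ₗ[ℝ] S := LinearEquiv.ofFinrankEq _ _ (by omega)
  let j : E ≃ₗ[ℝ] LinearMap.range (L : E →ₗ[ℝ] G) := LinearEquiv.ofInjective (L : E →ₗ[ℝ] G) hL
  let e : (E × F) ≃ₗ[ℝ] G := (j.prodCongr i).trans (Submodule.prodEquivOfIsCompl _ _ hS)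
  refine ⟨e.toContinuousLinearEquiv, fun u => ?_⟩
  simp [e, j]

/-! ### Maps with injective differential are immersions -/

section

variable {E : Type*} [NormedAddCommGroup E] [NormedSpace ℝ E] [FiniteDimensional ℝ E]
  {G : Type} [NormedAddCommGroup G] [NormedSpace ℝ G] [FiniteDimensional ℝ G]
  {F : Type*} [NormedAddCommGroup F] [NormedSpace ℝ F] [FiniteDimensional ℝ F]
  {H : Type*} [TopologicalSpace H] {I : ModelWithCorners ℝ E H} [I.Boundaryless]
  {M : Type*} [TopologicalSpace M] [ChartedSpace H M] [IsManifold I ∞ M]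
  {N : Type*} [TopologicalSpace N] [ChartedSpace G N] [IsManifold 𝓘(ℝ, G) ∞ N]

theorem isImmersionAtOfComplement_of_mfderiv_injective {f : M → N} {p : M}
    (hf : ContMDiff I 𝓘(ℝ, G) ∞ f)
    (hinj : Function.Injective (mfderiv I 𝓘(ℝ, G) f p))
    (hd : Module.finrank ℝ E + Module.finrank ℝ F = Module.finrank ℝ G) :
    Manifold.IsImmersionAtOfComplement F I 𝓘(ℝ, G) ∞ f p := by
  have : CompleteSpace E := FiniteDimensional.complete ℝ E
  have : CompleteSpace F := FiniteDimensional.complete ℝ F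
  let D : E →L[ℝ] G := mfderiv I 𝓘(ℝ, G) f p
  let w : E → G := writtenInExtChartAt I 𝓘(ℝ, G) p f
  let O : Set E := (extChartAt I p).target ∩
    (extChartAt I p).symm ⁻¹' (f ⁻¹' (chartAt G (f p)).source)
  have hOopen : IsOpen O := by
    refine (continuousOn_extChartAt_symm p).isOpen_inter_preimage (isOpen_extChartAt_target p) ?_
    exact (chartAt G (f p)).open_source.preimage hf.continuous
  have hpO : extChartAt I p p ∈ O := by
    refine ⟨mem_extChartAt_target p, ?_⟩
    simp
  have hw : ContDiffOn ℝ ∞ w O := by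
    have := (contMDiff_iff.mp hf).2 p (f p)
    refine this.mono fun x hx => ?_
    simpa [O] using hx
  have hwd : HasFDerivAt w D (extChartAt I p p) := by
    have h := (hf p).mdifferentiableAt (by simp)
    have h2 := h.hasMFDerivAt.2
    rw [I.range_eq_univ] at h2
    exact hasFDerivWithinAt_univ.mp h2
  obtain ⟨e, he⟩ := exists_continuousLinearEquiv_prod (F := F)
    D hinj hd
  let Γ : E × F → G := fun z => w z.1 + e (0, z.2)
  have hΓ : ContDiffOn ℝ ∞ Γ (O ×ˢ Set.univ) := by
    refine ContDiffOn.add ?_ ?_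
    · exact hw.comp contDiff_fst.contDiffOn fun z hz => hz.1
    · exact (e.contDiff.comp (contDiff_const.prodMk contDiff_snd)).contDiffOn
  have hΓd : HasFDerivAt Γ (e : E × F →L[ℝ] G) (extChartAt I p p, 0) := by
    have h1 : HasFDerivAt (fun z : E × F => w z.1)
        (D.comp (ContinuousLinearMap.fst ℝ E F))
        (extChartAt I p p, 0) :=
      HasFDerivAt.comp (g := w) _ hwd hasFDerivAt_fst
    have h2 : HasFDerivAt (fun z : E × F => e (0, z.2))
        ((e : E × F →L[ℝ] G).comp ((ContinuousLinearMap.inr ℝ E F).comp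
          (ContinuousLinearMap.snd ℝ E F))) (extChartAt I p p, 0) :=
      ContinuousLinearMap.hasFDerivAt ((e : E × F →L[ℝ] G).comp
        ((ContinuousLinearMap.inr ℝ E F).comp (ContinuousLinearMap.snd ℝ E F)))
    refine (h1.add h2).congr_fderiv ?_
    ext z
    · have h0 : e ((0 : E), (0 : F)) = 0 := e.map_zero
      simpa [h0] using (he z).symm
    · simp
  obtain ⟨g, hg1, hg2, hg3, hg4, hg5⟩ := exists_openPartialHomeomorph_contDiffOn
    (hOopen.prod isOpen_univ) hΓ ⟨hpO, Set.mem_univ _⟩ e hΓd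
  let k : OpenPartialHomeomorph G G := g.symm ≫ₕ e.toHomeomorph.toOpenPartialHomeomorph
  let cod : OpenPartialHomeomorph N G := chartAt G (f p) ≫ₕ k
  have hk1 : ContDiffOn ℝ ∞ k k.source := by
    have : k.source = g.target := by simp [k]
    rw [this]
    exact e.contDiff.comp_contDiffOn hg5
  have hk2 : ContDiffOn ℝ ∞ k.symm k.target := by
    have : k.target = e.symm ⁻¹' g.source := by
      ext y
      simp [k]
    rw [this]
    exact hg4.comp e.symm.contDiff.contDiffOn fun y hy => hy
  have hcod : cod ∈ IsManifold.maximalAtlas 𝓘(ℝ, G) ∞ N := by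
    refine cod.mem_maximalAtlas_of_contMDiffOn ?_ ?_
    · refine ContMDiffOn.comp (t := k.source) hk1.contMDiffOn
        ((contMDiffOn_chart (x := f p)).mono ?_) ?_
      · intro q hq
        simp only [cod, OpenPartialHomeomorph.trans_source] at hq
        exact hq.1
      · intro q hq
        simp only [cod, OpenPartialHomeomorph.trans_source] at hq
        exact hq.2
    · refine ContMDiffOn.comp (t := (chartAt G (f p)).target) (f := k.symm)
        (contMDiffOn_chart_symm (x := f p)) (hk2.contMDiffOn.mono ?_) ?_
      · intro q hq
        simp only [cod, OpenPartialHomeomorph.trans_target] at hq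
        exact hq.1
      · intro q hq
        simp only [cod, OpenPartialHomeomorph.trans_target] at hq
        exact hq.2
  let V : Set M := (chartAt H p).source ∩ extChartAt I p ⁻¹' ((fun x : E => (x, (0 : F))) ⁻¹' g.source)
  have hV : IsOpen V := by
    refine ContinuousOn.isOpen_inter_preimage ?_ (chartAt H p).open_source
      (g.open_source.preimage (by fun_prop))
    simpa using continuousOn_extChartAt (I := I) p
  have hpV : p ∈ V := ⟨mem_chart_source H p, hg1⟩
  let dom : OpenPartialHomeomorph M H := (chartAt H p).restr V
  have hdom : dom ∈ IsManifold.maximalAtlas I ∞ M := restr_mem_maximalAtlas (contDiffGroupoid ∞ I)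
    (IsManifold.chart_mem_maximalAtlas (I := I) (n := ∞) p) hV
  have hdoms : dom.source = (chartAt H p).source ∩ V := (chartAt H p).restr_source' V hV
  have hgw : ∀ x : E, (x, (0 : F)) ∈ g.source → w x ∈ g.target ∧ g.symm (w x) = (x, 0) := by
    intro x hx
    have h1 : g (x, 0) = w x := by
      rw [hg3]
      simp [Γ]
    rw [← h1]
    exact ⟨g.map_source hx, g.left_inv hx⟩
  have hwp : w (extChartAt I p p) = chartAt G (f p) (f p) := by
    simp [w, writtenInExtChartAt]
  refine Manifold.IsImmersionAtOfComplement.mk_of_continuousAt hf.continuous.continuousAt e dom cod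
    ?_ ?_ hdom hcod ?_
  · rw [hdoms]
    exact ⟨mem_chart_source H p, hpV⟩
  · simp only [cod, OpenPartialHomeomorph.trans_source]
    refine ⟨mem_chart_source G (f p), ?_⟩
    have := (hgw _ hg1).1
    rw [hwp] at this
    simpa [k] using this
  · intro x hx
    have hx1 : (dom.extend I).symm x ∈ (chartAt H p).source ∩ V := by
      have := (dom.extend I).map_target hx
      rwa [OpenPartialHomeomorph.extend_source, hdoms] at this
    have hx2 : x = extChartAt I p ((dom.extend I).symm x) := ((dom.extend I).right_inv hx).symm
    have hx3 : (x, (0 : F)) ∈ g.source := by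
      have : (dom.extend I).symm x ∈ V := hx1.2
      have := this.2
      rwa [Set.mem_preimage, ← hx2] at this
    have h := (hgw x hx3).2
    change e (g.symm (w x)) = e (x, 0)
    rw [h]

theorem isImmersion_of_mfderiv_injective {f : M → N} (hf : ContMDiff I 𝓘(ℝ, G) ∞ f)
    (hinj : ∀ p, Function.Injective (mfderiv I 𝓘(ℝ, G) f p)) {d : ℕ}
    (hd : Module.finrank ℝ E + d = Module.finrank ℝ G) :
    Manifold.IsImmersion I 𝓘(ℝ, G) ∞ f :=
  ⟨EuclideanSpace ℝ (Fin d), inferInstance, inferInstance, fun p =>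
    isImmersionAtOfComplement_of_mfderiv_injective hf (hinj p) (by simpa using hd)⟩

end

/-! ### The derivative of a determinant -/

theorem hasFDerivAt_det {E 𝔸 ι : Type*} [NormedAddCommGroup E] [NormedSpace ℝ E]
    [NormedCommRing 𝔸] [NormedAlgebra ℝ 𝔸] [Fintype ι] [DecidableEq ι] {A : E → Matrix ι ι 𝔸}
    {A' : ι → ι → E →L[ℝ] 𝔸} {x : E} (h : ∀ i j, HasFDerivAt (fun y => A y i j) (A' i j) x) :
    HasFDerivAt (fun y => (A y).det) (∑ i, ∑ j, (A x).adjugate j i • A' i j) x := by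
  have h1 : HasFDerivAt (fun y => (A y).det)
      (∑ σ : Equiv.Perm ι, (Equiv.Perm.sign σ : ℤ) •
        ∑ j, (∏ k ∈ Finset.univ.erase j, A x (σ k) k) • A' (σ j) j) x := by
    simp only [Matrix.det_apply]
    refine HasFDerivAt.fun_sum fun σ _ => ?_
    have := HasFDerivAt.finsetProd (u := Finset.univ) (x := x) fun k _ => h (σ k) k
    exact this.const_smul (Equiv.Perm.sign σ : ℤ)
  refine h1.congr_fderiv ?_
  ext v
  have h2 : ∀ j, ∑ i, (A x).adjugate j i * A' i j v =
      ((A x).updateCol j fun i => A' i j v).det := by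
    intro j
    rw [← Matrix.cramer_apply, Matrix.cramer_eq_adjugate_mulVec]
    rfl
  simp only [sum_apply, smul_apply, smul_eq_mul]
  rw [Finset.sum_comm (f := fun i j => (A x).adjugate j i * A' i j v)]
  simp only [h2, Matrix.det_apply, Finset.smul_sum]
  rw [Finset.sum_comm]
  refine Finset.sum_congr rfl fun j _ => Finset.sum_congr rfl fun σ _ => ?_
  rw [← Finset.mul_prod_erase _ _ (Finset.mem_univ j), Matrix.updateCol_self, mul_comm]
  congr 2
  refine Finset.prod_congr rfl fun k hk => ?_
  rw [Matrix.updateCol_ne (Finset.ne_of_mem_erase hk)]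

theorem hasDerivAt_det {𝔸 ι : Type*} [NormedCommRing 𝔸] [NormedAlgebra ℝ 𝔸] [Fintype ι]
    [DecidableEq ι] {A : ℝ → Matrix ι ι 𝔸} {A' : Matrix ι ι 𝔸} {x : ℝ}
    (h : ∀ i j, HasDerivAt (fun y => A y i j) (A' i j) x) :
    HasDerivAt (fun y => (A y).det) (∑ i, ∑ j, (A x).adjugate j i * A' i j) x := by
  have h1 := (hasFDerivAt_det fun i j => (h i j).hasFDerivAt).hasDerivAt
  refine h1.congr_deriv ?_
  simp

/-- To first order at a real matrix, the determinant of the real part of a matrix is the real part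
of its determinant. -/
theorem hasDerivAt_det_re {ι : Type*} [Fintype ι] [DecidableEq ι] {A : ℝ → Matrix ι ι ℂ}
    {A' : Matrix ι ι ℂ} {x : ℝ} (h : ∀ i j, HasDerivAt (fun y => A y i j) (A' i j) x)
    (hre : ∀ i j, (A x i j).im = 0) {d : ℝ} (hd : HasDerivAt (fun y => (A y).det) (d : ℂ) x) :
    HasDerivAt (fun y => ((A y).map Complex.re).det) d x := by
  have h1 := hasDerivAt_det (A := fun y => (A y).map Complex.re) (A' := A'.map Complex.re)
    (x := x) fun i j => by
      exact Complex.reCLM.hasFDerivAt.comp_hasDerivAt x (h i j)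
  have h2 := (hasDerivAt_det h).unique hd
  refine h1.congr_deriv ?_
  have h3 : A x = ((A x).map Complex.re).map Complex.ofRealHom := by
    ext i j
    apply Complex.ext
    · simp
    · simpa using hre i j
  have h4 : (A x).adjugate = ((A x).map Complex.re).adjugate.map Complex.ofRealHom := by
    conv_lhs => rw [h3]
    exact (RingHom.map_adjugate Complex.ofRealHom _).symm
  rw [← Complex.ofReal_re d, ← h2, Complex.re_sum]
  refine Finset.sum_congr rfl fun i _ => ?_
  rw [Complex.re_sum]
  refine Finset.sum_congr rfl fun j _ => ?_
  rw [h4]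
  simp

/-- The divergence of a vector field in a moving frame `U` whose coordinate derivatives are
symmetric. -/
theorem sum_adjugate_mul_fderiv {E : Type*} [NormedAddCommGroup E] [NormedSpace ℝ E] {n : ℕ}
    (b : Fin n → E) {U : E → Matrix (Fin n) (Fin n) ℂ} {U' : Fin n → Fin n → E →L[ℝ] ℂ}
    {Z V : Fin n → E → ℂ} {Z' V' : Fin n → E →L[ℝ] ℂ} {x : E}
    (hU : ∀ a i, HasFDerivAt (fun y => U y a i) (U' a i) x)
    (hsymm : ∀ a i k, U' a k (b i) = U' a i (b k))
    (hZ : ∀ k, HasFDerivAt (Z k) (Z' k) x)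
    (hV : ∀ a, HasFDerivAt (V a) (V' a) x)
    (hVZ : ∀ a, V a =ᶠ[𝓝 x] fun y => ∑ k, Z k y * U y a k) :
    ∑ a, ∑ i, (U x).adjugate i a * V' a (b i) =
      (U x).det * ∑ i, Z' i (b i) +
        ∑ k, Z k x * ∑ a, ∑ i, (U x).adjugate i a * U' a i (b k) := by
  have h1 : ∀ a i, V' a (b i) = ∑ k, (Z k x * U' a i (b k) + U x a k * Z' k (b i)) := by
    intro a i
    have h2 : HasFDerivAt (fun y => ∑ k, Z k y * U y a k)
        (∑ k, (Z k x • U' a k + U x a k • Z' k)) x :=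
      HasFDerivAt.fun_sum fun k _ => (hZ k).mul (hU a k)
    rw [(hV a).unique (h2.congr_of_eventuallyEq (hVZ a))]
    simp [hsymm a i]
  have h3 : ∀ i k, ∑ a, (U x).adjugate i a * U x a k = if i = k then (U x).det else 0 := by
    intro i k
    have := congrFun (congrFun (Matrix.adjugate_mul (U x)) i) k
    rw [Matrix.mul_apply] at this
    rw [this]
    simp [Matrix.one_apply]
  simp only [h1, Finset.sum_add_distrib, mul_add, Finset.mul_sum]
  rw [add_comm]
  congr 1
  · calc ∑ a, ∑ i, ∑ k, (U x).adjugate i a * (U x a k * Z' k (b i))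
        = ∑ i, ∑ k, (∑ a, (U x).adjugate i a * U x a k) * Z' k (b i) := by
          rw [Finset.sum_comm]
          refine Finset.sum_congr rfl fun i _ => ?_
          rw [Finset.sum_comm]
          refine Finset.sum_congr rfl fun k _ => ?_
          rw [Finset.sum_mul]
          exact Finset.sum_congr rfl fun a _ => by ring
      _ = ∑ i, (U x).det * Z' i (b i) := by simp [h3]
  · calc ∑ a, ∑ i, ∑ k, (U x).adjugate i a * (Z k x * U' a i (b k))
        = ∑ a, ∑ k, ∑ i, (U x).adjugate i a * (Z k x * U' a i (b k)) :=
          Finset.sum_congr rfl fun a _ => Finset.sum_comm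
      _ = ∑ k, ∑ a, ∑ i, (U x).adjugate i a * (Z k x * U' a i (b k)) := Finset.sum_comm
      _ = _ := by
          refine Finset.sum_congr rfl fun k _ => Finset.sum_congr rfl fun a _ =>
            Finset.sum_congr rfl fun i _ => by ring

/-! ### Regularity of Gram determinants -/

section

variable {E : Type*} [NormedAddCommGroup E] [NormedSpace ℝ E] {n : ℕ} {m : ℕ∞ω}

theorem _root_.ContDiffAt.bergman {w u v : E → EuclideanSpace ℂ (Fin n)} {x : E}
    (hw : ContDiffAt ℝ m w x) (hu : ContDiffAt ℝ m u x) (hv : ContDiffAt ℝ m v x)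
    (h1 : ‖w x‖ < 1) : ContDiffAt ℝ m (fun y => bergman (w y) (u y) (v y)) x := by
  have h2 : ContDiffAt ℝ m (fun y => (((1 - ‖w y‖ ^ 2)⁻¹ : ℝ) : ℂ)) x := by
    have h3 : ContDiffAt ℝ m (fun y => (1 - ‖w y‖ ^ 2)⁻¹) x :=
      (contDiffAt_const.sub (hw.norm_sq ℂ)).inv (one_sub_norm_sq_pos h1).ne'
    exact Complex.ofRealCLM.contDiff.contDiffAt.comp x h3
  exact (h2.mul (hv.inner ℂ hu)).add ((h2.pow 2).mul ((hw.inner ℂ hu).mul (hv.inner ℂ hw)))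

theorem _root_.ContDiffAt.matrix_det {ι : Type*} [Fintype ι] [DecidableEq ι]
    {A : E → Matrix ι ι ℝ} {x : E} (h : ∀ i j, ContDiffAt ℝ m (fun y => A y i j) x) :
    ContDiffAt ℝ m (fun y => (A y).det) x := by
  simp only [Matrix.det_apply]
  refine ContDiffAt.sum fun σ _ => ?_
  exact (contDiffAt_prod fun i _ => h _ _).const_smul (Equiv.Perm.sign σ : ℤ)

theorem _root_.ContDiffAt.gram_det {ι : Type*} [Fintype ι] [DecidableEq ι]
    {w : E → EuclideanSpace ℂ (Fin n)} {u : E → ι → EuclideanSpace ℂ (Fin n)} {x : E}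
    (hw : ContDiffAt ℝ m w x) (hu : ∀ i, ContDiffAt ℝ m (fun y => u y i) x)
    (h1 : ‖w x‖ < 1) : ContDiffAt ℝ m (fun y => (gram (w y) (u y)).det) x :=
  ContDiffAt.matrix_det fun i j =>
    Complex.reCLM.contDiff.contDiffAt.comp x (hw.bergman (hu i) (hu j) h1)

end

/-! ### The first variation of the Gram determinant -/

section

variable {E : Type*} [NormedAddCommGroup E] [NormedSpace ℝ E] {n : ℕ}

theorem fderiv_im_eq_zero {f : E → ℂ} {f' : E →L[ℝ] ℂ} {x : E} (hf : HasFDerivAt f f' x)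
    (h : ∀ᶠ y in 𝓝 x, (f y).im = 0) (v : E) : (f' v).im = 0 := by
  have h1 : HasFDerivAt (fun y => (f y).im) (Complex.imCLM.comp f') x :=
    Complex.imCLM.hasFDerivAt.comp x hf
  have h2 := h1.unique ((hasFDerivAt_const (0 : ℝ) x).congr_of_eventuallyEq h)
  exact congrArg (fun L => L v) h2

/-- If a complex function has the argument `m ℓ` up to a constant, with `ℓ` linear, then its
logarithmic derivative has imaginary part `m ℓ`. -/
theorem im_star_mul_fderiv {f : E → ℂ} {f' : E →L[ℝ] ℂ} {x : E} (hf : HasFDerivAt f f' x)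
    (m : ℝ) (ℓ : E →L[ℝ] ℝ) (c : ℂ) (hc : c ≠ 0)
    (h : ∀ y, ∃ β : ℝ, f y = Complex.exp ((m * ℓ y : ℝ) * Complex.I) * β * c) (v : E) :
    (star (f x) * f' v).im = m * ℓ v * ‖f x‖ ^ 2 := by
  let e : E → ℂ := fun y => Complex.exp ((m * ℓ y : ℝ) * Complex.I)
  let g : E → ℂ := fun y => Complex.exp (-((m * ℓ y : ℝ) * Complex.I)) * f y * c⁻¹
  have hlin : HasFDerivAt (fun y => ((m * ℓ y : ℝ) : ℂ) * Complex.I)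
      ((Complex.ofRealCLM.comp (m • ℓ)).smulRight Complex.I) x := by
    have h1 := (Complex.ofRealCLM.comp (m • ℓ)).hasFDerivAt (x := x)
    have h2 := h1.mul_const Complex.I
    refine h2.congr_fderiv ?_
    ext y
    simp [mul_comm]
  have he := hlin.cexp
  obtain ⟨g', hg⟩ : ∃ g' : E →L[ℝ] ℂ, HasFDerivAt g g' x :=
    ⟨_, (hlin.neg.cexp.mul hf).mul_const c⁻¹⟩
  have hfe : ∀ y, f y = e y * g y * c := by
    intro y
    simp only [e, g, Complex.exp_neg]
    field_simp [Complex.exp_ne_zero]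
  have hgim : ∀ y, (g y).im = 0 := by
    intro y
    obtain ⟨β, hβ⟩ := h y
    have : g y = β := by
      simp only [g, hβ, Complex.exp_neg]
      field_simp [Complex.exp_ne_zero]
    rw [this, Complex.ofReal_im]
  have hg0 := fderiv_im_eq_zero hg (Filter.Eventually.of_forall hgim) v
  have hf2 : HasFDerivAt f _ x := ((he.mul hg).mul_const c).congr_of_eventuallyEq
    (Filter.Eventually.of_forall hfe)
  have hfv := congrArg (fun L : E →L[ℝ] ℂ => L v) (hf.unique hf2)
  simp only [smul_apply, add_apply, ContinuousLinearMap.smulRight_apply,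
    ContinuousLinearMap.comp_apply, Complex.ofRealCLM_apply, smul_eq_mul] at hfv
  have hee : star (e x) * e x = 1 := by
    rw [Complex.star_def, mul_comm, Complex.mul_conj, Complex.normSq_eq_norm_sq]
    simp only [e, Complex.norm_exp_ofReal_mul_I]
    simp
  have hgx : star (g x) = g x := Complex.conj_eq_iff_im.mpr (hgim x)
  have hff : star (f x) * f x = (‖f x‖ ^ 2 : ℝ) := by
    rw [Complex.star_def, mul_comm, Complex.mul_conj, Complex.normSq_eq_norm_sq]
  have hcc : star c * c = (‖c‖ ^ 2 : ℝ) := by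
    rw [Complex.star_def, mul_comm, Complex.mul_conj, Complex.normSq_eq_norm_sq]
  have key : star (f x) * f' v =
      (‖f x‖ ^ 2 : ℝ) * ((m * ℓ v : ℝ) * Complex.I) + (‖c‖ ^ 2 : ℝ) * (g x * g' v) := by
    have h5 : f' v = ((m * ℓ v : ℝ) * Complex.I) * f x + e x * g' v * c := by
      rw [hfv, hfe x]
      simp only [e]
      ring
    rw [h5, mul_add, ← hff]
    congr 1
    · ring
    · rw [hfe x, star_mul', star_mul', hgx, ← hcc]
      linear_combination (g x * star c * g' v * c) * hee
  rw [key, Complex.add_im, Complex.im_ofReal_mul, Complex.im_ofReal_mul, Complex.im_ofReal_mul,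
    Complex.mul_im, hgim x, hg0]
  simp only [Complex.I_im, mul_one, mul_zero, zero_mul, add_zero]
  ring

/-- The first variation of the Gram determinant of a variation of a Lagrangian immersion in the
direction of `i` times the tangent vector `∑ X_k ∂_k`, if the complex determinant of the coordinate
frame has the argument `m ℓ` up to a constant. -/
theorem hasDerivAt_gram_det (b : Fin n → E) {w : ℝ × E → EuclideanSpace ℂ (Fin n)} {ε : ℝ}
    (hε : 0 < ε) (hw : ContDiffOn ℝ ∞ w (Set.Ioo (-ε) ε ×ˢ Set.univ)) (hball : ∀ z, ‖w z‖ < 1)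
    (x₀ : E)
    (hlag : ∀ i j, (bergman (w (0, x₀)) (fderiv ℝ w (0, x₀) (0, b i))
      (fderiv ℝ w (0, x₀) (0, b j))).im = 0)
    (X : E → Fin n → ℝ)
    (hX : ∀ x, fderiv ℝ w (0, x) (1, 0) =
      Complex.I • ∑ k, X x k • fderiv ℝ w (0, x) (0, b k))
    (m : ℝ) (ℓ : E →L[ℝ] ℝ) (c : ℂ) (hc : c ≠ 0)
    (hdet : ∀ x, ∃ β : ℝ, (colMatrix fun i => fderiv ℝ w (0, x) (0, b i)).det =
      Complex.exp ((m * ℓ x : ℝ) * Complex.I) * β * c)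
    (hne : (colMatrix fun i => fderiv ℝ w (0, x₀) (0, b i)).det ≠ 0) :
    HasDerivAt (fun t => (gram (w (t, x₀)) fun i => fderiv ℝ w (t, x₀) (0, b i)).det)
      (2 * (gram (w (0, x₀)) fun i => fderiv ℝ w (0, x₀) (0, b i)).det *
        (-(m * ∑ k, X x₀ k * ℓ (b k)) + (n + 1) * (1 - ‖w (0, x₀)‖ ^ 2)⁻¹ *
          (inner ℂ (w (0, x₀)) (fderiv ℝ w (0, x₀) (1, 0))).re)) 0 := by
  have hS : IsOpen (Set.Ioo (-ε) ε ×ˢ (Set.univ : Set E)) := isOpen_Ioo.prod isOpen_univ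
  have hmem : ∀ x : E, ((0 : ℝ), x) ∈ Set.Ioo (-ε) ε ×ˢ (Set.univ : Set E) := fun x =>
    ⟨⟨by linarith, hε⟩, Set.mem_univ _⟩
  have hw0 : ∀ x, ContDiffAt ℝ ∞ w (0, x) := fun x => hw.contDiffAt (hS.mem_nhds (hmem x))
  have hD : ∀ x, ContDiffAt ℝ ∞ (fderiv ℝ w) (0, x) := fun x =>
    (hw0 x).fderiv_right (m := ∞) (by simp)
  let F := fderiv ℝ (fderiv ℝ w) (0, x₀)
  have hF : HasFDerivAt (fderiv ℝ w) F (0, x₀) := ((hD x₀).differentiableAt (by simp)).hasFDerivAt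
  have hsymm : ∀ v v', F v v' = F v' v := by
    have h1 : IsSymmSndFDerivAt ℝ w (0, x₀) := (hw0 x₀).isSymmSndFDerivAt (by
      simp only [minSmoothness_of_isRCLikeNormedField]
      exact WithTop.coe_le_coe.mpr (le_top : (2 : ℕ∞) ≤ ⊤))
    exact fun v v' => h1 v v'
  let ev : Fin n → EuclideanSpace ℂ (Fin n) →L[ℝ] ℂ := fun a =>
    (EuclideanSpace.proj a : EuclideanSpace ℂ (Fin n) →L[ℂ] ℂ).restrictScalars ℝ
  have hFv : ∀ v : ℝ × E, ∀ a, HasFDerivAt (fun z => fderiv ℝ w z v a)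
      ((ev a).comp ((ContinuousLinearMap.apply ℝ _ v).comp F)) (0, x₀) := by
    intro v a
    have h1 : HasFDerivAt (fun z => fderiv ℝ w z v)
        ((ContinuousLinearMap.apply ℝ (EuclideanSpace ℂ (Fin n)) v).comp F) (0, x₀) :=
      (ContinuousLinearMap.apply ℝ (EuclideanSpace ℂ (Fin n)) v).hasFDerivAt.comp _ hF
    exact (ev a).hasFDerivAt.comp _ h1
  have hι₁ : HasDerivAt (fun t : ℝ => (t, x₀)) ((1 : ℝ), (0 : E)) 0 :=
    (hasDerivAt_id (0 : ℝ)).prodMk (hasDerivAt_const 0 x₀)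
  have hι₂ : HasFDerivAt (fun x : E => ((0 : ℝ), x)) (ContinuousLinearMap.inr ℝ ℝ E) x₀ :=
    (ContinuousLinearMap.inr ℝ ℝ E).hasFDerivAt
  -- the frame and its determinant
  let U : E → Matrix (Fin n) (Fin n) ℂ := fun x => colMatrix fun i => fderiv ℝ w (0, x) (0, b i)
  let U' : Fin n → Fin n → E →L[ℝ] ℂ := fun a i => ((ev a).comp
    ((ContinuousLinearMap.apply ℝ _ ((0 : ℝ), b i)).comp F)).comp (ContinuousLinearMap.inr ℝ ℝ E)
  have hU : ∀ a i, HasFDerivAt (fun x => U x a i) (U' a i) x₀ := fun a i =>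
    HasFDerivAt.comp (f := fun x : E => ((0 : ℝ), x)) x₀ (hFv (0, b i) a) hι₂
  let V : Fin n → E → ℂ := fun a x => fderiv ℝ w (0, x) (1, 0) a
  let V' : Fin n → E →L[ℝ] ℂ := fun a => ((ev a).comp
    ((ContinuousLinearMap.apply ℝ _ ((1 : ℝ), (0 : E))).comp F)).comp
      (ContinuousLinearMap.inr ℝ ℝ E)
  have hV : ∀ a, HasFDerivAt (V a) (V' a) x₀ := fun a =>
    HasFDerivAt.comp (f := fun x : E => ((0 : ℝ), x)) x₀ (hFv (1, 0) a) hι₂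
  have hUdet := hasFDerivAt_det hU
  -- the components of the variation field
  let Z : Fin n → E → ℂ := fun k x => Complex.I * X x k
  have hVZ : ∀ a x, V a x = ∑ k, Z k x * U x a k := by
    intro a x
    simp only [V, hX x, U, colMatrix, Z, PiLp.smul_apply, smul_eq_mul, Matrix.of_apply]
    rw [WithLp.ofLp_sum, Finset.sum_apply, Finset.mul_sum]
    refine Finset.sum_congr rfl fun k _ => ?_
    simp
    ring
  have hZd : ∀ k, DifferentiableAt ℝ (Z k) x₀ := by
    intro k
    have h1 : DifferentiableAt ℝ (fun x => ((U x).det)⁻¹ *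
        ((U x).updateCol k fun a => V a x).det) x₀ := by
      refine (hUdet.differentiableAt.inv hne).mul ?_
      refine (hasFDerivAt_det (A := fun x => (U x).updateCol k fun a => V a x)
        (A' := fun a i => if i = k then V' a else U' a i) fun a i => ?_).differentiableAt
      by_cases h : i = k
      · subst h
        simpa using hV a
      · simpa [h] using hU a i
    refine h1.congr_of_eventuallyEq ?_
    have h2 : ∀ᶠ x in 𝓝 x₀, (U x).det ≠ 0 := hUdet.continuousAt.eventually_ne hne
    filter_upwards [h2] with x hx
    have h3 : (fun a => V a x) = (U x).mulVec fun k => Z k x := by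
      funext a
      rw [hVZ]
      simp only [Matrix.mulVec, dotProduct]
      exact Finset.sum_congr rfl fun _ _ => mul_comm _ _
    rw [← Matrix.cramer_apply, h3, Matrix.cramer_eq_adjugate_mulVec, Matrix.mulVec_mulVec,
      Matrix.adjugate_mul, Matrix.smul_mulVec, Matrix.one_mulVec, Pi.smul_apply, smul_eq_mul,
      inv_mul_cancel_left₀ hx]
  have hZre : ∀ k v, ((fderiv ℝ (Z k) x₀) v).re = 0 := by
    intro k v
    have h1 := ((hZd k).hasFDerivAt.const_mul (-Complex.I))
    have h2 := fderiv_im_eq_zero h1 (Filter.Eventually.of_forall fun x => by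
      simp only [Z]
      rw [← mul_assoc]
      simp) v
    simpa using h2
  have hdiv := sum_adjugate_mul_fderiv b hU (fun a i k => by
      simp only [U', ContinuousLinearMap.comp_apply, ContinuousLinearMap.apply_apply,
        ContinuousLinearMap.inr_apply]
      rw [hsymm]) (fun k => (hZd k).hasFDerivAt) hV
      (fun a => Filter.Eventually.of_forall (hVZ a))
  -- the derivative in time of the complex determinant
  have hUt : HasDerivAt (fun t => (colMatrix fun i => fderiv ℝ w (t, x₀) (0, b i)).det)
      (∑ a, ∑ i, (U x₀).adjugate i a * V' a (b i)) 0 := by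
    refine (hasDerivAt_det (A := fun t => colMatrix fun i => fderiv ℝ w (t, x₀) (0, b i))
      (A' := Matrix.of fun a i => V' a (b i)) fun a i => ?_)
    have h1 := (hFv (0, b i) a).comp_hasDerivAt (0 : ℝ) hι₁
    refine h1.congr_deriv ?_
    simp only [V', ContinuousLinearMap.comp_apply, ContinuousLinearMap.apply_apply,
      ContinuousLinearMap.inr_apply, Matrix.of_apply]
    rw [hsymm]
  have him := im_star_mul_fderiv hUdet m ℓ c hc hdet
  set u : ℂ := (U x₀).det with hu
  set u' : ℂ := ∑ a, ∑ i, (U x₀).adjugate i a * V' a (b i) with hu'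
  have hre : (star u * u').re = -(m * ∑ k, X x₀ k * ℓ (b k)) * ‖u‖ ^ 2 := by
    have huu : star u * u = (‖u‖ ^ 2 : ℝ) := by
      rw [Complex.star_def, mul_comm, Complex.mul_conj, Complex.normSq_eq_norm_sq]
    rw [hdiv, mul_add, Complex.add_re, ← mul_assoc, huu, Complex.re_ofReal_mul, Complex.re_sum,
      Finset.sum_eq_zero fun i _ => hZre i (b i), mul_zero, zero_add, Finset.mul_sum,
      Complex.re_sum, Finset.mul_sum, ← Finset.sum_neg_distrib, Finset.sum_mul]
    refine Finset.sum_congr rfl fun k _ => ?_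
    have h1 := him (b k)
    simp only [sum_apply, smul_apply, smul_eq_mul] at h1
    have h2 : star u * (Z k x₀ * ∑ a, ∑ i, (U x₀).adjugate i a * U' a i (b k)) =
        X x₀ k * (Complex.I * (star u * ∑ a, ∑ i, (U x₀).adjugate i a * U' a i (b k))) := by
      simp only [Z]
      ring
    rw [h2, Complex.re_ofReal_mul, Complex.I_mul_re, h1]
    ring
  -- the Hermitian Gram determinant
  have hwt : HasDerivAt (fun t => w (t, x₀)) (fderiv ℝ w (0, x₀) (1, 0)) 0 :=
    ((hw0 x₀).differentiableAt (by simp)).hasFDerivAt.comp_hasDerivAt (0 : ℝ) hι₁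
  have h0 := one_sub_norm_sq_pos (hball (0, x₀))
  have hN : HasDerivAt (fun t => ‖(colMatrix fun i => fderiv ℝ w (t, x₀) (0, b i)).det‖ ^ 2 *
      ((1 - ‖w (t, x₀)‖ ^ 2)⁻¹) ^ (n + 1)) _ 0 :=
    hUt.norm_sq.mul (((hwt.norm_sq.const_sub 1).inv h0.ne').pow (n + 1))
  have hHdet : ∀ t, (hermGram (w (t, x₀)) fun i => fderiv ℝ w (t, x₀) (0, b i)).det =
      ((‖(colMatrix fun i => fderiv ℝ w (t, x₀) (0, b i)).det‖ ^ 2 *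
      ((1 - ‖w (t, x₀)‖ ^ 2)⁻¹) ^ (n + 1) : ℝ) : ℂ) := by
    intro t
    rw [det_hermGram (hball _), Complex.star_def, Complex.mul_conj, Complex.normSq_eq_norm_sq]
    push_cast
    ring
  have hGram : ∀ t, (gram (w (t, x₀)) fun i => fderiv ℝ w (t, x₀) (0, b i)) =
      (hermGram (w (t, x₀)) fun i => fderiv ℝ w (t, x₀) (0, b i)).map Complex.re := fun t => rfl
  have hG0 : (gram (w (0, x₀)) fun i => fderiv ℝ w (0, x₀) (0, b i)).det =
      ‖u‖ ^ 2 * ((1 - ‖w (0, x₀)‖ ^ 2)⁻¹) ^ (n + 1) := by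
    have h1 : (hermGram (w (0, x₀)) fun i => fderiv ℝ w (0, x₀) (0, b i)) =
        (gram (w (0, x₀)) fun i => fderiv ℝ w (0, x₀) (0, b i)).map Complex.ofRealHom := by
      ext i j
      apply Complex.ext
      · simp [hermGram, gram]
      · simpa [hermGram, gram] using hlag i j
    have h2 := hHdet 0
    rw [h1, ← RingHom.mapMatrix_apply, ← RingHom.map_det] at h2
    exact Complex.ofReal_injective h2
  have hfin := hasDerivAt_det_re
    (A := fun t => hermGram (w (t, x₀)) fun i => fderiv ℝ w (t, x₀) (0, b i))
    (A' := Matrix.of fun i j => deriv (fun t => hermGram (w (t, x₀))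
      (fun i => fderiv ℝ w (t, x₀) (0, b i)) i j) 0) (x := 0) (fun i j => by
        refine DifferentiableAt.hasDerivAt ?_
        have hc1 : ContDiffAt ℝ ∞ (fun t : ℝ => (t, x₀)) 0 := by fun_prop
        have hcD : ∀ i, ContDiffAt ℝ ∞ (fun t : ℝ => fderiv ℝ w (t, x₀) (0, b i)) 0 := fun i =>
          (ContDiffAt.comp (0 : ℝ) (hD x₀) hc1).clm_apply contDiffAt_const
        exact (ContDiffAt.bergman (ContDiffAt.comp (0 : ℝ) (hw0 x₀) hc1) (hcD i) (hcD j)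
          (hball _)).differentiableAt (by simp)) hlag
    (by
      simp only [hHdet]
      exact hN.ofReal_comp)
  refine hfin.congr_deriv ?_
  rw [hG0]
  have hin : ∀ p q : ℂ, inner ℝ p q = (star p * q).re := fun p q => by
    rw [Complex.inner, Complex.star_def, mul_comm]
  have hin' : ∀ p q : EuclideanSpace ℂ (Fin n), inner ℝ p q = (inner ℂ p q).re := fun p q => by
    simp [PiLp.inner_apply]
  rw [hin]
  change 2 * (star u * u').re * _ + ‖u‖ ^ 2 * (_ * ((1 - ‖w (0, x₀)‖ ^ 2)⁻¹) ^ (n + 1 - 1) * _) = _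
  rw [hre, hin', Nat.add_sub_cancel, neg_neg, div_eq_mul_inv, ← inv_pow, Nat.cast_succ]
  ring

end

/-! ### Glueing measures -/

open MeasureTheory in
/-- On the members of a countable measurable cover, the supremum of a compatible family of measures
is given by the members of the family. -/
theorem biSup_measure_apply_of_compatible {α ι : Type*} [MeasurableSpace α] {S T : Set ι}
    {μ : ι → Measure α} {U : ι → Set α} (hU : ∀ i, MeasurableSet (U i))
    (hμ : ∀ i ∈ S, μ i (U i)ᶜ = 0)
    (hcompat : ∀ i ∈ S, ∀ j ∈ S, ∀ A, MeasurableSet A → A ⊆ U i → A ⊆ U j → μ i A = μ j A)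
    (hTS : T ⊆ S) (hT : T.Countable) (hcover : ⋃ i ∈ T, U i = Set.univ) {i : ι} (hi : i ∈ S)
    {A : Set α} (hA : MeasurableSet A) (hAi : A ⊆ U i) :
    (⨆ j ∈ S, μ j) A = μ i A := by
  rcases T.eq_empty_or_nonempty with rfl | hTne
  · have hA0 : A = ∅ := by
      have : (Set.univ : Set α) = ∅ := by simpa using hcover.symm
      exact Set.eq_empty_of_subset_empty (this ▸ Set.subset_univ A)
    simp [hA0]
  obtain ⟨t, rfl⟩ := hT.exists_eq_range hTne
  have ht : ∀ k, t k ∈ S := fun k => hTS ⟨k, rfl⟩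
  let D : ℕ → Set α := disjointed fun k => U (t k)
  have hDm : ∀ k, MeasurableSet (D k) := fun k => MeasurableSet.disjointed (fun _ => hU _) k
  have hDU : ∀ k, D k ⊆ U (t k) := fun k => disjointed_subset _ k
  have hDd : Pairwise (Function.onFun Disjoint D) := disjoint_disjointed _
  have hDc : ⋃ k, D k = Set.univ := by
    rw [iUnion_disjointed, ← hcover, Set.biUnion_range]
  let N : Measure α := Measure.sum fun k => (μ (t k)).restrict (D k)
  have hdecomp : ∀ j, ∀ B, MeasurableSet B → μ j B = ∑' k, μ j (B ∩ D k) := by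
    intro j B hB
    rw [← measure_iUnion (fun k l hkl => (hDd hkl).mono Set.inter_subset_right
      Set.inter_subset_right) fun k => hB.inter (hDm k), ← Set.inter_iUnion, hDc, Set.inter_univ]
  have hinter : ∀ j ∈ S, ∀ B, μ j B = μ j (B ∩ U j) := by
    intro j hj B
    refine le_antisymm ?_ (measure_mono Set.inter_subset_left)
    calc μ j B ≤ μ j (B ∩ U j ∪ (U j)ᶜ) := measure_mono fun x hx => by
          by_cases h : x ∈ U j
          · exact Or.inl ⟨hx, h⟩
          · exact Or.inr h
      _ ≤ μ j (B ∩ U j) + μ j (U j)ᶜ := measure_union_le _ _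
      _ = μ j (B ∩ U j) := by rw [hμ j hj, add_zero]
  have hle : ∀ j ∈ S, μ j ≤ N := by
    intro j hj
    rw [Measure.le_iff]
    intro B hB
    rw [hdecomp j B hB, Measure.sum_apply _ hB]
    refine ENNReal.tsum_le_tsum fun k => ?_
    rw [Measure.restrict_apply hB, hinter j hj,
      hcompat j hj (t k) (ht k) _ ((hB.inter (hDm k)).inter (hU j)) Set.inter_subset_right
        ((Set.inter_subset_left.trans Set.inter_subset_right).trans (hDU k))]
    exact measure_mono Set.inter_subset_left
  have hNA : N A = μ i A := by
    rw [hdecomp i A hA, Measure.sum_apply _ hA]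
    refine tsum_congr fun k => ?_
    rw [Measure.restrict_apply hA]
    exact hcompat _ (ht k) i hi _ (hA.inter (hDm k)) (Set.inter_subset_right.trans (hDU k))
      (Set.inter_subset_left.trans hAi)
  refine le_antisymm ?_ ?_
  · rw [← hNA]
    exact (iSup₂_le hle : (⨆ j ∈ S, μ j) ≤ N) A
  · exact (le_iSup₂ (f := fun j (_ : j ∈ S) => μ j) i hi) A

open MeasureTheory in
theorem measure_ext_of_countable_cover {α ι : Type*} [MeasurableSpace α] {T : Set ι}
    {U : ι → Set α} (hT : T.Countable) (hU : ∀ i, MeasurableSet (U i))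
    (hcover : ⋃ i ∈ T, U i = Set.univ) {μ ν : Measure α}
    (h : ∀ i ∈ T, ∀ A, MeasurableSet A → A ⊆ U i → μ A = ν A) : μ = ν := by
  have := hT.to_subtype
  refine (Measure.ext_iff_of_iUnion_eq_univ (s := fun i : T => U i) ?_).mpr fun i => ?_
  · rw [← hcover, Set.biUnion_eq_iUnion]
  · ext A hA
    rw [Measure.restrict_apply hA, Measure.restrict_apply hA]
    exact h i i.2 _ (hA.inter (hU i)) Set.inter_subset_right

open MeasureTheory in
theorem measurableSet_preimage_inter_of_continuousOn {X Y : Type*} [TopologicalSpace X]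
    [MeasurableSpace X] [OpensMeasurableSpace X] [TopologicalSpace Y] [MeasurableSpace Y]
    [BorelSpace Y] {f : X → Y} {O : Set X} (hO : MeasurableSet O) (hf : ContinuousOn f O)
    {A : Set Y} (hA : MeasurableSet A) : MeasurableSet (f ⁻¹' A ∩ O) := by
  have h := hO.subtype_image ((continuousOn_iff_continuous_domRestrict.mp hf).measurable hA)
  convert h using 1
  ext x
  simp [and_comm]

section

variable {E : Type*} [NormedAddCommGroup E] [NormedSpace ℝ E]
  {H : Type*} [TopologicalSpace H] {I : ModelWithCorners ℝ E H}
  {M : Type*} [TopologicalSpace M] [ChartedSpace H M]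

theorem contMDiffAt_extend_symm [I.Boundaryless] [IsManifold I ∞ M] {e : OpenPartialHomeomorph M H}
    (he : e ∈ atlas H M) {x : E} (hx : x ∈ (e.extend I).target) :
    ContMDiffAt 𝓘(ℝ, E) I ∞ (e.extend I).symm x := by
  have h1 := contMDiffOn_extend_symm (IsManifold.subset_maximalAtlas (I := I) (n := ∞) he)
  rw [← e.extend_target'] at h1
  exact h1.contMDiffAt ((e.isOpen_extend_target (I := I)).mem_nhds hx)

theorem exists_countable_atlas_cover [SecondCountableTopology M] :
    ∃ T ⊆ atlas H M, T.Countable ∧ ⋃ e ∈ T, e.source = Set.univ := by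
  obtain ⟨s, hs, hs'⟩ := countable_cover_nhds fun x : M => chart_source_mem_nhds H x
  refine ⟨chartAt H '' s, ?_, hs.image _, ?_⟩
  · rintro _ ⟨x, _, rfl⟩
    exact chart_mem_atlas H x
  · rw [Set.biUnion_image]
    exact hs'

end

/-! ### The Riemannian measure of an immersion -/

section

open MeasureTheory

variable {E : Type*} [NormedAddCommGroup E] [NormedSpace ℝ E] [FiniteDimensional ℝ E]
  {H : Type*} [TopologicalSpace H] (I : ModelWithCorners ℝ E H)
  {M : Type*} [TopologicalSpace M] [ChartedSpace H M] {n : ℕ}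
  [MeasurableSpace E] [BorelSpace E] [MeasurableSpace M] [BorelSpace M]

/-- The measure induced by `ψ` in a chart. -/
def chartMeasure (ψ : M → CH n) (e : OpenPartialHomeomorph M H) : Measure M :=
  (((Module.finBasis ℝ E).addHaar.restrict (e.extend I).target).withDensity
    fun x => ENNReal.ofReal (volDensity (Module.finBasis ℝ E) ψ (e.extend I).symm x)).map
      (e.extend I).symm

/-- The Riemannian measure of the metric induced by `ψ`. -/
def volMeasure (ψ : M → CH n) : Measure M := ⨆ e ∈ atlas H M, chartMeasure I ψ e

variable {I} [I.Boundaryless]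

theorem chartMeasure_apply (ψ : M → CH n) (e : OpenPartialHomeomorph M H) {A : Set M}
    (hA : MeasurableSet A) : chartMeasure I ψ e A =
      ∫⁻ x in (e.extend I).symm ⁻¹' A ∩ (e.extend I).target,
        ENNReal.ofReal (volDensity (Module.finBasis ℝ E) ψ (e.extend I).symm x)
          ∂(Module.finBasis ℝ E).addHaar := by
  have hO := (OpenPartialHomeomorph.isOpen_extend_target (I := I) e).measurableSet
  have hc : AEMeasurable (e.extend I).symm
      ((Module.finBasis ℝ E).addHaar.restrict (e.extend I).target) :=
    (e.continuousOn_extend_symm).aemeasurable hO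
  rw [chartMeasure, Measure.map_apply_of_aemeasurable
    (hc.mono_ac (withDensity_absolutelyContinuous _ _)) hA, withDensity_apply',
    Measure.restrict_restrict' hO]

theorem chartMeasure_compl_source (ψ : M → CH n) (e : OpenPartialHomeomorph M H) :
    chartMeasure I ψ e e.sourceᶜ = 0 := by
  rw [chartMeasure_apply ψ e e.open_source.measurableSet.compl]
  have : (e.extend I).symm ⁻¹' e.sourceᶜ ∩ (e.extend I).target = ∅ := by
    ext x
    simp only [Set.mem_inter_iff, Set.mem_preimage, Set.mem_compl_iff, Set.mem_empty_iff_false,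
      iff_false, not_and]
    intro h1 h2
    exact h1 (by simpa using (e.extend I).map_target h2)
  rw [this]
  simp

/-- The change of variables formula for the measures induced in charts, under a smooth
homeomorphism. -/
theorem chartMeasure_comp_homeomorph [IsManifold I ∞ M] {ψ : M → CH n}
    (hψ : ContMDiff I 𝓘(ℝ, EuclideanSpace ℂ (Fin n)) ∞ ψ) (Θ : M ≃ₜ M) (hΘ : ContMDiff I I ∞ Θ)
    {e e' : OpenPartialHomeomorph M H} (he : e ∈ atlas H M) (he' : e' ∈ atlas H M) {A : Set M}
    (hA : MeasurableSet A) (hAe : A ⊆ e.source) (hAe' : A ⊆ Θ ⁻¹' e'.source) :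
    chartMeasure I (ψ ∘ Θ) e A = chartMeasure I ψ e' (Θ '' A) := by
  have hΘA : MeasurableSet (Θ '' A) := by
    rw [Θ.image_eq_preimage_symm]
    exact Θ.symm.continuous.measurable hA
  rw [chartMeasure_apply _ e hA, chartMeasure_apply _ e' hΘA]
  set φ := (e.extend I).symm with hφ
  set φ' := (e'.extend I).symm with hφ'
  set B := φ ⁻¹' A ∩ (e.extend I).target with hB
  have hBm : MeasurableSet B := measurableSet_preimage_inter_of_continuousOn
    (e.isOpen_extend_target (I := I)).measurableSet e.continuousOn_extend_symm hA
  let τ : E → E := fun x => e'.extend I (Θ (φ x))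
  have hmem : ∀ x ∈ B, Θ (φ x) ∈ e'.source := fun x hx => hAe' hx.1
  have hφd : ∀ x ∈ B, ContMDiffAt 𝓘(ℝ, E) I ∞ φ x := fun x hx => contMDiffAt_extend_symm he hx.2
  have hτc : ∀ x ∈ B, ContMDiffAt 𝓘(ℝ, E) 𝓘(ℝ, E) ∞ τ x := fun x hx => by
    have h1 : ContMDiffAt I 𝓘(ℝ, E) ∞ (e'.extend I) (Θ (φ x)) :=
      e'.contMDiffAt_extend (IsManifold.subset_maximalAtlas (I := I) (n := ∞) he') (hmem x hx)
    exact h1.comp x ((hΘ (φ x)).comp x (hφd x hx))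
  have hτd : ∀ x ∈ B, DifferentiableAt ℝ τ x := fun x hx =>
    (hτc x hx).contDiffAt.differentiableAt (by simp)
  have hφτ : ∀ x ∈ B, φ' (τ x) = Θ (φ x) := fun x hx =>
    (e'.extend I).left_inv (by simpa using hmem x hx)
  have hτt : ∀ x ∈ B, τ x ∈ (e'.extend I).target := fun x hx =>
    (e'.extend I).map_source (by simpa using hmem x hx)
  have himage : τ '' B = φ' ⁻¹' (Θ '' A) ∩ (e'.extend I).target := by
    apply Set.Subset.antisymm
    · rintro _ ⟨x, hx, rfl⟩
      refine ⟨?_, hτt x hx⟩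
      rw [Set.mem_preimage, hφτ x hx]
      exact ⟨φ x, hx.1, rfl⟩
    · rintro y ⟨⟨p, hp, hpy⟩, hyt⟩
      have hps : p ∈ (e.extend I).source := by simpa using hAe hp
      have hpx : φ (e.extend I p) = p := (e.extend I).left_inv hps
      refine ⟨e.extend I p, ⟨?_, (e.extend I).map_source hps⟩, ?_⟩
      · rw [Set.mem_preimage, hpx]
        exact hp
      · simp only [τ, hpx, hpy]
        exact (e'.extend I).right_inv hyt
  have hinj : Set.InjOn τ B := by
    intro x hx y hy hxy
    have h1 : Θ (φ x) = Θ (φ y) := by rw [← hφτ x hx, ← hφτ y hy, hxy]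
    exact (e.extend I).symm.injOn hx.2 hy.2 (Θ.injective h1)
  rw [← himage, lintegral_image_eq_lintegral_abs_det_fderiv_mul _ hBm
    (fun x hx => (hτd x hx).hasFDerivAt.hasFDerivWithinAt) hinj]
  refine setLIntegral_congr_fun hBm fun x hx => ?_
  have hφ'd : ContMDiffAt 𝓘(ℝ, E) I ∞ φ' (τ x) := contMDiffAt_extend_symm he' (hτt x hx)
  have h1 : ContMDiffAt 𝓘(ℝ, E) 𝓘(ℝ, EuclideanSpace ℂ (Fin n)) ∞ ((ψ ∘ Θ) ∘ φ) x :=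
    ((hψ.comp hΘ) (φ x)).comp x (hφd x hx)
  have h2 : ContMDiffAt 𝓘(ℝ, E) 𝓘(ℝ, EuclideanSpace ℂ (Fin n)) ∞ (ψ ∘ φ') (τ x) :=
    (hψ (φ' (τ x))).comp (τ x) hφ'd
  have h3 : DifferentiableAt ℝ (affineCoord ∘ ψ ∘ φ') (τ x) :=
    ((contMDiff_affineCoord _).comp (τ x) h2).contDiffAt.differentiableAt (by simp)
  have h4 : (affineCoord ∘ (ψ ∘ Θ) ∘ φ) =ᶠ[𝓝 x] (affineCoord ∘ ψ ∘ φ') ∘ τ := by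
    have hopen : ∀ᶠ y in 𝓝 x, Θ (φ y) ∈ e'.source :=
      ((hΘ.continuous.continuousAt).comp (hφd x hx).continuousAt).eventually
        (e'.open_source.mem_nhds (hmem x hx))
    filter_upwards [hopen] with y hy
    have : φ' (τ y) = Θ (φ y) := (e'.extend I).left_inv (by simpa using hy)
    simp only [Function.comp_apply, this]
  rw [volDensity_eq _ (h1.mdifferentiableAt (by simp)),
    volDensity_eq _ (h2.mdifferentiableAt (by simp)), h4.fderiv_eq,
    fderiv_comp x h3 (hτd x hx), hφτ x hx]
  have h5 := gram_det_comp (Module.finBasis ℝ E) (fderiv ℝ τ x : E →ₗ[ℝ] E)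
    (affineCoord (ψ (Θ (φ x)))) (fderiv ℝ (affineCoord ∘ ψ ∘ φ') (τ x) :
      E →ₗ[ℝ] EuclideanSpace ℂ (Fin n))
  simp only [ContinuousLinearMap.coe_coe] at h5
  simp only [ContinuousLinearMap.comp_apply, Function.comp_apply]
  rw [h5, Real.sqrt_mul (sq_nonneg _), Real.sqrt_sq_eq_abs, ENNReal.ofReal_mul (abs_nonneg _)]

theorem volMeasure_apply_of_subset_source [IsManifold I ∞ M] [SecondCountableTopology M]
    {ψ : M → CH n} (hψ : ContMDiff I 𝓘(ℝ, EuclideanSpace ℂ (Fin n)) ∞ ψ)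
    {e : OpenPartialHomeomorph M H} (he : e ∈ atlas H M) {A : Set M} (hA : MeasurableSet A)
    (hAe : A ⊆ e.source) : volMeasure I ψ A = chartMeasure I ψ e A := by
  obtain ⟨T, hT1, hT2, hT3⟩ := exists_countable_atlas_cover (H := H) (M := M)
  refine biSup_measure_apply_of_compatible (U := fun e : OpenPartialHomeomorph M H => e.source)
    (fun e => e.open_source.measurableSet) (fun e _ => chartMeasure_compl_source ψ e) ?_ hT1 hT2
    hT3 he hA hAe
  intro e₁ he₁ e₂ he₂ B hB hB₁ hB₂
  have := chartMeasure_comp_homeomorph hψ (Homeomorph.refl M) contMDiff_id he₁ he₂ hB hB₁ hB₂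
  simpa using this

/-- A smooth homeomorphism `Θ` maps the Riemannian measure of `ψ ∘ Θ` to that of `ψ`. -/
theorem map_volMeasure_comp_homeomorph [IsManifold I ∞ M] [SecondCountableTopology M]
    {ψ : M → CH n} (hψ : ContMDiff I 𝓘(ℝ, EuclideanSpace ℂ (Fin n)) ∞ ψ) (Θ : M ≃ₜ M)
    (hΘ : ContMDiff I I ∞ Θ) : (volMeasure I (ψ ∘ Θ)).map Θ = volMeasure I ψ := by
  obtain ⟨T, hT1, hT2, hT3⟩ := exists_countable_atlas_cover (H := H) (M := M)
  have hcover : ⋃ i ∈ T ×ˢ T, i.1.source ∩ Θ.symm ⁻¹' i.2.source = Set.univ := by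
    rw [Set.eq_univ_iff_forall]
    intro p
    have h1 : p ∈ ⋃ e ∈ T, e.source := hT3 ▸ Set.mem_univ p
    have h2 : Θ.symm p ∈ ⋃ e ∈ T, e.source := hT3 ▸ Set.mem_univ _
    obtain ⟨e, he, hp⟩ := Set.mem_iUnion₂.mp h1
    obtain ⟨e', he', hp'⟩ := Set.mem_iUnion₂.mp h2
    exact Set.mem_iUnion₂.mpr ⟨(e, e'), ⟨he, he'⟩, hp, hp'⟩
  refine measure_ext_of_countable_cover (hT2.prod hT2) (fun i => ?_) hcover ?_
  · exact i.1.open_source.measurableSet.inter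
      (Θ.symm.continuous.measurable i.2.open_source.measurableSet)
  rintro ⟨e, e'⟩ ⟨he, he'⟩ A hA hAs
  have hA' : MeasurableSet (Θ ⁻¹' A) := Θ.continuous.measurable hA
  have hs' : Θ ⁻¹' A ⊆ e'.source := fun p hp => by simpa using (hAs hp).2
  rw [Measure.map_apply Θ.continuous.measurable hA,
    volMeasure_apply_of_subset_source (hψ.comp hΘ) (hT1 he') hA' hs',
    volMeasure_apply_of_subset_source hψ (hT1 he) hA fun p hp => (hAs hp).1,
    chartMeasure_comp_homeomorph hψ Θ hΘ (hT1 he') (hT1 he) hA' hs' fun p hp => (hAs hp).1,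
    Θ.image_preimage]

theorem continuousOn_volDensity [IsManifold I ∞ M] {ψ : M → CH n}
    (hψ : ContMDiff I 𝓘(ℝ, EuclideanSpace ℂ (Fin n)) ∞ ψ) {e : OpenPartialHomeomorph M H}
    (he : e ∈ atlas H M) :
    ContinuousOn (volDensity (Module.finBasis ℝ E) ψ (e.extend I).symm) (e.extend I).target := by
  have hO := e.isOpen_extend_target (I := I)
  have h1 : ∀ x ∈ (e.extend I).target, ContMDiffAt 𝓘(ℝ, E) 𝓘(ℝ, EuclideanSpace ℂ (Fin n)) ∞
      (ψ ∘ (e.extend I).symm) x := fun x hx => (hψ _).comp x (contMDiffAt_extend_symm he hx)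
  have h2 : ∀ x ∈ (e.extend I).target, ContDiffAt ℝ ∞
      (affineCoord ∘ ψ ∘ (e.extend I).symm) x := fun x hx =>
    ((contMDiff_affineCoord _).comp x (h1 x hx)).contDiffAt
  intro x hx
  refine ContinuousAt.continuousWithinAt ?_
  have h3 : ContDiffAt ℝ ∞ (fun y => (gram (affineCoord (ψ ((e.extend I).symm y))) fun i =>
      fderiv ℝ (affineCoord ∘ ψ ∘ (e.extend I).symm) y (Module.finBasis ℝ E i)).det) x := by
    refine ContDiffAt.gram_det (h2 x hx) (fun i => ?_) (norm_affineCoord_lt _)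
    exact ((h2 x hx).fderiv_right (m := ∞) (by simp)).clm_apply contDiffAt_const
  refine (h3.continuousAt.sqrt).congr ?_
  filter_upwards [hO.mem_nhds hx] with y hy
  exact (volDensity_eq _ ((h1 y hy).mdifferentiableAt (by simp))).symm

theorem isLocallyFiniteMeasure_volMeasure [IsManifold I ∞ M] [SecondCountableTopology M]
    {ψ : M → CH n} (hψ : ContMDiff I 𝓘(ℝ, EuclideanSpace ℂ (Fin n)) ∞ ψ) :
    IsLocallyFiniteMeasure (volMeasure I ψ) := by
  refine ⟨fun p => ?_⟩
  set e := chartAt H p with he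
  have hea : e ∈ atlas H M := chart_mem_atlas H p
  have hps : p ∈ (e.extend I).source := by simp [he]
  have hx : e.extend I p ∈ (e.extend I).target := (e.extend I).map_source hps
  have hO := e.isOpen_extend_target (I := I)
  set d := volDensity (Module.finBasis ℝ E) ψ (e.extend I).symm with hd
  have hd1 : ContinuousAt d (e.extend I p) :=
    (continuousOn_volDensity hψ hea).continuousAt (hO.mem_nhds hx)
  have hd2 : ∀ᶠ y in 𝓝 (e.extend I p), d y < d (e.extend I p) + 1 :=
    hd1.eventually (gt_mem_nhds (by linarith))
  obtain ⟨r, hr, hball⟩ := Metric.eventually_nhds_iff_ball.mp (hd2.and (hO.mem_nhds hx))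
  let N : Set M := e.source ∩ e.extend I ⁻¹' Metric.ball (e.extend I p) r
  have hN : IsOpen N := by
    refine ContinuousOn.isOpen_inter_preimage ?_ e.open_source Metric.isOpen_ball
    simpa using e.continuousOn_extend (I := I)
  refine ⟨N, hN.mem_nhds ⟨by simpa using hps, Metric.mem_ball_self hr⟩, ?_⟩
  rw [volMeasure_apply_of_subset_source hψ hea hN.measurableSet Set.inter_subset_left,
    chartMeasure_apply _ _ hN.measurableSet]
  have hsub : (e.extend I).symm ⁻¹' N ∩ (e.extend I).target ⊆ Metric.ball (e.extend I p) r := by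
    rintro y ⟨hy1, hy2⟩
    have := hy1.2
    rwa [Set.mem_preimage, (e.extend I).right_inv hy2] at this
  calc ∫⁻ x in (e.extend I).symm ⁻¹' N ∩ (e.extend I).target, ENNReal.ofReal (d x)
        ∂(Module.finBasis ℝ E).addHaar
      ≤ ∫⁻ x in Metric.ball (e.extend I p) r, ENNReal.ofReal (d x)
        ∂(Module.finBasis ℝ E).addHaar := lintegral_mono_set hsub
    _ ≤ ∫⁻ _ in Metric.ball (e.extend I p) r, ENNReal.ofReal (d (e.extend I p) + 1)
        ∂(Module.finBasis ℝ E).addHaar :=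
        setLIntegral_mono' Metric.isOpen_ball.measurableSet fun y hy =>
          ENNReal.ofReal_le_ofReal (hball y hy).1.le
    _ < (⊤ : ℝ≥0∞) := by
        rw [setLIntegral_const]
        exact ENNReal.mul_lt_top ENNReal.ofReal_lt_top measure_ball_lt_top

/-- If the densities of two maps are proportional, so are their Riemannian measures. -/
theorem volMeasure_eq_withDensity [IsManifold I ∞ M] [SecondCountableTopology M]
    {ψ ψ' : M → CH n} (hψ : ContMDiff I 𝓘(ℝ, EuclideanSpace ℂ (Fin n)) ∞ ψ)
    (hψ' : ContMDiff I 𝓘(ℝ, EuclideanSpace ℂ (Fin n)) ∞ ψ') {ρ : M → ℝ} (hρ : Continuous ρ)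
    (hρ0 : ∀ p, 0 ≤ ρ p)
    (h : ∀ e ∈ atlas H M, ∀ x ∈ (e.extend I).target,
      volDensity (Module.finBasis ℝ E) ψ' (e.extend I).symm x =
        ρ ((e.extend I).symm x) * volDensity (Module.finBasis ℝ E) ψ (e.extend I).symm x) :
    volMeasure I ψ' = (volMeasure I ψ).withDensity fun p => ENNReal.ofReal (ρ p) := by
  obtain ⟨T, hT1, hT2, hT3⟩ := exists_countable_atlas_cover (H := H) (M := M)
  refine measure_ext_of_countable_cover (U := fun e : OpenPartialHomeomorph M H => e.source) hT2
    (fun e => e.open_source.measurableSet) hT3 fun e he A hA hAe => ?_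
  have hea := hT1 he
  have hO := (e.isOpen_extend_target (I := I)).measurableSet
  have hρm : Measurable fun p => ENNReal.ofReal (ρ p) := hρ.measurable.ennreal_ofReal
  have hrestr : (volMeasure I ψ).restrict A = (chartMeasure I ψ e).restrict A := by
    ext B hB
    rw [Measure.restrict_apply hB, Measure.restrict_apply hB,
      volMeasure_apply_of_subset_source hψ hea (hB.inter hA) (Set.inter_subset_right.trans hAe)]
  have hφm : AEMeasurable (e.extend I).symm
      ((Module.finBasis ℝ E).addHaar.restrict (e.extend I).target) :=
    (e.continuousOn_extend_symm).aemeasurable hO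
  have hdm : AEMeasurable (fun x => ENNReal.ofReal
      (volDensity (Module.finBasis ℝ E) ψ (e.extend I).symm x))
      ((Module.finBasis ℝ E).addHaar.restrict (e.extend I).target) :=
    ((continuousOn_volDensity hψ hea).aemeasurable hO).ennreal_ofReal
  have hg : AEMeasurable (fun x => A.indicator (fun p => ENNReal.ofReal (ρ p)) ((e.extend I).symm x))
      ((Module.finBasis ℝ E).addHaar.restrict (e.extend I).target) :=
    (hρm.indicator hA).comp_aemeasurable hφm
  rw [volMeasure_apply_of_subset_source hψ' hea hA hAe, chartMeasure_apply _ _ hA,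
    withDensity_apply _ hA, hrestr, ← lintegral_indicator hA, chartMeasure,
    lintegral_map' (hρm.indicator hA).aemeasurable
      (hφm.mono_ac (withDensity_absolutelyContinuous _ _)),
    lintegral_withDensity_eq_lintegral_mul₀ hdm hg]
  have hB : MeasurableSet ((e.extend I).symm ⁻¹' A ∩ (e.extend I).target) :=
    measurableSet_preimage_inter_of_continuousOn hO e.continuousOn_extend_symm hA
  rw [← lintegral_indicator hB, ← lintegral_indicator hO]
  congr 1
  funext x
  by_cases hx : x ∈ (e.extend I).target
  · by_cases hxA : (e.extend I).symm x ∈ A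
    · rw [Set.indicator_of_mem (show x ∈ (e.extend I).symm ⁻¹' A ∩ (e.extend I).target from ⟨hxA, hx⟩),
        Set.indicator_of_mem hx, h e hea x hx,
        ENNReal.ofReal_mul (hρ0 _), Pi.mul_apply, Set.indicator_of_mem hxA, mul_comm]
    · rw [Set.indicator_of_notMem fun h => hxA h.1, Set.indicator_of_mem hx, Pi.mul_apply,
        Set.indicator_of_notMem hxA, mul_zero]
  · rw [Set.indicator_of_notMem fun h => hx h.2, Set.indicator_of_notMem hx]

end

/-! ### Twisting real vectors by phases -/

section Twist

variable {n : ℕ}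

/-- The diagonal unitary transformation with entries `exp(i s χ_k)`. -/
def twist (χ : Fin n → ℝ) (s : ℝ) : EuclideanSpace ℂ (Fin n) →L[ℝ] EuclideanSpace ℂ (Fin n) :=
  LinearMap.toContinuousLinearMap
    { toFun := fun v => WithLp.toLp 2 fun k => Complex.exp ((s * χ k : ℝ) * Complex.I) * v k
      map_add' := fun u v => by ext k; simp [mul_add]
      map_smul' := fun a v => by
        ext k
        simp only [PiLp.smul_apply, Complex.real_smul, RingHom.id_apply]
        ring }

@[simp]
theorem twist_apply (χ : Fin n → ℝ) (s : ℝ) (v : EuclideanSpace ℂ (Fin n)) (k : Fin n) :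
    twist χ s v k = Complex.exp ((s * χ k : ℝ) * Complex.I) * v k := rfl

theorem twist_add (χ : Fin n → ℝ) (s τ : ℝ) (v : EuclideanSpace ℂ (Fin n)) :
    twist χ (s + τ) v = twist χ τ (twist χ s v) := by
  ext k
  simp only [twist_apply]
  rw [← mul_assoc, ← Complex.exp_add]
  congr 2
  push_cast
  ring

theorem inner_twist (χ : Fin n → ℝ) (s : ℝ) (u v : EuclideanSpace ℂ (Fin n)) :
    inner ℂ (twist χ s u) (twist χ s v) = inner ℂ u v := by
  simp only [PiLp.inner_apply, twist_apply, RCLike.inner_apply, map_mul]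
  refine Finset.sum_congr rfl fun k _ => ?_
  have h : Complex.exp ((s * χ k : ℝ) * Complex.I) *
      (starRingEnd ℂ) (Complex.exp ((s * χ k : ℝ) * Complex.I)) = 1 := by
    rw [Complex.mul_conj, Complex.normSq_eq_norm_sq, Complex.norm_exp_ofReal_mul_I]
    simp
  linear_combination (v k * (starRingEnd ℂ) (u k)) * h

theorem norm_twist (χ : Fin n → ℝ) (s : ℝ) (v : EuclideanSpace ℂ (Fin n)) :
    ‖twist χ s v‖ = ‖v‖ := by
  rw [@norm_eq_sqrt_re_inner ℂ, inner_twist, ← @norm_eq_sqrt_re_inner ℂ]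

theorem bergman_twist (χ : Fin n → ℝ) (s : ℝ) (w u v : EuclideanSpace ℂ (Fin n)) :
    bergman (twist χ s w) (twist χ s u) (twist χ s v) = bergman w u v := by
  simp only [bergman, inner_twist, norm_twist]

/-- A real vector as a complex vector. -/
def realVec : EuclideanSpace ℝ (Fin n) →L[ℝ] EuclideanSpace ℂ (Fin n) :=
  LinearMap.toContinuousLinearMap
    { toFun := fun v => WithLp.toLp 2 fun k => (v k : ℂ)
      map_add' := fun u v => by ext k; simp
      map_smul' := fun a v => by ext k; simp }

@[simp]
theorem realVec_apply (v : EuclideanSpace ℝ (Fin n)) (k : Fin n) : realVec v k = (v k : ℂ) := rfl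

theorem norm_realVec (v : EuclideanSpace ℝ (Fin n)) : ‖realVec v‖ = ‖v‖ := by
  simp [EuclideanSpace.norm_eq]

/-- The tangent vector `q + i a χ p`. -/
def tangentVec (χ : Fin n → ℝ) (p : EuclideanSpace ℝ (Fin n)) (a : ℝ)
    (q : EuclideanSpace ℝ (Fin n)) : EuclideanSpace ℂ (Fin n) :=
  WithLp.toLp 2 fun k => (q k : ℂ) + (a * χ k * p k : ℝ) * Complex.I

@[simp]
theorem tangentVec_apply (χ : Fin n → ℝ) (p : EuclideanSpace ℝ (Fin n)) (a : ℝ)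
    (q : EuclideanSpace ℝ (Fin n)) (k : Fin n) :
    tangentVec χ p a q k = (q k : ℂ) + (a * χ k * p k : ℝ) * Complex.I := rfl

theorem inner_tangentVec_im (χ : Fin n → ℝ) (p q q' : EuclideanSpace ℝ (Fin n)) (a b : ℝ) :
    (inner ℂ (tangentVec χ p a q) (tangentVec χ p b q')).im =
      b * ∑ k, χ k * p k * q k - a * ∑ k, χ k * p k * q' k := by
  simp only [PiLp.inner_apply, tangentVec_apply, RCLike.inner_apply, Complex.im_sum,
    Finset.mul_sum, ← Finset.sum_sub_distrib]
  refine Finset.sum_congr rfl fun k _ => ?_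
  simp
  ring

theorem inner_tangentVec_one_zero_re {χ : Fin n → ℝ} (hχ : ∀ k, χ k ^ 2 = χ k)
    (p q : EuclideanSpace ℝ (Fin n)) (a : ℝ) :
    (inner ℂ (tangentVec χ p 1 0) (tangentVec χ p a q)).re = a * ∑ k, χ k * p k ^ 2 := by
  simp only [PiLp.inner_apply, tangentVec_apply, RCLike.inner_apply, Complex.re_sum,
    Finset.mul_sum]
  refine Finset.sum_congr rfl fun k _ => ?_
  simp
  linear_combination (a * p k ^ 2) * hχ k

theorem inner_realVec_tangentVec (χ : Fin n → ℝ) (p q : EuclideanSpace ℝ (Fin n)) (a : ℝ) :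
    inner ℂ (realVec p) (tangentVec χ p a q) =
      (∑ k, p k * q k : ℝ) + (a * ∑ k, χ k * p k ^ 2 : ℝ) * Complex.I := by
  simp only [PiLp.inner_apply, tangentVec_apply, realVec_apply, RCLike.inner_apply,
    Finset.mul_sum]
  push_cast
  rw [Finset.sum_mul, ← Finset.sum_add_distrib]
  refine Finset.sum_congr rfl fun k _ => ?_
  simp
  ring

/-- Lagrangian condition for the tangent vectors `q + i a χ p`. -/
theorem bergman_tangentVec_im {χ : Fin n → ℝ} {p : EuclideanSpace ℝ (Fin n)} (hp : ‖p‖ < 1)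
    {κ : ℝ} (hA : ∑ k, χ k * p k ^ 2 = κ * (1 - ‖p‖ ^ 2)) {q q' : EuclideanSpace ℝ (Fin n)}
    (hq : ∑ k, χ k * p k * q k = -(κ * ∑ k, p k * q k))
    (hq' : ∑ k, χ k * p k * q' k = -(κ * ∑ k, p k * q' k)) (a b : ℝ) :
    (bergman (realVec p) (tangentVec χ p a q) (tangentVec χ p b q')).im = 0 := by
  have h0 : 1 - ‖p‖ ^ 2 ≠ 0 := by nlinarith [norm_nonneg p]
  have h1 : (1 - ‖p‖ ^ 2)⁻¹ * ∑ k, χ k * p k ^ 2 = κ := by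
    rw [hA]
    field_simp
  rw [bergman, norm_realVec, ← inner_conj_symm (tangentVec χ p b q') (realVec p),
    inner_realVec_tangentVec, inner_realVec_tangentVec, ← Complex.ofReal_pow, Complex.add_im,
    Complex.im_ofReal_mul, Complex.im_ofReal_mul, inner_tangentVec_im, hq, hq']
  simp only [Complex.mul_im, Complex.conj_re, Complex.conj_im, Complex.add_re, Complex.add_im,
    Complex.ofReal_re, Complex.ofReal_im, Complex.mul_re, Complex.I_re, Complex.I_im]
  linear_combination ((1 - ‖p‖ ^ 2)⁻¹ * (a * ∑ k, p k * q' k - b * ∑ k, p k * q k)) * h1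

theorem bergman_tangentVec_one_zero_re {χ : Fin n → ℝ} (hχ : ∀ k, χ k ^ 2 = χ k)
    {p : EuclideanSpace ℝ (Fin n)} (hp : ‖p‖ < 1) {κ : ℝ}
    (hA : ∑ k, χ k * p k ^ 2 = κ * (1 - ‖p‖ ^ 2)) (q : EuclideanSpace ℝ (Fin n)) (a : ℝ) :
    (bergman (realVec p) (tangentVec χ p a q) (tangentVec χ p 1 0)).re = a * (κ * (1 + κ)) := by
  have h0 : 1 - ‖p‖ ^ 2 ≠ 0 := by nlinarith [norm_nonneg p]
  have h1 : (1 - ‖p‖ ^ 2)⁻¹ * ∑ k, χ k * p k ^ 2 = κ := by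
    rw [hA]
    field_simp
  rw [bergman, norm_realVec, ← inner_conj_symm (tangentVec χ p 1 0) (realVec p),
    inner_realVec_tangentVec, inner_realVec_tangentVec, ← Complex.ofReal_pow, Complex.add_re,
    Complex.re_ofReal_mul, Complex.re_ofReal_mul, inner_tangentVec_one_zero_re hχ]
  simp only [Complex.mul_re, Complex.conj_re, Complex.conj_im, Complex.add_re, Complex.add_im,
    Complex.ofReal_re, Complex.ofReal_im, Complex.mul_im, Complex.I_re, Complex.I_im,
    PiLp.zero_apply, mul_zero, Finset.sum_const_zero]
  linear_combination (a + a * (1 - ‖p‖ ^ 2)⁻¹ * ∑ k, χ k * p k ^ 2 + a * κ) * h1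

/-- The vectors `q + i a χ p`, with `q` in an injectively immersed subspace, vanish only for
trivial reasons. -/
theorem eq_zero_of_smul_add_eq_zero {χ : Fin n → ℝ} (hχ : ∀ k, χ k ^ 2 = χ k)
    {p : EuclideanSpace ℝ (Fin n)} (hp : ‖p‖ < 1) {κ : ℝ} (hκ : 0 < κ)
    (hA : ∑ k, χ k * p k ^ 2 = κ * (1 - ‖p‖ ^ 2)) {q : EuclideanSpace ℝ (Fin n)}
    (hq : ∑ k, χ k * p k * q k = -(κ * ∑ k, p k * q k)) {a : ℝ}
    (h : ∀ k, a * (χ k * p k) + q k = 0) : a = 0 := by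
  have h0 : 0 < 1 - ‖p‖ ^ 2 := by nlinarith [norm_nonneg p]
  have h1 : ∑ k, p k * q k = -(a * ∑ k, χ k * p k ^ 2) := by
    rw [Finset.mul_sum, ← Finset.sum_neg_distrib]
    exact Finset.sum_congr rfl fun k _ => by linear_combination p k * h k
  have h2 : ∑ k, χ k * p k * q k = -(a * ∑ k, χ k * p k ^ 2) := by
    rw [Finset.mul_sum, ← Finset.sum_neg_distrib]
    exact Finset.sum_congr rfl fun k _ => by
      linear_combination χ k * p k * h k - a * p k ^ 2 * hχ k
  rw [h1, h2, hA] at hq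
  have h3 : a * (κ * (1 - ‖p‖ ^ 2) * (1 + κ)) = 0 := by linarith
  rcases mul_eq_zero.mp h3 with h4 | h4
  · exact h4
  · exact absurd h4 (by positivity)

variable {V : Type*}

/-- The map `(s, x) ↦ (exp(i s χ_k) r_k(x))_k`. -/
def twistMap (χ : Fin n → ℝ) (r : V → EuclideanSpace ℝ (Fin n)) (z : ℝ × V) :
    EuclideanSpace ℂ (Fin n) := twist χ z.1 (realVec (r z.2))

theorem norm_twistMap (χ : Fin n → ℝ) (r : V → EuclideanSpace ℝ (Fin n)) (z : ℝ × V) :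
    ‖twistMap χ r z‖ = ‖r z.2‖ := by
  rw [twistMap, norm_twist, norm_realVec]

variable [NormedAddCommGroup V] [NormedSpace ℝ V]

theorem contDiff_twistMap (χ : Fin n → ℝ) {r : V → EuclideanSpace ℝ (Fin n)} {m : ℕ∞}
    (hr : ContDiff ℝ m r) : ContDiff ℝ m (twistMap χ r) := by
  rw [contDiff_piLp]
  intro k
  simp only [twistMap, twist_apply, realVec_apply]
  have h1 : ContDiff ℝ m fun z : ℝ × V => (r z.2) k := (contDiff_euclidean.mp hr k).comp contDiff_snd
  have h2 : ContDiff ℝ m fun z : ℝ × V => z.1 * χ k := contDiff_fst.mul contDiff_const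
  exact (((Complex.ofRealCLM.contDiff.comp h2).mul contDiff_const).cexp).mul
    (Complex.ofRealCLM.contDiff.comp h1)

theorem fderiv_twistMap (χ : Fin n → ℝ) {r : V → EuclideanSpace ℝ (Fin n)} (hr : ContDiff ℝ ∞ r)
    (z ζ : ℝ × V) : fderiv ℝ (twistMap χ r) z ζ =
      twist χ z.1 (tangentVec χ (r z.2) ζ.1 (fderiv ℝ r z.2 ζ.2)) := by
  have hW : DifferentiableAt ℝ (twistMap χ r) z :=
    (contDiff_twistMap χ hr).contDiffAt.differentiableAt (by simp)
  have hr' : HasFDerivAt r (fderiv ℝ r z.2) z.2 :=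
    (hr.contDiffAt.differentiableAt (by simp)).hasFDerivAt
  ext k
  have h1 : HasFDerivAt (fun y => twistMap χ r y k)
      ((PiLp.proj (𝕜 := ℝ) 2 (fun _ : Fin n => ℂ) k).comp
        (fderiv ℝ (twistMap χ r) z)) z :=
    (PiLp.proj (𝕜 := ℝ) 2 (fun _ : Fin n => ℂ) k).hasFDerivAt.comp z hW.hasFDerivAt
  have h2 : HasFDerivAt (fun y : V => ((r y) k : ℂ))
      (Complex.ofRealCLM.comp ((PiLp.proj (𝕜 := ℝ) 2 (fun _ : Fin n => ℝ) k).comp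
        (fderiv ℝ r z.2))) z.2 :=
    Complex.ofRealCLM.hasFDerivAt.comp z.2
      ((PiLp.proj (𝕜 := ℝ) 2 (fun _ : Fin n => ℝ) k).hasFDerivAt.comp z.2 hr')
  have h3 : HasDerivAt (fun s : ℝ => Complex.exp ((s * χ k : ℝ) * Complex.I))
      (Complex.exp ((z.1 * χ k : ℝ) * Complex.I) * ((χ k : ℝ) * Complex.I)) z.1 := by
    have h4 : HasDerivAt (fun s : ℝ => ((s * χ k : ℝ) : ℂ)) ((1 * χ k : ℝ) : ℂ) z.1 :=
      ((hasDerivAt_id z.1).mul_const (χ k)).ofReal_comp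
    simpa using (h4.mul_const Complex.I).cexp
  have h5 := (h3.hasFDerivAt.comp z hasFDerivAt_fst).mul (h2.comp z hasFDerivAt_snd)
  have h6 := h1.unique h5
  have h7 := congrArg (fun L => L ζ) h6
  refine h7.trans ?_
  simp
  ring

/-- An immersion `r` into the unit ball of `ℝ^n` for which the norm of the projection of `r` onto a
coordinate subspace, with indicator `χ`, is determined by the norm of `r`. -/
structure IsTwistProfile (χ : Fin n → ℝ) (κ : ℝ) (r : V → EuclideanSpace ℝ (Fin n)) : Prop where
  chi_sq : ∀ k, χ k ^ 2 = χ k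
  kappa_pos : 0 < κ
  smooth : ContDiff ℝ ∞ r
  norm_lt : ∀ x, ‖r x‖ < 1
  sum_eq : ∀ x, ∑ k, χ k * r x k ^ 2 = κ * (1 - ‖r x‖ ^ 2)
  injective : ∀ x, Function.Injective (fderiv ℝ r x)

namespace IsTwistProfile

variable {χ : Fin n → ℝ} {κ : ℝ} {r : V → EuclideanSpace ℝ (Fin n)}
theorem sum_fderiv (h : IsTwistProfile χ κ r) (x ξ : V) : ∑ k, χ k * r x k * fderiv ℝ r x ξ k =
    -(κ * ∑ k, r x k * fderiv ℝ r x ξ k) := by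
  have hr' : HasFDerivAt r (fderiv ℝ r x) x :=
    (h.smooth.contDiffAt.differentiableAt (by simp)).hasFDerivAt
  have h1 : ∀ k, HasFDerivAt (fun y => r y k)
      ((PiLp.proj (𝕜 := ℝ) 2 (fun _ : Fin n => ℝ) k).comp (fderiv ℝ r x)) x := fun k =>
    (PiLp.proj (𝕜 := ℝ) 2 (fun _ : Fin n => ℝ) k).hasFDerivAt.comp x hr'
  have h2 := HasFDerivAt.fun_sum (u := Finset.univ) fun k _ =>
    ((h1 k).mul (h1 k)).const_mul (χ k + κ)
  have h3 : (fun y => ∑ k, (χ k + κ) * (r y k * r y k)) = fun _ => κ := by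
    funext y
    have h4 := h.sum_eq y
    rw [EuclideanSpace.real_norm_sq_eq] at h4
    calc ∑ k, (χ k + κ) * (r y k * r y k) = ∑ k, χ k * r y k ^ 2 + κ * ∑ k, r y k ^ 2 := by
          rw [Finset.mul_sum, ← Finset.sum_add_distrib]
          exact Finset.sum_congr rfl fun k _ => by ring
      _ = κ := by rw [h4]; ring
  replace h2 := h2.congr_of_eventuallyEq (f₁ := fun _ => κ)
    (Filter.Eventually.of_forall fun y => (congrFun h3 y).symm)
  have h5 := congrArg (fun L => L ξ) (h2.unique (hasFDerivAt_const κ x))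
  simp only [sum_apply, smul_apply,
    add_apply, ContinuousLinearMap.comp_apply, PiLp.proj_apply,
    smul_eq_mul, zero_apply] at h5
  rw [eq_neg_iff_add_eq_zero, Finset.mul_sum, ← Finset.sum_add_distrib]
  have h6 : ∑ k, (χ k + κ) * (r x k * fderiv ℝ r x ξ k + r x k * fderiv ℝ r x ξ k) =
      2 * ∑ k, (χ k * r x k * fderiv ℝ r x ξ k + κ * (r x k * fderiv ℝ r x ξ k)) := by
    rw [Finset.mul_sum]
    exact Finset.sum_congr rfl fun k _ => by ring
  linarith

theorem eq_zero_of_forall (h : IsTwistProfile χ κ r) {x ξ : V} {a : ℝ}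
    (h0 : ∀ k, a * (χ k * r x k) + fderiv ℝ r x ξ k = 0) : a = 0 ∧ ξ = 0 := by
  have ha := eq_zero_of_smul_add_eq_zero h.chi_sq (h.norm_lt x) h.kappa_pos (h.sum_eq x)
    (h.sum_fderiv x ξ) h0
  refine ⟨ha, h.injective x ?_⟩
  rw [map_zero]
  ext k
  have := h0 k
  rw [ha, zero_mul, zero_add] at this
  exact this

theorem fderiv_injective (h : IsTwistProfile χ κ r) (z : ℝ × V) : Function.Injective (fderiv ℝ (twistMap χ r) z) := by
  rw [injective_iff_map_eq_zero]
  intro ζ hζ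
  rw [fderiv_twistMap χ h.smooth] at hζ
  have h1 : tangentVec χ (r z.2) ζ.1 (fderiv ℝ r z.2 ζ.2) = 0 := by
    rw [← norm_eq_zero, ← norm_twist χ z.1, hζ, norm_zero]
  have h2 : ∀ k, ζ.1 * (χ k * r z.2 k) + fderiv ℝ r z.2 ζ.2 k = 0 := by
    intro k
    have h3 := congrArg (fun v => v k) h1
    simp only [tangentVec_apply, PiLp.zero_apply] at h3
    have h4 := congrArg Complex.re h3
    have h5 := congrArg Complex.im h3
    simp at h4 h5
    rw [h4, ← mul_assoc, add_zero]
    simpa using h5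
  obtain ⟨ha, hξ⟩ := h.eq_zero_of_forall h2
  exact Prod.ext ha hξ

theorem bergman_fderiv_im (h : IsTwistProfile χ κ r) (z ζ ζ' : ℝ × V) :
    (bergman (twistMap χ r z) (fderiv ℝ (twistMap χ r) z ζ)
      (fderiv ℝ (twistMap χ r) z ζ')).im = 0 := by
  rw [fderiv_twistMap χ h.smooth, fderiv_twistMap χ h.smooth, twistMap, bergman_twist]
  exact bergman_tangentVec_im (h.norm_lt _) (h.sum_eq _) (h.sum_fderiv _ _) (h.sum_fderiv _ _) _ _

theorem bergman_fderiv_one_zero_re (h : IsTwistProfile χ κ r) (z ζ : ℝ × V) :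
    (bergman (twistMap χ r z) (fderiv ℝ (twistMap χ r) z ζ)
      (fderiv ℝ (twistMap χ r) z (1, 0))).re = ζ.1 * (κ * (1 + κ)) := by
  rw [fderiv_twistMap χ h.smooth, fderiv_twistMap χ h.smooth, twistMap, bergman_twist, map_zero]
  exact bergman_tangentVec_one_zero_re h.chi_sq (h.norm_lt _) (h.sum_eq _) _ _

theorem inner_I_smul_fderiv_re (h : IsTwistProfile χ κ r) (z ζ : ℝ × V) :
    (inner ℂ (twistMap χ r z) (Complex.I • fderiv ℝ (twistMap χ r) z ζ)).re =
      -(ζ.1 * (κ * (1 - ‖twistMap χ r z‖ ^ 2))) := by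
  rw [norm_twistMap, fderiv_twistMap χ h.smooth, twistMap, inner_smul_right, inner_twist,
    inner_realVec_tangentVec, h.sum_eq]
  simp only [Complex.mul_re, Complex.add_re, Complex.add_im, Complex.ofReal_re, Complex.ofReal_im,
    Complex.mul_im, Complex.I_re, Complex.I_im]
  ring

/-- In a suitable frame, the phase of the complex volume of the tangent spaces is linear in the
angle. -/
theorem exists_basis_det (h : IsTwistProfile χ κ r) [FiniteDimensional ℝ V] (hn : Module.finrank ℝ V + 1 = n) :
    ∃ (b : Module.Basis (Fin n) ℝ (ℝ × V)) (c : ℂ), c ≠ 0 ∧ ∀ z : ℝ × V,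
      (colMatrix fun i => fderiv ℝ (twistMap χ r) z (b i)).det ≠ 0 ∧
      ∃ β : ℝ, (colMatrix fun i => fderiv ℝ (twistMap χ r) z (b i)).det =
        Complex.exp (((∑ k, χ k) * z.1 : ℝ) * Complex.I) * β * c := by
  let e : Unit ⊕ Fin (Module.finrank ℝ V) ≃ Fin n :=
    Fintype.equivFinOfCardEq (by simp; omega)
  let b : Module.Basis (Fin n) ℝ (ℝ × V) :=
    ((Module.Basis.singleton Unit ℝ).prod (Module.finBasis ℝ V)).reindex e
  have hb : ∀ i, (b i).1 = 0 ∨ (b i).2 = 0 := by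
    intro i
    simp only [b, Module.Basis.reindex_apply]
    rcases e.symm i with u | j
    · right
      simp
    · left
      simp
  let ph : Fin n → ℂ := fun i => if (b i).1 = 0 then 1 else Complex.I
  have hph : ∀ i, ph i ≠ 0 := fun i => by
    by_cases hi : (b i).1 = 0 <;> simp [ph, hi]
  refine ⟨b, ∏ i, ph i, Finset.prod_ne_zero_iff.mpr fun i _ => hph i, fun z => ?_⟩
  let R : Matrix (Fin n) (Fin n) ℝ :=
    Matrix.of fun k i => (b i).1 * (χ k * r z.2 k) + fderiv ℝ r z.2 (b i).2 k
  have hR : R.det ≠ 0 := by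
    intro h0
    obtain ⟨v, hv, hv0⟩ := Matrix.exists_mulVec_eq_zero_iff.mpr h0
    have h1 : ∀ k, (∑ i, v i • b i).1 * (χ k * r z.2 k) +
        fderiv ℝ r z.2 (∑ i, v i • b i).2 k = 0 := by
      intro k
      have h2 := congrFun hv0 k
      simp only [Matrix.mulVec, dotProduct, R, Matrix.of_apply, Pi.zero_apply] at h2
      rw [Prod.fst_sum, Prod.snd_sum, map_sum, ← h2, Finset.sum_mul, WithLp.ofLp_sum,
        Finset.sum_apply, ← Finset.sum_add_distrib]
      refine Finset.sum_congr rfl fun i _ => ?_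
      simp
      ring
    obtain ⟨h3, h4⟩ := h.eq_zero_of_forall h1
    have h5 : ∑ i, v i • b i = 0 := Prod.ext h3 h4
    exact hv (funext (Fintype.linearIndependent_iff.mp b.linearIndependent v h5))
  have hmat : (colMatrix fun i => fderiv ℝ (twistMap χ r) z (b i)) =
      Matrix.diagonal (fun k => Complex.exp ((z.1 * χ k : ℝ) * Complex.I)) *
        R.map Complex.ofRealHom * Matrix.diagonal ph := by
    ext k i
    rw [Matrix.mul_diagonal, Matrix.diagonal_mul]
    simp only [colMatrix, Matrix.of_apply, fderiv_twistMap χ h.smooth, twist_apply,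
      tangentVec_apply, Matrix.map_apply, R, mul_assoc]
    congr 1
    rcases hb i with hi | hi
    · simp [ph, hi]
    · by_cases hi' : (b i).1 = 0
      · simp [ph, hi, hi']
      · simp [ph, hi, hi']
  have hdet : (colMatrix fun i => fderiv ℝ (twistMap χ r) z (b i)).det =
      Complex.exp (((∑ k, χ k) * z.1 : ℝ) * Complex.I) * R.det * ∏ i, ph i := by
    rw [hmat, Matrix.det_mul, Matrix.det_mul, Matrix.det_diagonal, Matrix.det_diagonal,
      ← Complex.exp_sum, ← Finset.sum_mul]
    congr 2
    · congr 3
      push_cast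
      rw [Finset.sum_mul]
      exact Finset.sum_congr rfl fun k _ => mul_comm _ _
    · exact (RingHom.map_det Complex.ofRealHom R).symm
  refine ⟨?_, R.det, hdet⟩
  rw [hdet]
  exact mul_ne_zero (mul_ne_zero (Complex.exp_ne_zero _) (by exact_mod_cast hR))
    (Finset.prod_ne_zero_iff.mpr fun i _ => hph i)

end IsTwistProfile

end Twist

/-! ### Families of open parametrizations -/

section Param

variable {ι W M Y : Type*} [TopologicalSpace M] {α : ι → W → M}

theorem continuous_of_comp_param [TopologicalSpace W] [TopologicalSpace Y]
    (hαo : ∀ i, IsOpenMap (α i)) (hcov : ∀ p, ∃ i z, α i z = p) {g : M → Y}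
    (hg : ∀ i, Continuous (g ∘ α i)) : Continuous g := by
  rw [continuous_iff_continuousAt]
  intro p
  obtain ⟨i, z, rfl⟩ := hcov p
  have h1 : Filter.Tendsto g (Filter.map (α i) (𝓝 z)) (𝓝 (g (α i z))) :=
    (hg i).continuousAt
  exact h1.mono_left ((hαo i).nhds_le z)

open MeasureTheory in
/-- Differentiation under the integral sign over a compact set. -/
theorem hasDerivAt_setIntegral_of_param [NormedAddCommGroup W] [NormedSpace ℝ W]
    [MeasurableSpace M] [BorelSpace M] (μ : Measure M) [IsFiniteMeasureOnCompacts μ]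
    (hαo : ∀ i, IsOpenMap (α i)) (hcov : ∀ p, ∃ i z, α i z = p) {F : ℝ → M → ℝ}
    (hF : ∀ i z, ContDiffAt ℝ 1 (fun q : ℝ × W => F q.1 (α i q.2)) (0, z))
    (hFc : ∀ᶠ t in 𝓝 (0 : ℝ), Continuous (F t)) {K : Set M} (hK : IsCompact K)
    (hKm : MeasurableSet K) :
    HasDerivAt (fun t => ∫ p in K, F t p ∂μ) (∫ p in K, deriv (fun t => F t p) 0 ∂μ) 0 := by
  have hslice : ∀ i z, HasDerivAt (fun t => F t (α i z))
      (fderiv ℝ (fun q : ℝ × W => F q.1 (α i q.2)) (0, z) (1, 0)) 0 := by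
    intro i z
    have h1 : HasDerivAt (fun t : ℝ => (t, z)) ((1 : ℝ), (0 : W)) 0 :=
      (hasDerivAt_id 0).prodMk (hasDerivAt_const 0 z)
    exact ((hF i z).differentiableAt (by simp)).hasFDerivAt.comp_hasDerivAt (0 : ℝ) h1
  have hderiv : ∀ p, HasDerivAt (fun t => F t p) (deriv (fun t => F t p) 0) 0 := by
    intro p
    obtain ⟨i, z, rfl⟩ := hcov p
    exact (hslice i z).differentiableAt.hasDerivAt
  have hcont : Continuous fun p => deriv (fun t => F t p) 0 := by
    refine continuous_of_comp_param hαo hcov fun i => ?_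
    have h1 : ((fun p => deriv (fun t => F t p) 0) ∘ α i) = fun z =>
        fderiv ℝ (fun q : ℝ × W => F q.1 (α i q.2)) (0, z) (1, 0) :=
      funext fun z => (hslice i z).deriv
    rw [h1, continuous_iff_continuousAt]
    intro z
    have h2 : ContinuousAt (fderiv ℝ fun q : ℝ × W => F q.1 (α i q.2)) (0, z) :=
      ((hF i z).fderiv_right (m := 0) (by simp)).continuousAt
    have h3 : ContinuousAt (fun z : W => fderiv ℝ (fun q : ℝ × W => F q.1 (α i q.2)) (0, z)) z :=
      ContinuousAt.comp (f := fun z : W => ((0 : ℝ), z)) h2 (by fun_prop)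
    exact h3.clm_apply continuousAt_const
  have hlip : ∃ (C : NNReal) (δ : ℝ), 0 < δ ∧
      ∀ p ∈ K, LipschitzOnWith C (fun t => F t p) (Metric.ball 0 δ) := by
    refine hK.induction_on (p := fun s => ∃ (C : NNReal) (δ : ℝ), 0 < δ ∧
      ∀ p ∈ s, LipschitzOnWith C (fun t => F t p) (Metric.ball 0 δ)) ?_ ?_ ?_ ?_
    · exact ⟨0, 1, one_pos, by simp⟩
    · rintro s t hst ⟨C, δ, hδ, h⟩
      exact ⟨C, δ, hδ, fun p hp => h p (hst hp)⟩
    · rintro s t ⟨C, δ, hδ, h⟩ ⟨C', δ', hδ', h'⟩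
      refine ⟨max C C', min δ δ', lt_min hδ hδ', ?_⟩
      rintro p (hp | hp)
      · exact ((h p hp).mono (Metric.ball_subset_ball (min_le_left _ _))).weaken (le_max_left _ _)
      · exact ((h' p hp).mono (Metric.ball_subset_ball (min_le_right _ _))).weaken
          (le_max_right _ _)
    · intro p _
      obtain ⟨i, z, rfl⟩ := hcov p
      obtain ⟨C, s, hs, hC⟩ := (hF i z).exists_lipschitzOnWith
      rw [nhds_prod_eq] at hs
      obtain ⟨T, hT, N, hN, hTN⟩ := Filter.mem_prod_iff.mp hs
      obtain ⟨δ, hδ, hball⟩ := Metric.mem_nhds_iff.mp hT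
      refine ⟨α i '' N, mem_nhdsWithin_of_mem_nhds ((hαo i).image_mem_nhds hN), C, δ, hδ, ?_⟩
      rintro _ ⟨y, hy, rfl⟩
      rw [lipschitzOnWith_iff_dist_le_mul] at hC ⊢
      intro t ht t' ht'
      have := hC (t, y) (hTN ⟨hball ht, hy⟩) (t', y) (hTN ⟨hball ht', hy⟩)
      simpa [Prod.dist_eq] using this
  obtain ⟨C, δ, hδ, hC⟩ := hlip
  have hae : ∀ᵐ p ∂(μ.restrict K), p ∈ K := ae_restrict_mem hKm
  refine (hasDerivAt_integral_of_dominated_loc_of_lip (bound := fun _ => (C : ℝ))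
    (Metric.ball_mem_nhds 0 hδ) ?_ ?_ hcont.aestronglyMeasurable ?_ ?_ ?_).2
  · filter_upwards [hFc] with t ht using ht.aestronglyMeasurable
  · exact hFc.self_of_nhds.continuousOn.integrableOn_compact' hK hKm
  · filter_upwards [hae] with p hp
    simpa using hC p hp
  · have : IsFiniteMeasure (μ.restrict K) := ⟨by simpa using hK.measure_lt_top⟩
    exact integrable_const _
  · exact Filter.Eventually.of_forall hderiv

end Param

/-! ### Immersions with a circle symmetry -/

section

variable {E : Type*} [NormedAddCommGroup E] [NormedSpace ℝ E] [FiniteDimensional ℝ E]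
  {H : Type*} [TopologicalSpace H] (I : ModelWithCorners ℝ E H)
  {M : Type*} [TopologicalSpace M] [ChartedSpace H M] {n : ℕ} {ι : Type*}
  {V : Type*} [NormedAddCommGroup V] [NormedSpace ℝ V] [FiniteDimensional ℝ V]

/-- In the open parametrizations `α i`, the affine coordinates of `ψ` are obtained by twisting the
real immersions `r i`. -/
structure IsTwistedImmersion (ψ : M → CH n) (χ : Fin n → ℝ) (κ : ℝ) (α : ι → ℝ × V → M)
    (r : ι → V → EuclideanSpace ℝ (Fin n)) : Prop where
  smooth : ContMDiff I 𝓘(ℝ, EuclideanSpace ℂ (Fin n)) ∞ ψ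
  profile : ∀ i, IsTwistProfile χ κ (r i)
  smooth_param : ∀ i, ContMDiff 𝓘(ℝ, ℝ × V) I ∞ (α i)
  isOpenMap : ∀ i, IsOpenMap (α i)
  cover : ∀ p, ∃ i z, α i z = p
  coord : ∀ i z, affineCoord (ψ (α i z)) = twistMap χ (r i) z
  finrank_model : Module.finrank ℝ E = n
  finrank_param : Module.finrank ℝ V + 1 = n

namespace IsTwistedImmersion

variable {I} {ψ : M → CH n} {χ : Fin n → ℝ} {κ : ℝ} {α : ι → ℝ × V → M}
  {r : ι → V → EuclideanSpace ℝ (Fin n)}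

theorem dmap_mfderiv (h : IsTwistedImmersion I ψ χ κ α r) {ψ' : M → CH n}
    (hψ' : ContMDiff I 𝓘(ℝ, EuclideanSpace ℂ (Fin n)) ∞ ψ') (i : ι) (z ζ : ℝ × V) :
    dmap I ψ' (α i z) (mfderiv 𝓘(ℝ, ℝ × V) I (α i) z ζ) =
      fderiv ℝ (affineCoord ∘ ψ' ∘ α i) z ζ := by
  have h1 : MDifferentiableAt I 𝓘(ℝ, EuclideanSpace ℂ (Fin n)) ψ' (α i z) :=
    (hψ' _).mdifferentiableAt (by simp)
  have h2 : MDifferentiableAt 𝓘(ℝ, ℝ × V) I (α i) z :=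
    (h.smooth_param i z).mdifferentiableAt (by simp)
  rw [← dmap_eq_fderiv (h1.comp z h2)]
  exact (congrArg (fun L => L ζ) (mfderiv_comp z h1 h2)).symm

theorem dmap_mfderiv_self (h : IsTwistedImmersion I ψ χ κ α r) (i : ι) (z ζ : ℝ × V) :
    dmap I ψ (α i z) (mfderiv 𝓘(ℝ, ℝ × V) I (α i) z ζ) = fderiv ℝ (twistMap χ (r i)) z ζ := by
  rw [h.dmap_mfderiv h.smooth]
  congr 2
  exact funext fun z => h.coord i z

theorem exists_equiv (h : IsTwistedImmersion I ψ χ κ α r) (i : ι) (z : ℝ × V) :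
    ∃ A : (ℝ × V) ≃ₗ[ℝ] E, ∀ ζ, A ζ = mfderiv 𝓘(ℝ, ℝ × V) I (α i) z ζ := by
  let L : (ℝ × V) →L[ℝ] E := mfderiv 𝓘(ℝ, ℝ × V) I (α i) z
  let A : (ℝ × V) →ₗ[ℝ] E := L.toLinearMap
  have hA : Function.Injective A := by
    intro ζ ζ' hζ
    apply (h.profile i).fderiv_injective z
    rw [← h.dmap_mfderiv_self, ← h.dmap_mfderiv_self]
    exact congrArg (dmap I ψ (α i z)) hζ
  have hdim : Module.finrank ℝ (ℝ × V) = Module.finrank ℝ E := by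
    rw [Module.finrank_prod, Module.finrank_self, h.finrank_model, ← h.finrank_param, add_comm]
  exact ⟨LinearEquiv.ofInjectiveOfFinrankEq A hA hdim, fun ζ => rfl⟩

theorem exists_eq_mfderiv (h : IsTwistedImmersion I ψ χ κ α r) (i : ι) (z : ℝ × V)
    (u : TangentSpace I (α i z)) : ∃ ζ : ℝ × V, mfderiv 𝓘(ℝ, ℝ × V) I (α i) z ζ = u := by
  obtain ⟨A, hA⟩ := h.exists_equiv i z
  exact ⟨A.symm u, by rw [← hA]; exact A.apply_symm_apply u⟩

theorem isLagrangianImmersion [I.Boundaryless] [IsManifold I ∞ M]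
    (h : IsTwistedImmersion I ψ χ κ α r) :
    IsLagrangianImmersion I ψ where
  isImmersion := by
    refine isImmersion_of_mfderiv_injective h.smooth (fun p => ?_) (d := n) ?_
    · obtain ⟨i, z, rfl⟩ := h.cover p
      intro u u' huu
      obtain ⟨ζ, rfl⟩ := h.exists_eq_mfderiv i z u
      obtain ⟨ζ', rfl⟩ := h.exists_eq_mfderiv i z u'
      congr 1
      apply (h.profile i).fderiv_injective z
      rw [← h.dmap_mfderiv_self, ← h.dmap_mfderiv_self]
      exact huu
    · rw [h.finrank_model, finrank_real_of_complex, finrank_euclideanSpace_fin]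
      ring
  finrank_eq := h.finrank_model
  pullback_kahler := by
    intro p u v
    obtain ⟨i, z, rfl⟩ := h.cover p
    obtain ⟨ζ, rfl⟩ := h.exists_eq_mfderiv i z u
    obtain ⟨ζ', rfl⟩ := h.exists_eq_mfderiv i z v
    rw [chKahler_eq, h.dmap_mfderiv_self, h.dmap_mfderiv_self, h.coord,
      (h.profile i).bergman_fderiv_im, neg_zero]

end IsTwistedImmersion

end

section

variable {E : Type*} [NormedAddCommGroup E] [NormedSpace ℝ E] [FiniteDimensional ℝ E]
  {H : Type*} [TopologicalSpace H] {I : ModelWithCorners ℝ E H}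
  {M : Type*} [TopologicalSpace M] [ChartedSpace H M] {n : ℕ} {ι : Type*}
  {V : Type*} [NormedAddCommGroup V] [NormedSpace ℝ V] [FiniteDimensional ℝ V]

/-- A Gram matrix of vectors spanning a Lagrangian subspace has positive determinant. -/
theorem gram_det_pos {w : EuclideanSpace ℂ (Fin n)} (hw : ‖w‖ < 1)
    {u : Fin n → EuclideanSpace ℂ (Fin n)} (hlag : ∀ i j, (bergman w (u i) (u j)).im = 0)
    (hne : (colMatrix u).det ≠ 0) : 0 < (gram w u).det := by
  have h1 : hermGram w u = (gram w u).map Complex.ofRealHom := by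
    ext i j
    exact Complex.ext (by simp [hermGram, gram]) (by simp [hermGram, gram, hlag])
  have h2 : ((gram w u).det : ℂ) =
      ((‖(colMatrix u).det‖ ^ 2 * (1 - ‖w‖ ^ 2)⁻¹ ^ (n + 1) : ℝ) : ℂ) := by
    have h3 := det_hermGram hw u
    rw [h1, Complex.star_def, Complex.mul_conj, Complex.normSq_eq_norm_sq] at h3
    have h4 := RingHom.map_det Complex.ofRealHom (gram w u)
    change ((gram w u).det : ℂ) = ((gram w u).map Complex.ofRealHom).det at h4
    rw [h4, h3]
    push_cast
    rfl
  rw [Complex.ofReal_injective h2]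
  have := one_sub_norm_sq_pos hw
  have := norm_pos_iff.mpr hne
  positivity

/-- The Gram determinant of the metric induced by `ψ` in a basis of the model space. -/
def gramDet (I : ModelWithCorners ℝ E H) (ψ : M → CH n) (p : M) : ℝ :=
  (gram (affineCoord (ψ p)) fun i => dmap I ψ p (Module.finBasis ℝ E i)).det

/-- The ratio of the volume densities of two maps. -/
def densityRatio (I : ModelWithCorners ℝ E H) (ψ ψ' : M → CH n) (p : M) : ℝ :=
  √(gramDet I ψ' p) / √(gramDet I ψ p)

theorem volDensity_extend_symm [I.Boundaryless] [IsManifold I ∞ M]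
    {e : OpenPartialHomeomorph M H} (he : e ∈ atlas H M) {x : E} (hx : x ∈ (e.extend I).target) :
    ∃ A : E →ₗ[ℝ] E, ∀ ψ' : M → CH n, ContMDiff I 𝓘(ℝ, EuclideanSpace ℂ (Fin n)) ∞ ψ' →
      volDensity (Module.finBasis ℝ E) ψ' (e.extend I).symm x =
        |LinearMap.det A| * √(gramDet I ψ' ((e.extend I).symm x)) := by
  have h2 : MDifferentiableAt 𝓘(ℝ, E) I (e.extend I).symm x :=
    (contMDiffAt_extend_symm he hx).mdifferentiableAt (by simp)
  let L : E →L[ℝ] E := mfderiv 𝓘(ℝ, E) I (e.extend I).symm x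
  refine ⟨L.toLinearMap, fun ψ' hψ' => ?_⟩
  have h1 : MDifferentiableAt I 𝓘(ℝ, EuclideanSpace ℂ (Fin n)) ψ' ((e.extend I).symm x) :=
    (hψ' _).mdifferentiableAt (by simp)
  let D : E →L[ℝ] EuclideanSpace ℂ (Fin n) :=
    mfderiv I 𝓘(ℝ, EuclideanSpace ℂ (Fin n)) ψ' ((e.extend I).symm x)
  have h3 : ∀ u, fderiv ℝ (affineCoord ∘ ψ' ∘ (e.extend I).symm) x u = D (L u) := by
    intro u
    rw [← dmap_eq_fderiv (h1.comp x h2)]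
    exact congrArg (fun L => L u) (mfderiv_comp x h1 h2)
  rw [volDensity_eq _ (h1.comp x h2)]
  simp only [h3]
  have h5 := gram_det_comp (Module.finBasis ℝ E) L.toLinearMap
    (affineCoord (ψ' ((e.extend I).symm x))) D.toLinearMap
  rw [← Real.sqrt_sq_eq_abs, ← Real.sqrt_mul (sq_nonneg _)]
  exact congrArg Real.sqrt h5

namespace IsTwistedImmersion

variable {ψ : M → CH n} {χ : Fin n → ℝ} {κ : ℝ} {α : ι → ℝ × V → M}
  {r : ι → V → EuclideanSpace ℝ (Fin n)}

theorem exists_gram_det_eq (h : IsTwistedImmersion I ψ χ κ α r)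
    (b : Module.Basis (Fin n) ℝ (ℝ × V)) (i : ι) (z : ℝ × V) :
    ∃ c : ℝ, 0 < c ∧ ∀ ψ' : M → CH n, ContMDiff I 𝓘(ℝ, EuclideanSpace ℂ (Fin n)) ∞ ψ' →
      (gram (affineCoord (ψ' (α i z))) fun k =>
        fderiv ℝ (affineCoord ∘ ψ' ∘ α i) z (b k)).det = c * gramDet I ψ' (α i z) := by
  obtain ⟨A, hA⟩ := h.exists_equiv i z
  obtain ⟨c, hc, hc'⟩ := HMinLag.exists_gram_det_eq (n := n) (Module.finBasis ℝ E) b A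
  refine ⟨c, hc, fun ψ' hψ' => ?_⟩
  let D : E →L[ℝ] EuclideanSpace ℂ (Fin n) :=
    mfderiv I 𝓘(ℝ, EuclideanSpace ℂ (Fin n)) ψ' (α i z)
  have h1 : ∀ ζ, fderiv ℝ (affineCoord ∘ ψ' ∘ α i) z ζ = D (A ζ) := by
    intro ζ
    rw [← h.dmap_mfderiv hψ', hA]
    rfl
  simp only [h1]
  exact hc' _ D.toLinearMap

theorem gram_det_pos (h : IsTwistedImmersion I ψ χ κ α r) {b : Module.Basis (Fin n) ℝ (ℝ × V)}
    (i : ι) (z : ℝ × V)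
    (hb : (colMatrix fun k => fderiv ℝ (twistMap χ (r i)) z (b k)).det ≠ 0) :
    0 < (gram (affineCoord (ψ (α i z))) fun k => fderiv ℝ (affineCoord ∘ ψ ∘ α i) z (b k)).det := by
  have h1 : affineCoord ∘ ψ ∘ α i = twistMap χ (r i) := funext fun z => h.coord i z
  rw [h1, h.coord]
  refine HMinLag.gram_det_pos ?_ (fun j k => (h.profile i).bergman_fderiv_im _ _ _) hb
  rw [← h.coord]
  exact norm_affineCoord_lt _

theorem gramDet_pos (h : IsTwistedImmersion I ψ χ κ α r) (p : M) : 0 < gramDet I ψ p := by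
  obtain ⟨i, z, rfl⟩ := h.cover p
  obtain ⟨b, _, _, hb⟩ := (h.profile i).exists_basis_det h.finrank_param
  obtain ⟨c, hc, hc'⟩ := h.exists_gram_det_eq b i z
  have h1 := h.gram_det_pos i z (hb z).1
  rw [hc' ψ h.smooth] at h1
  exact pos_of_mul_pos_right h1 hc.le

theorem densityRatio_eq (h : IsTwistedImmersion I ψ χ κ α r)
    (b : Module.Basis (Fin n) ℝ (ℝ × V)) (i : ι) (z : ℝ × V) {ψ' : M → CH n}
    (hψ' : ContMDiff I 𝓘(ℝ, EuclideanSpace ℂ (Fin n)) ∞ ψ') :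
    densityRatio I ψ ψ' (α i z) =
      √(gram (affineCoord (ψ' (α i z))) fun k =>
        fderiv ℝ (affineCoord ∘ ψ' ∘ α i) z (b k)).det /
      √(gram (affineCoord (ψ (α i z))) fun k =>
        fderiv ℝ (affineCoord ∘ ψ ∘ α i) z (b k)).det := by
  obtain ⟨c, hc, hc'⟩ := h.exists_gram_det_eq b i z
  rw [hc' ψ h.smooth, hc' ψ' hψ', Real.sqrt_mul hc.le, Real.sqrt_mul hc.le,
    mul_div_mul_left _ _ (Real.sqrt_pos.mpr hc).ne', densityRatio]

theorem contDiff_coord (h : IsTwistedImmersion I ψ χ κ α r) {ψ' : M → CH n}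
    (hψ' : ContMDiff I 𝓘(ℝ, EuclideanSpace ℂ (Fin n)) ∞ ψ') (i : ι) :
    ContDiff ℝ ∞ (affineCoord ∘ ψ' ∘ α i) :=
  (contMDiff_affineCoord.comp (hψ'.comp (h.smooth_param i))).contDiff

theorem continuous_densityRatio (h : IsTwistedImmersion I ψ χ κ α r) {ψ' : M → CH n}
    (hψ' : ContMDiff I 𝓘(ℝ, EuclideanSpace ℂ (Fin n)) ∞ ψ') :
    Continuous (densityRatio I ψ ψ') := by
  refine continuous_of_comp_param h.isOpenMap h.cover fun i => ?_
  obtain ⟨b, _, _, hb⟩ := (h.profile i).exists_basis_det h.finrank_param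
  have h1 : ∀ ψ' : M → CH n, ContMDiff I 𝓘(ℝ, EuclideanSpace ℂ (Fin n)) ∞ ψ' →
      Continuous fun z => √(gram (affineCoord (ψ' (α i z))) fun k =>
        fderiv ℝ (affineCoord ∘ ψ' ∘ α i) z (b k)).det := by
    intro ψ' hψ'
    refine Real.continuous_sqrt.comp (ContDiff.continuous (𝕜 := ℝ) (n := ∞) ?_)
    rw [contDiff_iff_contDiffAt]
    intro z
    refine ContDiffAt.gram_det (h.contDiff_coord hψ' i).contDiffAt (fun k => ?_)
      (norm_affineCoord_lt _)
    exact ((h.contDiff_coord hψ' i).contDiffAt.fderiv_right (m := ∞) (by simp)).clm_apply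
      contDiffAt_const
  have h2 : densityRatio I ψ ψ' ∘ α i = fun z =>
      √(gram (affineCoord (ψ' (α i z))) fun k =>
        fderiv ℝ (affineCoord ∘ ψ' ∘ α i) z (b k)).det /
      √(gram (affineCoord (ψ (α i z))) fun k =>
        fderiv ℝ (affineCoord ∘ ψ ∘ α i) z (b k)).det :=
    funext fun z => h.densityRatio_eq b i z hψ'
  rw [h2]
  exact (h1 ψ' hψ').div (h1 ψ h.smooth) fun z => (Real.sqrt_pos.mpr
    (h.gram_det_pos i z (hb z).1)).ne'

open MeasureTheory in
theorem volMeasure_eq [MeasurableSpace E] [BorelSpace E] [MeasurableSpace M] [BorelSpace M]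
    [I.Boundaryless] [IsManifold I ∞ M] [SecondCountableTopology M]
    (h : IsTwistedImmersion I ψ χ κ α r) {ψ' : M → CH n}
    (hψ' : ContMDiff I 𝓘(ℝ, EuclideanSpace ℂ (Fin n)) ∞ ψ') :
    volMeasure I ψ' =
      (volMeasure I ψ).withDensity fun p => ENNReal.ofReal (densityRatio I ψ ψ' p) := by
  refine volMeasure_eq_withDensity h.smooth hψ' (h.continuous_densityRatio hψ')
    (fun p => div_nonneg (Real.sqrt_nonneg _) (Real.sqrt_nonneg _)) fun e he x hx => ?_
  obtain ⟨A, hA⟩ := volDensity_extend_symm (n := n) he hx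
  rw [hA ψ h.smooth, hA ψ' hψ', densityRatio]
  have := (Real.sqrt_pos.mpr (h.gramDet_pos ((e.extend I).symm x))).ne'
  field_simp

end IsTwistedImmersion

end

section

variable {E : Type*} [NormedAddCommGroup E] [NormedSpace ℝ E] [FiniteDimensional ℝ E]
  {H : Type*} [TopologicalSpace H] {I : ModelWithCorners ℝ E H}
  {M : Type*} [TopologicalSpace M] [ChartedSpace H M] {n : ℕ} {ι : Type*}
  {V : Type*} [NormedAddCommGroup V] [NormedSpace ℝ V] [FiniteDimensional ℝ V]
  {ψ : M → CH n} {χ : Fin n → ℝ} {κ : ℝ} {α : ι → ℝ × V → M}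
  {r : ι → V → EuclideanSpace ℝ (Fin n)} {Ψ : ℝ → M → CH n} {ε : ℝ} {K : Set M}

/-! ### The first variation of the volume density -/

theorem IsVariation.contMDiff (hv : IsVariation I ψ Ψ ε K) {t : ℝ} (ht : t ∈ Set.Ioo (-ε) ε) :
    ContMDiff I 𝓘(ℝ, EuclideanSpace ℂ (Fin n)) ∞ (Ψ t) := by
  intro p
  have h1 : ContMDiffAt (𝓘(ℝ, ℝ).prod I) 𝓘(ℝ, EuclideanSpace ℂ (Fin n)) ∞
      (fun x : ℝ × M => Ψ x.1 x.2) (t, p) :=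
    hv.smooth.contMDiffAt (prod_mem_nhds (isOpen_Ioo.mem_nhds ht) Filter.univ_mem)
  exact h1.comp p (contMDiffAt_const.prodMk contMDiffAt_id)

/-- The affine coordinates of a variation in a parametrization. -/
def variationCoord (Ψ : ℝ → M → CH n) (φ : ℝ × V → M) (q : ℝ × ℝ × V) :
    EuclideanSpace ℂ (Fin n) := affineCoord (Ψ q.1 (φ q.2))

theorem contDiffOn_variationCoord (hv : IsVariation I ψ Ψ ε K) {φ : ℝ × V → M}
    (hφ : ContMDiff 𝓘(ℝ, ℝ × V) I ∞ φ) :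
    ContDiffOn ℝ ∞ (variationCoord Ψ φ) (Set.Ioo (-ε) ε ×ˢ Set.univ) := by
  have h1 : ContMDiff 𝓘(ℝ, ℝ × ℝ × V) 𝓘(ℝ, ℝ) ∞ (fun q : ℝ × ℝ × V => q.1) :=
    contDiff_fst.contMDiff
  have h2 : ContMDiff 𝓘(ℝ, ℝ × ℝ × V) I ∞ (fun q : ℝ × ℝ × V => φ q.2) :=
    hφ.comp contDiff_snd.contMDiff
  have h3 : ContMDiffOn 𝓘(ℝ, ℝ × ℝ × V) 𝓘(ℝ, EuclideanSpace ℂ (Fin n)) ∞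
      (variationCoord Ψ φ) (Set.Ioo (-ε) ε ×ˢ Set.univ) :=
    contMDiff_affineCoord.comp_contMDiffOn
      (hv.smooth.comp (h1.prodMk h2).contMDiffOn fun q hq => ⟨hq.1, Set.mem_univ _⟩)
  exact h3.contDiffOn

theorem contDiffAt_variationCoord (hv : IsVariation I ψ Ψ ε K) {φ : ℝ × V → M}
    (hφ : ContMDiff 𝓘(ℝ, ℝ × V) I ∞ φ) {t : ℝ} (ht : t ∈ Set.Ioo (-ε) ε) (z : ℝ × V) :
    ContDiffAt ℝ ∞ (variationCoord Ψ φ) (t, z) :=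
  (contDiffOn_variationCoord hv hφ).contDiffAt
    (prod_mem_nhds (isOpen_Ioo.mem_nhds ht) Filter.univ_mem)

theorem fderiv_variationCoord_zero (hv : IsVariation I ψ Ψ ε K) {φ : ℝ × V → M}
    (hφ : ContMDiff 𝓘(ℝ, ℝ × V) I ∞ φ) {t : ℝ} (ht : t ∈ Set.Ioo (-ε) ε) (z ζ : ℝ × V) :
    fderiv ℝ (variationCoord Ψ φ) (t, z) (0, ζ) = fderiv ℝ (affineCoord ∘ Ψ t ∘ φ) z ζ := by
  have h1 := ((contDiffAt_variationCoord hv hφ ht z).differentiableAt (by simp)).hasFDerivAt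
  have h2 : HasFDerivAt (fun z : ℝ × V => (t, z))
      (ContinuousLinearMap.inr ℝ ℝ (ℝ × V)) z := hasFDerivAt_prodMk_right t z
  have h3 : HasFDerivAt (affineCoord ∘ Ψ t ∘ φ) _ z := h1.comp z h2
  rw [h3.fderiv]
  rfl

theorem fderiv_variationCoord_one (hv : IsVariation I ψ Ψ ε K) {φ : ℝ × V → M}
    (hφ : ContMDiff 𝓘(ℝ, ℝ × V) I ∞ φ) (z : ℝ × V) :
    fderiv ℝ (variationCoord Ψ φ) (0, z) (1, 0) =
      dmap 𝓘(ℝ, ℝ) (fun t => Ψ t (φ z)) 0 (1 : ℝ) := by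
  have h0 : (0 : ℝ) ∈ Set.Ioo (-ε) ε := ⟨neg_lt_zero.mpr hv.pos, hv.pos⟩
  have h1 := ((contDiffAt_variationCoord hv hφ h0 z).differentiableAt (by simp)).hasFDerivAt
  have h2 : HasFDerivAt (fun t : ℝ => (t, z))
      (ContinuousLinearMap.inl ℝ ℝ (ℝ × V)) 0 := hasFDerivAt_prodMk_left 0 z
  have h3 : HasFDerivAt (variationCoord Ψ φ ∘ fun t => (t, z)) _ 0 := h1.comp (0 : ℝ) h2
  have h4 : ContMDiffAt (𝓘(ℝ, ℝ).prod I) 𝓘(ℝ, EuclideanSpace ℂ (Fin n)) ∞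
      (fun x : ℝ × M => Ψ x.1 x.2) (0, φ z) :=
    hv.smooth.contMDiffAt (prod_mem_nhds (isOpen_Ioo.mem_nhds h0) Filter.univ_mem)
  have h5 : ContMDiffAt 𝓘(ℝ, ℝ) 𝓘(ℝ, EuclideanSpace ℂ (Fin n)) ∞ (fun t => Ψ t (φ z)) 0 :=
    h4.comp (0 : ℝ) (contMDiffAt_id.prodMk contMDiffAt_const)
  rw [dmap_eq_fderiv (h5.mdifferentiableAt (by simp))]
  exact (congrArg (fun L => L (1 : ℝ)) h3.fderiv).symm

namespace IsTwistedImmersion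

theorem densityRatio_variation (h : IsTwistedImmersion I ψ χ κ α r) (hv : IsVariation I ψ Ψ ε K)
    (b : Module.Basis (Fin n) ℝ (ℝ × V)) (i : ι) {t : ℝ} (ht : t ∈ Set.Ioo (-ε) ε) (z : ℝ × V) :
    densityRatio I ψ (Ψ t) (α i z) =
      √(gram (variationCoord Ψ (α i) (t, z)) fun k =>
        fderiv ℝ (variationCoord Ψ (α i)) (t, z) (0, b k)).det /
      √(gram (variationCoord Ψ (α i) (0, z)) fun k =>
        fderiv ℝ (variationCoord Ψ (α i)) (0, z) (0, b k)).det := by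
  have h0 : (0 : ℝ) ∈ Set.Ioo (-ε) ε := ⟨neg_lt_zero.mpr hv.pos, hv.pos⟩
  simp only [fderiv_variationCoord_zero hv (h.smooth_param i) ht,
    fderiv_variationCoord_zero hv (h.smooth_param i) h0, variationCoord]
  rw [h.densityRatio_eq b i z (hv.contMDiff ht), hv.zero]

theorem gram_variationCoord_pos (h : IsTwistedImmersion I ψ χ κ α r)
    (hv : IsVariation I ψ Ψ ε K) {b : Module.Basis (Fin n) ℝ (ℝ × V)} (i : ι) (z : ℝ × V)
    (hb : (colMatrix fun k => fderiv ℝ (twistMap χ (r i)) z (b k)).det ≠ 0) :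
    0 < (gram (variationCoord Ψ (α i) (0, z)) fun k =>
        fderiv ℝ (variationCoord Ψ (α i)) (0, z) (0, b k)).det := by
  have h0 : (0 : ℝ) ∈ Set.Ioo (-ε) ε := ⟨neg_lt_zero.mpr hv.pos, hv.pos⟩
  simp only [fderiv_variationCoord_zero hv (h.smooth_param i) h0, variationCoord]
  rw [hv.zero]
  exact h.gram_det_pos i z hb

theorem contDiffAt_densityRatio (h : IsTwistedImmersion I ψ χ κ α r) (hv : IsVariation I ψ Ψ ε K)
    (i : ι) (z : ℝ × V) :
    ContDiffAt ℝ 1 (fun q : ℝ × ℝ × V => densityRatio I ψ (Ψ q.1) (α i q.2)) (0, z) := by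
  have h0 : (0 : ℝ) ∈ Set.Ioo (-ε) ε := ⟨neg_lt_zero.mpr hv.pos, hv.pos⟩
  obtain ⟨b, _, _, hb⟩ := (h.profile i).exists_basis_det h.finrank_param
  have hpos := h.gram_variationCoord_pos hv i z (hb z).1
  have hw := contDiffAt_variationCoord hv (h.smooth_param i) h0 z
  have h1 : ContDiffAt ℝ ∞ (fun q : ℝ × ℝ × V => (gram (variationCoord Ψ (α i) q) fun k =>
      fderiv ℝ (variationCoord Ψ (α i)) q (0, b k)).det) (0, z) := by
    refine ContDiffAt.gram_det hw (fun k => ?_) (norm_affineCoord_lt _)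
    exact (hw.fderiv_right (m := ∞) (by simp)).clm_apply contDiffAt_const
  have h2 : ContDiffAt ℝ ∞ (fun q : ℝ × ℝ × V => (gram (variationCoord Ψ (α i) (0, q.2)) fun k =>
      fderiv ℝ (variationCoord Ψ (α i)) (0, q.2) (0, b k)).det) (0, z) :=
    ContDiffAt.comp (f := fun q : ℝ × ℝ × V => ((0 : ℝ), q.2)) (0, z) h1
      (contDiffAt_const.prodMk contDiffAt_snd)
  have h3 := (h1.sqrt hpos.ne').div (h2.sqrt hpos.ne') (Real.sqrt_pos.mpr hpos).ne'
  refine (h3.of_le (by simp)).congr_of_eventuallyEq ?_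
  filter_upwards [prod_mem_nhds (isOpen_Ioo.mem_nhds h0) Filter.univ_mem] with q hq
  exact h.densityRatio_variation hv b i hq.1 q.2

/-- The first variation of the volume density under a Hamiltonian variation. -/
theorem hasDerivAt_densityRatio (h : IsTwistedImmersion I ψ χ κ α r)
    (hv : IsVariation I ψ Ψ ε K) {f : M → ℝ} {X : (p : M) → TangentSpace I p}
    (hf : ContMDiff I 𝓘(ℝ, ℝ) ∞ f) (hX : IsInducedGradient I ψ f X)
    (hH : ∀ p, dmap 𝓘(ℝ, ℝ) (fun t => Ψ t p) 0 (1 : ℝ) = chJ (dmap I ψ p (X p)))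
    (i : ι) (z : ℝ × V) :
    HasDerivAt (fun t => densityRatio I ψ (Ψ t) (α i z))
      (-((∑ k, χ k + (n + 1) * κ) / (κ * (1 + κ))) * fderiv ℝ (f ∘ α i) z (1, 0)) 0 := by
  have h0 : (0 : ℝ) ∈ Set.Ioo (-ε) ε := ⟨neg_lt_zero.mpr hv.pos, hv.pos⟩
  obtain ⟨b, c, hc, hb⟩ := (h.profile i).exists_basis_det h.finrank_param
  have hpos := h.gram_variationCoord_pos hv i z (hb z).1
  have hκ := (h.profile i).kappa_pos
  choose Y hY using fun z => h.exists_eq_mfderiv i z (X (α i z))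
  have hw0 : ∀ z, variationCoord Ψ (α i) (0, z) = twistMap χ (r i) z := fun z => by
    rw [variationCoord, hv.zero, h.coord]
  have hD : ∀ z ζ, fderiv ℝ (variationCoord Ψ (α i)) (0, z) (0, ζ) =
      fderiv ℝ (twistMap χ (r i)) z ζ := fun z ζ => by
    rw [fderiv_variationCoord_zero hv (h.smooth_param i) h0, hv.zero]
    congr 2
    exact funext fun z => h.coord i z
  have hT : ∀ z, fderiv ℝ (variationCoord Ψ (α i)) (0, z) (1, 0) =
      Complex.I • fderiv ℝ (twistMap χ (r i)) z (Y z) := fun z => by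
    rw [fderiv_variationCoord_one hv (h.smooth_param i), hH, ← hY, h.dmap_mfderiv_self]
    rfl
  have key := hasDerivAt_gram_det (fun k => b k) hv.pos
    (contDiffOn_variationCoord hv (h.smooth_param i)) (fun q => norm_affineCoord_lt _) z
    (fun j k => by
      rw [hw0, hD, hD]
      exact (h.profile i).bergman_fderiv_im _ _ _)
    (fun z k => b.repr (Y z) k)
    (fun z => by
      simp only [hD, hT]
      conv_lhs => rw [← b.sum_repr (Y z)]
      simp only [map_sum, map_smul])
    (∑ k, χ k) (ContinuousLinearMap.fst ℝ ℝ V) c hc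
    (fun z => by
      simp only [hD]
      exact (hb z).2)
    (by
      simp only [hD]
      exact (hb z).1)
  have hYs : ∑ k, b.repr (Y z) k * ContinuousLinearMap.fst ℝ ℝ V (b k) = (Y z).1 := by
    conv_rhs => rw [← b.sum_repr (Y z)]
    rw [Prod.fst_sum]
    rfl
  have hnorm : 0 < 1 - ‖twistMap χ (r i) z‖ ^ 2 := by
    rw [← h.coord]
    exact one_sub_norm_sq_pos (norm_affineCoord_lt _)
  have hgrad : (Y z).1 * (κ * (1 + κ)) = fderiv ℝ (f ∘ α i) z (1, 0) := by
    have h1 := hX (α i z) (mfderiv 𝓘(ℝ, ℝ × V) I (α i) z (1, 0))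
    rw [← hY, h.dmap_mfderiv_self, h.dmap_mfderiv_self, chMetric_eq, h.coord,
      (h.profile i).bergman_fderiv_one_zero_re] at h1
    have h2 := mfderiv_comp z ((hf (α i z)).mdifferentiableAt (by simp))
      ((h.smooth_param i z).mdifferentiableAt (by simp))
    rw [mfderiv_eq_fderiv] at h2
    rw [h1, h2]
    rfl
  rw [hYs, hT, hw0, (h.profile i).inner_I_smul_fderiv_re] at key
  have hsq := (key.sqrt hpos.ne').div_const
    (√(gram (variationCoord Ψ (α i) (0, z)) fun k =>
        fderiv ℝ (variationCoord Ψ (α i)) (0, z) (0, b k)).det)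
  have hev : (fun t => densityRatio I ψ (Ψ t) (α i z)) =ᶠ[𝓝 0] fun t =>
      √(gram (variationCoord Ψ (α i) (t, z)) fun k =>
        fderiv ℝ (variationCoord Ψ (α i)) (t, z) (0, b k)).det /
      √(gram (variationCoord Ψ (α i) (0, z)) fun k =>
        fderiv ℝ (variationCoord Ψ (α i)) (0, z) (0, b k)).det := by
    filter_upwards [isOpen_Ioo.mem_nhds h0] with t ht using h.densityRatio_variation hv b i ht z
  refine (hsq.congr_of_eventuallyEq hev).congr_deriv ?_
  rw [← hgrad, ← hw0]
  rw [← hw0] at hnorm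
  set G := (gram (variationCoord Ψ (α i) (0, z)) fun k =>
        fderiv ℝ (variationCoord Ψ (α i)) (0, z) (0, b k)).det with hG
  have h3 : √G ≠ 0 := (Real.sqrt_pos.mpr hpos).ne'
  have h4 : √G ^ 2 = G := Real.sq_sqrt hpos.le
  have h5 := hnorm.ne'
  have h6 : 1 + κ ≠ 0 := by positivity
  field_simp
  rw [h4]
  ring

end IsTwistedImmersion

end

section

variable {E : Type*} [NormedAddCommGroup E] [NormedSpace ℝ E] [FiniteDimensional ℝ E]
  {H : Type*} [TopologicalSpace H] {I : ModelWithCorners ℝ E H}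
  {M : Type*} [TopologicalSpace M] [ChartedSpace H M] {n : ℕ} {ι : Type*}
  {V : Type*} [NormedAddCommGroup V] [NormedSpace ℝ V] [FiniteDimensional ℝ V]
  {ψ : M → CH n} {χ : Fin n → ℝ} {κ : ℝ} {α : ι → ℝ × V → M}
  {r : ι → V → EuclideanSpace ℝ (Fin n)}

theorem vol_eq [MeasurableSpace E] [BorelSpace E] [MeasurableSpace M] [BorelSpace M]
    (ψ : M → CH n) (K : Set M) : vol I ψ K = volMeasure I ψ K := by
  obtain rfl := BorelSpace.measurable_eq (α := M)
  rfl

/-! ### Invariance under rotations and criticality -/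

/-- The action of the circle on `M` corresponds to translations of the angle in the
parametrizations. -/
structure IsRotation [MulAction Circle M] (α : ι → ℝ × V → M) : Prop where
  smul_param : ∀ i s x τ, Circle.exp τ • α i (s, x) = α i (s + τ, x)

variable [MulAction Circle M]

namespace IsTwistedImmersion

theorem coord_smul (h : IsTwistedImmersion I ψ χ κ α r) (hR : IsRotation α) (τ : ℝ) (p : M) :
    affineCoord (ψ (Circle.exp τ • p)) = twist χ τ (affineCoord (ψ p)) := by
  obtain ⟨i, ⟨s, x⟩, rfl⟩ := h.cover p
  rw [hR.smul_param, h.coord, h.coord, twistMap, twist_add, twistMap]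

theorem gramDet_smul (h : IsTwistedImmersion I ψ χ κ α r) (hR : IsRotation α) (τ : ℝ)
    (hτ : ContMDiff I I ∞ (fun p : M => Circle.exp τ • p)) (p : M) :
    gramDet I (ψ ∘ fun p => Circle.exp τ • p) p = gramDet I ψ p := by
  have h1 : MDifferentiableAt I 𝓘(ℝ, EuclideanSpace ℂ (Fin n)) ψ p :=
    (h.smooth p).mdifferentiableAt (by simp)
  have h2 : MDifferentiableAt I 𝓘(ℝ, EuclideanSpace ℂ (Fin n))
      (ψ ∘ fun p => Circle.exp τ • p) p :=
    ((h.smooth.comp hτ) p).mdifferentiableAt (by simp)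
  have h3 : affineCoord ∘ (ψ ∘ fun p => Circle.exp τ • p) = twist χ τ ∘ affineCoord ∘ ψ :=
    funext fun p => h.coord_smul hR τ p
  have h4 : MDifferentiableAt I 𝓘(ℝ, EuclideanSpace ℂ (Fin n)) (affineCoord ∘ ψ) p :=
    ((contMDiff_affineCoord.comp h.smooth) p).mdifferentiableAt (by simp)
  have h5 : ∀ u : TangentSpace I p, dmap I (ψ ∘ fun p => Circle.exp τ • p) p u = twist χ τ (dmap I ψ p u) := by
    intro u
    rw [dmap_eq h2, dmap_eq h1, h3]
    have h6 := mfderiv_comp p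
      (twist χ τ).differentiableAt.mdifferentiableAt h4
    rw [ContinuousLinearMap.mfderiv_eq] at h6
    rw [h6]
    rfl
  have h5' : ∀ k, dmap I (ψ ∘ fun p => Circle.exp τ • p) p (Module.finBasis ℝ E k) =
      twist χ τ (dmap I ψ p (Module.finBasis ℝ E k)) := fun k => h5 _
  simp only [gramDet, Function.comp_apply, h.coord_smul hR]
  congr 1
  ext i j
  simp only [gram, Matrix.of_apply]
  rw [← bergman_twist χ τ (affineCoord (ψ p)), ← h5' i, ← h5' j]

theorem hasDerivAt_comp_smul (h : IsTwistedImmersion I ψ χ κ α r) (hR : IsRotation α)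
    {f : M → ℝ} (hf : ContMDiff I 𝓘(ℝ, ℝ) ∞ f) (i : ι) (z : ℝ × V) :
    HasDerivAt (fun τ => f (Circle.exp τ • α i z)) (fderiv ℝ (f ∘ α i) z (1, 0)) 0 := by
  obtain ⟨s, x⟩ := z
  have h1 : HasFDerivAt (f ∘ α i) (fderiv ℝ (f ∘ α i) (s, x)) ((s, x) + (0 : ℝ) • ((1 : ℝ), (0 : V))) := by
    rw [zero_smul, add_zero]
    exact ((hf.comp (h.smooth_param i)).contDiff.contDiffAt.differentiableAt
      (by simp)).hasFDerivAt
  have h2 : HasDerivAt (fun τ : ℝ => (s, x) + τ • ((1 : ℝ), (0 : V))) ((1 : ℝ), (0 : V)) 0 := by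
    simpa using ((hasDerivAt_id (0 : ℝ)).smul_const ((1 : ℝ), (0 : V))).const_add (s, x)
  refine (h1.comp_hasDerivAt (0 : ℝ) h2).congr_of_eventuallyEq (Filter.Eventually.of_forall ?_)
  intro τ
  change f (Circle.exp τ • α i (s, x)) = f (α i ((s, x) + τ • ((1 : ℝ), (0 : V))))
  rw [hR.smul_param]
  congr 2
  ext <;> simp

open MeasureTheory

variable [MeasurableSpace E] [BorelSpace E] [MeasurableSpace M] [BorelSpace M]
    [I.Boundaryless] [IsManifold I ∞ M] [SecondCountableTopology M] [ContinuousSMul Circle M]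

theorem measurePreserving_smul (h : IsTwistedImmersion I ψ χ κ α r) (hR : IsRotation α)
    (hsm : ∀ c : Circle, ContMDiff I I ∞ (fun p : M => c • p)) (τ : ℝ) :
    MeasurePreserving (fun p : M => Circle.exp τ • p) (volMeasure I ψ) (volMeasure I ψ) := by
  refine ⟨(continuous_const_smul _).measurable, ?_⟩
  have h2 : volMeasure I (ψ ∘ fun p => Circle.exp τ • p) = volMeasure I ψ := by
    have h3 : ∀ p, densityRatio I ψ (ψ ∘ fun p => Circle.exp τ • p) p = 1 := fun p => by
      rw [densityRatio, h.gramDet_smul hR τ (hsm _),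
        div_self (Real.sqrt_pos.mpr (h.gramDet_pos p)).ne']
    rw [h.volMeasure_eq (h.smooth.comp (hsm _))]
    simp only [h3, ENNReal.ofReal_one]
    exact withDensity_one
  have h4 : (volMeasure I (ψ ∘ fun p => Circle.exp τ • p)).map (fun p : M => Circle.exp τ • p) =
      volMeasure I ψ := by
    rw [← map_volMeasure_comp_homeomorph h.smooth (Homeomorph.smul (Circle.exp τ)) (hsm _)]
    rfl
  rwa [h2] at h4

/-- The derivative of a function in the direction of the rotations has integral zero. -/
theorem setIntegral_deriv_smul (h : IsTwistedImmersion I ψ χ κ α r) [T2Space M]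
    (hR : IsRotation α) (hsm : ∀ c : Circle, ContMDiff I I ∞ (fun p : M => c • p))
    {f : M → ℝ} (hf : ContMDiff I 𝓘(ℝ, ℝ) ∞ f) {K : Set M} (hK : IsCompact K)
    (hfK : ∀ p ∉ K, deriv (fun τ => f (Circle.exp τ • p)) 0 = 0) :
    ∫ p in K, deriv (fun τ => f (Circle.exp τ • p)) 0 ∂(volMeasure I ψ) = 0 := by
  have := isLocallyFiniteMeasure_volMeasure h.smooth
  let C : Set M := (fun q : Circle × M => q.1 • q.2) '' (Set.univ ×ˢ K)
  have hC : IsCompact C := (isCompact_univ.prod hK).image continuous_smul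
  have hKC : K ⊆ C := fun p hp => ⟨(1, p), ⟨Set.mem_univ _, hp⟩, one_smul _ _⟩
  have hCinv : ∀ c : Circle, (fun p : M => c • p) ⁻¹' C = C := by
    intro c
    ext p
    constructor
    · rintro ⟨⟨d, q⟩, ⟨_, hq⟩, hdq⟩
      refine ⟨(c⁻¹ * d, q), ⟨Set.mem_univ _, hq⟩, ?_⟩
      change d • q = c • p at hdq
      change (c⁻¹ * d) • q = p
      rw [mul_smul, hdq, inv_smul_smul]
    · rintro ⟨⟨d, q⟩, ⟨_, hq⟩, rfl⟩
      exact ⟨(c * d, q), ⟨Set.mem_univ _, hq⟩, mul_smul _ _ _⟩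
  have hCm := hC.isClosed.measurableSet
  have h1 : ∫ p in K, deriv (fun τ => f (Circle.exp τ • p)) 0 ∂(volMeasure I ψ) =
      ∫ p in C, deriv (fun τ => f (Circle.exp τ • p)) 0 ∂(volMeasure I ψ) :=
    (setIntegral_eq_of_subset_of_forall_sdiff_eq_zero hCm hKC fun p hp => hfK p hp.2).symm
  have h2 : HasDerivAt (fun τ : ℝ => ∫ p in C, f (Circle.exp τ • p) ∂(volMeasure I ψ))
      (∫ p in C, deriv (fun τ => f (Circle.exp τ • p)) 0 ∂(volMeasure I ψ)) 0 := by
    refine hasDerivAt_setIntegral_of_param (F := fun τ p => f (Circle.exp τ • p)) _ h.isOpenMap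
      h.cover (fun i z => ?_) (Filter.Eventually.of_forall fun τ =>
        hf.continuous.comp (continuous_const_smul _)) hC hCm
    have h3 : ContDiff ℝ ∞ (f ∘ α i) := (hf.comp (h.smooth_param i)).contDiff
    have h4 : (fun q : ℝ × ℝ × V => f (Circle.exp q.1 • α i q.2)) =
        fun q : ℝ × ℝ × V => (f ∘ α i) (q.2.1 + q.1, q.2.2) := by
      funext q
      rw [← Prod.mk.eta (p := q.2), hR.smul_param]
      rfl
    rw [h4]
    refine ((h3.comp ?_).of_le (by simp)).contDiffAt
    fun_prop
  have h3 : (fun τ : ℝ => ∫ p in C, f (Circle.exp τ • p) ∂(volMeasure I ψ)) =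
      fun _ => ∫ p in C, f p ∂(volMeasure I ψ) := by
    funext τ
    have := (h.measurePreserving_smul hR hsm τ).setIntegral_preimage_emb
      (Homeomorph.smul (α := M) (Circle.exp τ)).measurableEmbedding f C
    rw [hCinv] at this
    exact this
  rw [h3] at h2
  rw [h1]
  exact h2.unique (hasDerivAt_const _ _)

theorem isHMinimal (h : IsTwistedImmersion I ψ χ κ α r) [T2Space M] (hR : IsRotation α)
    (hsm : ∀ c : Circle, ContMDiff I I ∞ (fun p : M => c • p)) : IsHMinimal I ψ where
  isLagrangianImmersion := h.isLagrangianImmersion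
  critical := by
    intro f X Ψ ε K hf _ hX hK hv hH
    have := isLocallyFiniteMeasure_volMeasure h.smooth
    have h0 : (0 : ℝ) ∈ Set.Ioo (-ε) ε := ⟨neg_lt_zero.mpr hv.pos, hv.pos⟩
    have hKm := hK.isClosed.measurableSet
    have hvol : (fun t => (vol I (Ψ t) K).toReal) =ᶠ[𝓝 0]
        fun t => ∫ p in K, densityRatio I ψ (Ψ t) p ∂(volMeasure I ψ) := by
      filter_upwards [isOpen_Ioo.mem_nhds h0] with t ht
      rw [vol_eq, h.volMeasure_eq (hv.contMDiff ht), withDensity_apply _ hKm,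
        integral_eq_lintegral_of_nonneg_ae]
      · exact Filter.Eventually.of_forall fun p =>
          div_nonneg (Real.sqrt_nonneg _) (Real.sqrt_nonneg _)
      · exact (h.continuous_densityRatio (hv.contMDiff ht)).aestronglyMeasurable
    refine HasDerivAt.congr_of_eventuallyEq ?_ hvol
    have hderiv : ∀ p, deriv (fun t => densityRatio I ψ (Ψ t) p) 0 =
        -((∑ k, χ k + (n + 1) * κ) / (κ * (1 + κ))) *
          deriv (fun τ => f (Circle.exp τ • p)) 0 := by
      intro p
      obtain ⟨i, z, rfl⟩ := h.cover p
      rw [(h.hasDerivAt_densityRatio hv hf hX hH i z).deriv, (h.hasDerivAt_comp_smul hR hf i z).deriv]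
    have hoff : ∀ p ∉ K, deriv (fun τ => f (Circle.exp τ • p)) 0 = 0 := by
      intro p hp
      have h1 : dmap 𝓘(ℝ, ℝ) (fun t => Ψ t p) 0 (1 : ℝ) = 0 := by
        have h2 : (fun t => Ψ t p) =ᶠ[𝓝 0] fun _ => ψ p := by
          filter_upwards [isOpen_Ioo.mem_nhds h0] with t ht using hv.eq_off t ht p hp
        exact congrArg (fun L => L (1 : ℝ)) ((h2.mfderiv_eq (I := 𝓘(ℝ, ℝ))
          (I' := 𝓘(ℝ, EuclideanSpace ℂ (Fin n)))).trans mfderiv_const)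
      have h3 : dmap I ψ p (X p) = 0 := by
        rw [hH, chJ, smul_eq_zero] at h1
        exact h1.resolve_left Complex.I_ne_zero
      obtain ⟨i, z, rfl⟩ := h.cover p
      rw [(h.hasDerivAt_comp_smul hR hf i z).deriv]
      have h4 := hX (α i z) (mfderiv 𝓘(ℝ, ℝ × V) I (α i) z (1, 0))
      rw [h3, chMetric_eq] at h4
      have h5 := mfderiv_comp z ((hf (α i z)).mdifferentiableAt (by simp))
        ((h.smooth_param i z).mdifferentiableAt (by simp))
      rw [mfderiv_eq_fderiv] at h5
      rw [h5]
      refine h4.symm.trans ?_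
      simp [bergman]
    have key := hasDerivAt_setIntegral_of_param (F := fun t p => densityRatio I ψ (Ψ t) p)
      (volMeasure I ψ) h.isOpenMap h.cover (h.contDiffAt_densityRatio hv)
      (by filter_upwards [isOpen_Ioo.mem_nhds h0] with t ht using
            h.continuous_densityRatio (hv.contMDiff ht)) hK hKm
    simp only [hderiv] at key
    rw [integral_const_mul, h.setIntegral_deriv_smul hR hsm hf hK hoff, mul_zero] at key
    exact key

end IsTwistedImmersion

end

/-! ### Smooth maps and quotients -/

section

variable {E H X G : Type*} [NormedAddCommGroup E] [NormedSpace ℝ E]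
  [TopologicalSpace H] {I : ModelWithCorners ℝ E H} [TopologicalSpace X] [ChartedSpace H X]
  [IsManifold I ∞ X] [Group G] [MulAction G X] [ProperlyDiscontinuousSMul G X]
  [ContinuousConstSMul G X] [IsCancelSMul G X] [T2Space X] [LocallyCompactSpace X]

theorem exists_section_of_quotient [IsManifold I ∞ (MulAction.orbitRel.Quotient G X)]
    (q : MulAction.orbitRel.Quotient G X) :
    ∃ σ : MulAction.orbitRel.Quotient G X → X, ContMDiffAt I I ∞ σ q ∧
      (∀ᶠ q' in 𝓝 q, Quotient.mk (MulAction.orbitRel G X) (σ q') = q') ∧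
      ContMDiffAt I I ∞ (Quotient.mk (MulAction.orbitRel G X)) (σ q) := by
  have hf : IsLocalHomeomorph (Quotient.mk (MulAction.orbitRel G X)) :=
    isQuotientCoveringMap_quotientMk_of_properlyDiscontinuousSMul.isCoveringMap.isLocalHomeomorph
  let g := (Quotient.mk_surjective (s := MulAction.orbitRel G X)).hasRightInverse.choose
  have hg : Quotient.mk (MulAction.orbitRel G X) (g q) = q :=
    (Quotient.mk_surjective (s := MulAction.orbitRel G X)).hasRightInverse.choose_spec q
  set σ := hf.localInverseAt (g q) with hσ
  have hc : chartAt H q = σ.trans (chartAt H (g q)) := rfl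
  have hqσ : q ∈ σ.source := by
    have := hf.apply_self_mem_localInverseAt_source (x := g q)
    rwa [hg] at this
  have hσq : σ q = g q := by
    have := hf.localInverseAt_apply_self (x := g q)
    rwa [hg] at this
  have h1 : ContMDiffAt I I ∞ (chartAt H q) q :=
    contMDiffAt_of_mem_maximalAtlas (IsManifold.chart_mem_maximalAtlas q) (mem_chart_source H q)
  have hcq : chartAt H q q = chartAt H (g q) (g q) := by
    rw [hc, OpenPartialHomeomorph.trans_apply, hσq]
  have h2 : ContMDiffAt I I ∞ (chartAt H (g q)).symm (chartAt H q q) := by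
    rw [hcq]
    exact (contMDiffOn_symm_of_mem_maximalAtlas
      (IsManifold.chart_mem_maximalAtlas (g q))).contMDiffAt
        ((chartAt H (g q)).open_target.mem_nhds (mem_chart_target H (g q)))
  refine ⟨σ, (h2.comp q h1).congr_of_eventuallyEq ?_, ?_, ?_⟩
  · filter_upwards [(chartAt H q).open_source.mem_nhds (mem_chart_source H q)] with q' hq'
    rw [hc, OpenPartialHomeomorph.trans_source] at hq'
    rw [Function.comp_apply, hc, OpenPartialHomeomorph.trans_apply]
    exact ((chartAt H (g q)).left_inv hq'.2).symm
  · filter_upwards [σ.open_source.mem_nhds hqσ] with q' hq'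
    exact hf.apply_localInverseAt_of_mem hq'
  · rw [hσq]
    have h3 : ContMDiffAt I I ∞ (chartAt H (g q)) (g q) :=
      contMDiffAt_of_mem_maximalAtlas (IsManifold.chart_mem_maximalAtlas (g q))
        (mem_chart_source H (g q))
    have h4 : ContMDiffAt I I ∞ (chartAt H q).symm (chartAt H (g q) (g q)) := by
      rw [← hcq]
      exact (contMDiffOn_symm_of_mem_maximalAtlas
        (IsManifold.chart_mem_maximalAtlas q)).contMDiffAt
          ((chartAt H q).open_target.mem_nhds (mem_chart_target H q))
    refine (h4.comp (g q) h3).congr_of_eventuallyEq ?_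
    filter_upwards [(chartAt H (g q)).open_source.mem_nhds (mem_chart_source H (g q))] with x hx
    rw [Function.comp_apply, hc, OpenPartialHomeomorph.coe_trans_symm, Function.comp_apply,
      (chartAt H (g q)).left_inv hx, hf.localInverseAt_symm]

/-- A map out of the quotient is smooth if its composition with the projection is. -/
theorem contMDiff_of_comp_quotient_mk [IsManifold I ∞ (MulAction.orbitRel.Quotient G X)]
    {E' H' N : Type*} [NormedAddCommGroup E'] [NormedSpace ℝ E'] [TopologicalSpace H']
    {J : ModelWithCorners ℝ E' H'} [TopologicalSpace N] [ChartedSpace H' N]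
    {F : MulAction.orbitRel.Quotient G X → N}
    (hF : ContMDiff I J ∞ (F ∘ Quotient.mk (MulAction.orbitRel G X))) : ContMDiff I J ∞ F := by
  intro q
  obtain ⟨σ, hσ, hσ', -⟩ := exists_section_of_quotient (I := I) q
  refine ((hF (σ q)).comp q hσ).congr_of_eventuallyEq ?_
  filter_upwards [hσ'] with q' hq'
  simp only [Function.comp_apply, hq']

theorem contMDiff_quotient_mk [IsManifold I ∞ (MulAction.orbitRel.Quotient G X)]
    (hG : ∀ g : G, ContMDiff I I ∞ fun x : X => g • x) :
    ContMDiff I I ∞ (Quotient.mk (MulAction.orbitRel G X)) := by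
  intro x
  obtain ⟨σ, -, hσ', hσ⟩ := exists_section_of_quotient (I := I)
    (Quotient.mk (MulAction.orbitRel G X) x)
  obtain ⟨g, hg⟩ : ∃ g : G, g • x = σ (Quotient.mk _ x) := Quotient.exact hσ'.self_of_nhds
  have h1 : ContMDiffAt I I ∞ (Quotient.mk (MulAction.orbitRel G X) ∘ fun x => g • x) x :=
    ContMDiffAt.comp x (by rw [hg]; exact hσ) (hG g x)
  refine h1.congr_of_eventuallyEq (Filter.Eventually.of_forall fun y => ?_)
  exact (Quotient.sound (s := MulAction.orbitRel G X) ⟨g, rfl⟩).symm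

end

/-! ### The rotations of the quotient -/

section

variable {n₁ n₂ : ℕ}

instance : T2Space (Quot3 n₁ n₂) := t2Space_of_properlyDiscontinuousSMul_of_t2Space

instance : SecondCountableTopology (Quot3 n₁ n₂) := ContinuousConstSMul.secondCountableTopology

theorem contMDiff_smul_prod3 (u : ℤˣ) :
    ContMDiff (model3 n₁ n₂) (model3 n₁ n₂) ∞ fun p : Prod3 n₁ n₂ => u • p := by
  rcases Int.units_eq_one_or u with rfl | rfl
  · simpa only [one_smul] using! contMDiff_id
  · simpa only [neg_one_smul_eq] using contMDiff_invol

theorem contMDiff_proj3 :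
    ContMDiff (model3 n₁ n₂) (model3 n₁ n₂) ∞ (proj3 (n₁ := n₁) (n₂ := n₂)) :=
  contMDiff_quotient_mk contMDiff_smul_prod3

theorem isOpenMap_proj3 : IsOpenMap (proj3 (n₁ := n₁) (n₂ := n₂)) :=
  isOpenMap_quotient_mk'_mul

theorem proj3_surjective : Function.Surjective (proj3 (n₁ := n₁) (n₂ := n₂)) :=
  Quotient.mk_surjective

theorem proj3_invol (p : Prod3 n₁ n₂) : proj3 (invol p) = proj3 p :=
  Quotient.sound (s := MulAction.orbitRel ℤˣ (Prod3 n₁ n₂)) ⟨-1, neg_one_smul_eq p⟩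

theorem proj3_eq_iff {p q : Prod3 n₁ n₂} : proj3 p = proj3 q ↔ p = q ∨ p = invol q := by
  constructor
  · intro h
    obtain ⟨u, hu⟩ : ∃ u : ℤˣ, u • q = p := Quotient.exact h
    rcases Int.units_eq_one_or u with rfl | rfl
    · exact Or.inl (by rw [← hu, one_smul])
    · exact Or.inr (by rw [← hu, neg_one_smul_eq])
  · rintro (rfl | rfl)
    · rfl
    · exact proj3_invol q

/-- The circle acts on the quotient by rotations of the first factor. -/
instance : MulAction Circle (Quot3 n₁ n₂) where
  smul c := Quotient.map' (fun p => (c * p.1, p.2)) (by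
    rintro _ p ⟨u, rfl⟩
    refine ⟨u, ?_⟩
    rcases Int.units_eq_one_or u with rfl | rfl
    · simp
    · simp [neg_one_smul_eq, invol])
  one_smul q := by
    induction q using Quotient.inductionOn with
    | h p => exact congrArg proj3 (Prod.ext (one_mul _) rfl)
  mul_smul c d q := by
    induction q using Quotient.inductionOn with
    | h p => exact congrArg proj3 (Prod.ext (mul_assoc _ _ _) rfl)

theorem smul_proj3 (c : Circle) (p : Prod3 n₁ n₂) :
    c • proj3 p = proj3 (c * p.1, p.2) := rfl

theorem contMDiff_smul_quot3 (c : Circle) :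
    ContMDiff (model3 n₁ n₂) (model3 n₁ n₂) ∞ fun q : Quot3 n₁ n₂ => c • q := by
  refine contMDiff_of_comp_quotient_mk ?_
  have h1 : ContMDiff (𝓡 1) (𝓡 1) ∞ (fun d : Circle => c * d) := contMDiff_mul_left.of_le le_top
  exact contMDiff_proj3.comp (h1.prodMap contMDiff_id)

instance : ContinuousSMul Circle (Quot3 n₁ n₂) where
  continuous_smul := by
    have h1 : IsOpenQuotientMap (Prod.map (id : Circle → Circle) (proj3 (n₁ := n₁) (n₂ := n₂))) :=
      IsOpenQuotientMap.id.prodMap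
        ⟨proj3_surjective, contMDiff_proj3.continuous, isOpenMap_proj3⟩
    rw [h1.isQuotientMap.continuous_iff]
    have h2 : Continuous fun q : Circle × Prod3 n₁ n₂ => ((q.1 * q.2.1, q.2.2) : Prod3 n₁ n₂) := by
      fun_prop
    exact contMDiff_proj3.continuous.comp h2

end

/-! ### Parametrizations of the sphere -/

section

variable {n : ℕ}

/-- The inverse of the stereographic projection from `a`. -/
def sphereParam (a : Metric.sphere (0 : EuclideanSpace ℝ (Fin (n + 1))) 1)
    (v : EuclideanSpace ℝ (Fin n)) : Metric.sphere (0 : EuclideanSpace ℝ (Fin (n + 1))) 1 :=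
  have := Fact.mk (@finrank_euclideanSpace_fin ℝ _ (n + 1))
  (stereographic' n a).symm v

theorem contMDiff_sphereParam (a : Metric.sphere (0 : EuclideanSpace ℝ (Fin (n + 1))) 1) :
    ContMDiff (𝓡 n) (𝓡 n) ∞ (sphereParam a) := by
  have := Fact.mk (@finrank_euclideanSpace_fin ℝ _ (n + 1))
  have h1 : stereographic' n a ∈ IsManifold.maximalAtlas (𝓡 n) ∞
      (Metric.sphere (0 : EuclideanSpace ℝ (Fin (n + 1))) 1) :=
    IsManifold.subset_maximalAtlas ⟨a, rfl⟩
  have h2 := contMDiffOn_symm_of_mem_maximalAtlas h1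
  rw [stereographic'_target] at h2
  exact contMDiffOn_univ.mp h2

theorem isOpenMap_sphereParam (a : Metric.sphere (0 : EuclideanSpace ℝ (Fin (n + 1))) 1) :
    IsOpenMap (sphereParam a) := by
  have := Fact.mk (@finrank_euclideanSpace_fin ℝ _ (n + 1))
  exact ((stereographic' n a).symm.isOpenEmbedding (by simp)).isOpenMap

theorem exists_sphereParam_eq (x : Metric.sphere (0 : EuclideanSpace ℝ (Fin (n + 1))) 1) :
    ∃ v, sphereParam (-x) v = x := by
  have := Fact.mk (@finrank_euclideanSpace_fin ℝ _ (n + 1))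
  exact ⟨stereographic' n (-x) x, (stereographic' n (-x)).left_inv
    (by simpa using ne_neg_of_mem_unit_sphere ℝ x)⟩

theorem contDiff_coe_sphereParam (a : Metric.sphere (0 : EuclideanSpace ℝ (Fin (n + 1))) 1) :
    ContDiff ℝ ∞ fun v => (sphereParam a v : EuclideanSpace ℝ (Fin (n + 1))) := by
  have := Fact.mk (@finrank_euclideanSpace_fin ℝ _ (n + 1))
  exact (contMDiff_coe_sphere.comp (contMDiff_sphereParam a)).contDiff

theorem exists_leftInverse_sphereParam
    (a : Metric.sphere (0 : EuclideanSpace ℝ (Fin (n + 1))) 1) :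
    ∃ g : EuclideanSpace ℝ (Fin (n + 1)) → EuclideanSpace ℝ (Fin n),
      ∀ v, g (sphereParam a v) = v ∧ DifferentiableAt ℝ g (sphereParam a v) := by
  have := Fact.mk (@finrank_euclideanSpace_fin ℝ _ (n + 1))
  let U := (OrthonormalBasis.fromOrthogonalSpanSingleton (𝕜 := ℝ) n
    (ne_zero_of_mem_unit_sphere a)).repr
  refine ⟨fun x => U (stereoToFun (a : EuclideanSpace ℝ (Fin (n + 1))) x), fun v => ⟨?_, ?_⟩⟩
  · have h := (stereographic' n a).right_inv (x := v) (by simp)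
    exact h
  · have hne : innerSL ℝ (a : EuclideanSpace ℝ (Fin (n + 1)))
        (sphereParam a v : EuclideanSpace ℝ (Fin (n + 1))) ≠ 1 := by
      intro h
      have h1 : sphereParam a v ∈ (stereographic' n a).source :=
        (stereographic' n a).map_target (by simp)
      rw [stereographic'_source] at h1
      exact h1 ((sphere_ext_iff a (sphereParam a v)).mpr h).symm
    have hopen : IsOpen {x : EuclideanSpace ℝ (Fin (n + 1)) |
        innerSL ℝ (a : EuclideanSpace ℝ (Fin (n + 1))) x ≠ (1 : ℝ)} :=
      isOpen_ne_fun (innerSL ℝ (a : EuclideanSpace ℝ (Fin (n + 1)))).continuous continuous_const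
    have h2 : ContDiffAt ℝ 1 (stereoToFun (a : EuclideanSpace ℝ (Fin (n + 1))))
        (sphereParam a v) := contDiffOn_stereoToFun.contDiffAt (hopen.mem_nhds hne)
    exact U.toContinuousLinearEquiv.differentiableAt.comp _ (h2.differentiableAt (by simp))

end

theorem fderiv_injective_of_leftInverse {E F : Type*} [NormedAddCommGroup E] [NormedSpace ℝ E]
    [NormedAddCommGroup F] [NormedSpace ℝ F] {f : E → F} {g : F → E} {x : E}
    (hf : DifferentiableAt ℝ f x) (hg : DifferentiableAt ℝ g (f x))
    (h : Function.LeftInverse g f) : Function.Injective (fderiv ℝ f x) := by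
  have h1 := fderiv_comp x hg hf
  rw [h.comp_eq_id, fderiv_id] at h1
  intro u v huv
  have h2 : ∀ u, fderiv ℝ g (f x) (fderiv ℝ f x u) = u := fun u =>
    (congrArg (fun L => L u) h1).symm
  rw [← h2 u, huv, h2]

/-! ### The real profile of the immersion -/

section

variable {n₁ n₂ : ℕ}

/-- The inclusion of the first block of coordinates of `ℝ^n`, where `n = n₁ + n₂ + 1`. -/
def inlIdx (i : Fin (n₁ + 1)) : Fin (n₁ + n₂ + 1) :=
  Fin.cast (by omega : n₁ + 1 + n₂ = n₁ + n₂ + 1) (Fin.castAdd n₂ i)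

/-- The inclusion of the second block of coordinates of `ℝ^n`, where `n = n₁ + n₂ + 1`. -/
def inrIdx (j : Fin n₂) : Fin (n₁ + n₂ + 1) :=
  Fin.cast (by omega : n₁ + 1 + n₂ = n₁ + n₂ + 1) (Fin.natAdd (n₁ + 1) j)

theorem idx_cases (k : Fin (n₁ + n₂ + 1)) :
    (∃ i : Fin (n₁ + 1), k = inlIdx i) ∨ ∃ j : Fin n₂, k = inrIdx (n₁ := n₁) j := by
  obtain ⟨k', rfl⟩ : ∃ k', k = Fin.cast (by omega : n₁ + 1 + n₂ = n₁ + n₂ + 1) k' :=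
    ⟨Fin.cast (by omega) k, by simp⟩
  refine Fin.addCases (fun i => Or.inl ⟨i, rfl⟩) (fun j => Or.inr ⟨j, rfl⟩) k'

theorem sum_idx {A : Type*} [AddCommMonoid A] (F : Fin (n₁ + n₂ + 1) → A) :
    ∑ k, F k = ∑ i : Fin (n₁ + 1), F (inlIdx i) + ∑ j : Fin n₂, F (inrIdx j) := by
  rw [← (finCongr (by omega : n₁ + 1 + n₂ = n₁ + n₂ + 1)).sum_comp, Fin.sum_univ_add]
  rfl

/-- The indicator function of the first block of coordinates. -/
def firstBlock (n₁ n₂ : ℕ) (k : Fin (n₁ + n₂ + 1)) : ℝ := if k.1 < n₁ + 1 then 1 else 0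

@[simp]
theorem firstBlock_inl (i : Fin (n₁ + 1)) : firstBlock n₁ n₂ (inlIdx i) = 1 :=
  if_pos i.2

@[simp]
theorem firstBlock_inr (j : Fin n₂) : firstBlock n₁ n₂ (inrIdx j) = 0 :=
  if_neg (by simp [inrIdx]; omega)

/-- The vector of `ℝ^n` with the given blocks of coordinates. -/
def glue (p : EuclideanSpace ℝ (Fin (n₁ + 1))) (q : EuclideanSpace ℝ (Fin n₂)) :
    EuclideanSpace ℝ (Fin (n₁ + n₂ + 1)) :=
  WithLp.toLp 2 fun k =>
    Fin.append p q (Fin.cast (by omega : n₁ + n₂ + 1 = n₁ + 1 + n₂) k)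

@[simp]
theorem glue_inl (p : EuclideanSpace ℝ (Fin (n₁ + 1))) (q : EuclideanSpace ℝ (Fin n₂))
    (i : Fin (n₁ + 1)) : glue p q (inlIdx i) = p i := by
  simp [glue, inlIdx]

@[simp]
theorem glue_inr (p : EuclideanSpace ℝ (Fin (n₁ + 1))) (q : EuclideanSpace ℝ (Fin n₂))
    (j : Fin n₂) : glue p q (inrIdx j) = q j := by
  simp [glue, inrIdx]

theorem norm_sq_glue (p : EuclideanSpace ℝ (Fin (n₁ + 1))) (q : EuclideanSpace ℝ (Fin n₂)) :
    ‖glue p q‖ ^ 2 = ‖p‖ ^ 2 + ‖q‖ ^ 2 := by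
  simp only [EuclideanSpace.real_norm_sq_eq, sum_idx, glue_inl, glue_inr]

/-- The inverse of the last coordinate of the point of real hyperbolic space over `u`. -/
def invLast (u : EuclideanSpace ℝ (Fin n₂)) : ℝ := (√(1 + ‖u‖ ^ 2))⁻¹

theorem invLast_pos (u : EuclideanSpace ℝ (Fin n₂)) : 0 < invLast u :=
  inv_pos.mpr (Real.sqrt_pos.mpr (by positivity))

theorem invLast_sq (u : EuclideanSpace ℝ (Fin n₂)) : invLast u ^ 2 * (1 + ‖u‖ ^ 2) = 1 := by
  rw [invLast, inv_pow, Real.sq_sqrt (by positivity)]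
  exact inv_mul_cancel₀ (by positivity)

theorem contDiff_invLast : ContDiff ℝ ∞ (invLast (n₂ := n₂)) := by
  have h1 : ContDiff ℝ ∞ fun u : EuclideanSpace ℝ (Fin n₂) => 1 + ‖u‖ ^ 2 :=
    contDiff_const.add (contDiff_norm_sq ℝ)
  exact (h1.sqrt fun u => by positivity).inv fun u =>
    (Real.sqrt_pos.mpr (by positivity : 0 < 1 + ‖u‖ ^ 2)).ne'

/-- The real affine coordinates of the immersion. -/
def realCoord (T : ℝ) (x : EuclideanSpace ℝ (Fin (n₁ + 1))) (u : EuclideanSpace ℝ (Fin n₂)) :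
    EuclideanSpace ℝ (Fin (n₁ + n₂ + 1)) :=
  glue ((T * invLast u) • x) (invLast u • u)

theorem contDiff_realCoord (T : ℝ) : ContDiff ℝ ∞
    fun z : EuclideanSpace ℝ (Fin (n₁ + 1)) × EuclideanSpace ℝ (Fin n₂) =>
      realCoord T z.1 z.2 := by
  have hz : ContDiff ℝ ∞ fun z : EuclideanSpace ℝ (Fin (n₁ + 1)) × EuclideanSpace ℝ (Fin n₂) =>
      invLast z.2 := contDiff_invLast.comp contDiff_snd
  rw [contDiff_euclidean]
  intro k
  rcases idx_cases k with ⟨i, rfl⟩ | ⟨j, rfl⟩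
  · simp only [realCoord, glue_inl]
    exact contDiff_euclidean.mp ((contDiff_const.mul hz).smul contDiff_fst) i
  · simp only [realCoord, glue_inr]
    exact contDiff_euclidean.mp (hz.smul contDiff_snd) j

theorem norm_sq_realCoord (T : ℝ) {x : EuclideanSpace ℝ (Fin (n₁ + 1))} (hx : ‖x‖ = 1)
    (u : EuclideanSpace ℝ (Fin n₂)) :
    ‖realCoord T x u‖ ^ 2 = 1 - (1 - T ^ 2) * invLast u ^ 2 := by
  rw [realCoord, norm_sq_glue, norm_smul, norm_smul, hx, mul_pow, mul_pow, Real.norm_eq_abs,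
    Real.norm_eq_abs, sq_abs, sq_abs]
  linear_combination invLast_sq u

theorem sum_realCoord (T : ℝ) {x : EuclideanSpace ℝ (Fin (n₁ + 1))} (hx : ‖x‖ = 1)
    (u : EuclideanSpace ℝ (Fin n₂)) :
    ∑ k, firstBlock n₁ n₂ k * realCoord T x u k ^ 2 = T ^ 2 * invLast u ^ 2 := by
  have h := EuclideanSpace.real_norm_sq_eq x
  rw [hx] at h
  rw [sum_idx]
  simp only [firstBlock_inl, firstBlock_inr, realCoord, glue_inl, PiLp.smul_apply, smul_eq_mul,
    one_mul, zero_mul, Finset.sum_const_zero, add_zero, mul_pow, ← Finset.mul_sum, ← h]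
  ring

theorem tanh_sq_lt_one (ρ : ℝ) : Real.tanh ρ ^ 2 < 1 := by
  rw [Real.tanh_eq_sinh_div_cosh, div_pow, div_lt_one (by positivity [Real.cosh_pos ρ]),
    Real.cosh_sq]
  linarith

theorem norm_realCoord_lt (ρ : ℝ) {x : EuclideanSpace ℝ (Fin (n₁ + 1))} (hx : ‖x‖ = 1)
    (u : EuclideanSpace ℝ (Fin n₂)) : ‖realCoord (Real.tanh ρ) x u‖ < 1 := by
  have h1 := norm_sq_realCoord (Real.tanh ρ) hx u
  have h2 : 0 < (1 - Real.tanh ρ ^ 2) * invLast u ^ 2 :=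
    mul_pos (sub_pos.mpr (tanh_sq_lt_one ρ)) (pow_pos (invLast_pos u) 2)
  nlinarith [norm_nonneg (realCoord (Real.tanh ρ) x u)]

/-- The real affine coordinates of the immersion in a parametrization. -/
def profile (ρ : ℝ) (a : Metric.sphere (0 : EuclideanSpace ℝ (Fin (n₁ + 1))) 1)
    (z : EuclideanSpace ℝ (Fin n₁) × EuclideanSpace ℝ (Fin n₂)) :
    EuclideanSpace ℝ (Fin (n₁ + n₂ + 1)) :=
  realCoord (Real.tanh ρ) (sphereParam a z.1) z.2

theorem contDiff_profile (ρ : ℝ) (a : Metric.sphere (0 : EuclideanSpace ℝ (Fin (n₁ + 1))) 1) :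
    ContDiff ℝ ∞ (profile (n₂ := n₂) ρ a) := by
  have h1 := (contDiff_coe_sphereParam a).comp
    (contDiff_fst (E := EuclideanSpace ℝ (Fin n₁)) (F := EuclideanSpace ℝ (Fin n₂)))
  have h2 := (contDiff_realCoord (n₁ := n₁) (n₂ := n₂) (Real.tanh ρ)).comp
    (h1.prodMk contDiff_snd)
  exact h2

theorem fderiv_profile_injective {ρ : ℝ} (hρ : 0 < ρ)
    (a : Metric.sphere (0 : EuclideanSpace ℝ (Fin (n₁ + 1))) 1)
    (z : EuclideanSpace ℝ (Fin n₁) × EuclideanSpace ℝ (Fin n₂)) :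
    Function.Injective (fderiv ℝ (profile ρ a) z) := by
  obtain ⟨g, hg⟩ := exists_leftInverse_sphereParam a
  have hT : Real.tanh ρ ≠ 0 := by
    rw [Real.tanh_eq_sinh_div_cosh]
    exact (div_pos (Real.sinh_pos_iff.mpr hρ) (Real.cosh_pos ρ)).ne'
  let P : EuclideanSpace ℝ (Fin (n₁ + n₂ + 1)) → EuclideanSpace ℝ (Fin (n₁ + 1)) :=
    fun w => WithLp.toLp 2 fun i => w (inlIdx i)
  let Q : EuclideanSpace ℝ (Fin (n₁ + n₂ + 1)) → EuclideanSpace ℝ (Fin n₂) :=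
    fun w => WithLp.toLp 2 fun j => w (inrIdx j)
  have hP : Differentiable ℝ P := by
    rw [differentiable_euclidean]
    exact fun i => (PiLp.proj (𝕜 := ℝ) 2 (fun _ : Fin (n₁ + n₂ + 1) => ℝ) (inlIdx i)).differentiable
  have hQ : Differentiable ℝ Q := by
    rw [differentiable_euclidean]
    exact fun j => (PiLp.proj (𝕜 := ℝ) 2 (fun _ : Fin (n₁ + n₂ + 1) => ℝ) (inrIdx j)).differentiable
  let Z : EuclideanSpace ℝ (Fin (n₁ + n₂ + 1)) → ℝ := fun w => √(1 - ‖Q w‖ ^ 2)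
  let L : EuclideanSpace ℝ (Fin (n₁ + n₂ + 1)) →
      EuclideanSpace ℝ (Fin n₁) × EuclideanSpace ℝ (Fin n₂) := fun w =>
    (g ((Real.tanh ρ * Z w)⁻¹ • P w), (Z w)⁻¹ • Q w)
  have hPr : ∀ z, P (profile ρ a z) = (Real.tanh ρ * invLast z.2) •
      (sphereParam a z.1 : EuclideanSpace ℝ (Fin (n₁ + 1))) := fun z => by
    ext i
    simp [P, profile, realCoord]
  have hQr : ∀ z : EuclideanSpace ℝ (Fin n₁) × EuclideanSpace ℝ (Fin n₂),
      Q (profile ρ a z) = invLast z.2 • z.2 := fun z => by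
    ext i
    simp [Q, profile, realCoord]
  have hQn : ∀ z : EuclideanSpace ℝ (Fin n₁) × EuclideanSpace ℝ (Fin n₂),
      1 - ‖Q (profile ρ a z)‖ ^ 2 = invLast z.2 ^ 2 := fun z => by
    rw [hQr, norm_smul, Real.norm_eq_abs, mul_pow, sq_abs]
    linear_combination -invLast_sq z.2
  have hZr : ∀ z, Z (profile ρ a z) = invLast z.2 := fun z => by
    simp only [Z, hQn]
    exact Real.sqrt_sq (invLast_pos _).le
  have hZd : DifferentiableAt ℝ Z (profile ρ a z) := by
    refine DifferentiableAt.sqrt ?_ ?_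
    · exact (differentiableAt_const _).sub ((hQ _).norm_sq ℝ)
    · rw [hQn]
      exact (pow_pos (invLast_pos _) 2).ne'
  have hPz : ∀ z, (Real.tanh ρ * Z (profile ρ a z))⁻¹ • P (profile ρ a z) =
      (sphereParam a z.1 : EuclideanSpace ℝ (Fin (n₁ + 1))) := fun z => by
    rw [hZr, hPr, smul_smul, inv_mul_cancel₀ (mul_ne_zero hT (invLast_pos _).ne'), one_smul]
  refine fderiv_injective_of_leftInverse (g := L)
    ((contDiff_profile ρ a).contDiffAt.differentiableAt (by simp)) ?_ ?_
  · have hZ0 : Z (profile ρ a z) ≠ 0 := by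
      rw [hZr]
      exact (invLast_pos _).ne'
    refine DifferentiableAt.prodMk ?_ ((hZd.inv hZ0).smul (hQ _))
    refine DifferentiableAt.comp (g := g) (f := fun w => (Real.tanh ρ * Z w)⁻¹ • P w) _ ?_ ?_
    · rw [hPz]
      exact (hg z.1).2
    · exact (((differentiableAt_const _).mul hZd).inv (mul_ne_zero hT hZ0)).smul (hP _)
  · intro z
    refine Prod.ext ?_ ?_
    · simp only [L, hPz]
      exact (hg z.1).1
    · simp only [L, hZr, hQr, smul_smul, inv_mul_cancel₀ (invLast_pos _).ne', one_smul]

theorem isTwistProfile_profile {ρ : ℝ} (hρ : 0 < ρ)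
    (a : Metric.sphere (0 : EuclideanSpace ℝ (Fin (n₁ + 1))) 1) :
    IsTwistProfile (firstBlock n₁ n₂) (Real.sinh ρ ^ 2) (profile ρ a) where
  chi_sq k := by
    rcases idx_cases k with ⟨i, rfl⟩ | ⟨j, rfl⟩ <;> simp
  kappa_pos := pow_pos (Real.sinh_pos_iff.mpr hρ) 2
  smooth := contDiff_profile ρ a
  norm_lt z := norm_realCoord_lt ρ (mem_sphere_zero_iff_norm.mp (sphereParam a z.1).2) z.2
  sum_eq z := by
    have hx := mem_sphere_zero_iff_norm.mp (sphereParam a z.1).2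
    rw [profile, sum_realCoord _ hx, norm_sq_realCoord _ hx]
    have h1 : Real.tanh ρ ^ 2 * Real.cosh ρ ^ 2 = Real.sinh ρ ^ 2 := by
      rw [Real.tanh_eq_sinh_div_cosh, div_pow, div_mul_cancel₀ _
        (pow_pos (Real.cosh_pos ρ) 2).ne']
    rw [Real.cosh_sq] at h1
    linear_combination (invLast z.2 ^ 2) * h1
  injective := fderiv_profile_injective hρ a

end

/-! ### The immersion of the quotient -/

section

variable {n₁ n₂ : ℕ}

theorem contMDiff_rhHomeo : ContMDiff (𝓡 n₂) (𝓡 n₂) ∞ (rhHomeo n₂) := fun y =>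
  contMDiffAt_of_mem_maximalAtlas (IsManifold.chart_mem_maximalAtlas y) (mem_chart_source _ y)

theorem contMDiff_rhHomeo_symm : ContMDiff (𝓡 n₂) (𝓡 n₂) ∞ (rhHomeo n₂).symm :=
  contMDiffOn_univ.mp (contMDiffOn_symm_of_mem_maximalAtlas
    (e := (rhHomeo n₂).toOpenPartialHomeomorph)
    (IsManifold.chart_mem_maximalAtlas ((rhHomeo n₂).symm 0)))

theorem invLast_rhHomeo (y : RH n₂) : invLast (rhHomeo n₂ y) * y.1 (Fin.last n₂) = 1 := by
  have h1 : 1 + ‖rhHomeo n₂ y‖ ^ 2 = y.1 (Fin.last n₂) ^ 2 := by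
    have h2 := y.2.1
    have h3 : ‖rhHomeo n₂ y‖ ^ 2 = ∑ i : Fin n₂, y.1 i.castSucc ^ 2 :=
      EuclideanSpace.real_norm_sq_eq _
    linarith
  rw [invLast, h1, Real.sqrt_sq y.2.2.le, inv_mul_cancel₀ y.2.2.ne']

theorem contMDiff_coe_circle : ContMDiff (𝓡 1) 𝓘(ℝ, ℂ) ∞ (fun c : Circle => (c : ℂ)) :=
  have := finrank_real_complex_fact'
  contMDiff_coe_sphere (E := ℂ)

/-- The affine coordinates of the immersion. -/
def complexCoord (T : ℝ) (c : ℂ) (x : EuclideanSpace ℝ (Fin (n₁ + 1)))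
    (u : EuclideanSpace ℝ (Fin n₂)) : EuclideanSpace ℂ (Fin (n₁ + n₂ + 1)) :=
  WithLp.toLp 2 fun k => (if k.1 < n₁ + 1 then c else 1) * (realCoord T x u k : ℂ)

theorem complexCoord_apply (T : ℝ) (c : ℂ) (x : EuclideanSpace ℝ (Fin (n₁ + 1)))
    (u : EuclideanSpace ℝ (Fin n₂)) (k : Fin (n₁ + n₂ + 1)) :
    complexCoord T c x u k = (if k.1 < n₁ + 1 then c else 1) * (realCoord T x u k : ℂ) := rfl

theorem complexCoord_inl (T : ℝ) (c : ℂ) (x : EuclideanSpace ℝ (Fin (n₁ + 1)))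
    (u : EuclideanSpace ℝ (Fin n₂)) (i : Fin (n₁ + 1)) :
    complexCoord T c x u (inlIdx i) = c * ((T * invLast u * x i : ℝ) : ℂ) := by
  rw [complexCoord_apply, if_pos (show (inlIdx (n₂ := n₂) i).1 < n₁ + 1 from i.2)]
  simp [realCoord]

theorem complexCoord_inr (T : ℝ) (c : ℂ) (x : EuclideanSpace ℝ (Fin (n₁ + 1)))
    (u : EuclideanSpace ℝ (Fin n₂)) (j : Fin n₂) :
    complexCoord T c x u (inrIdx j) = ((invLast u * u j : ℝ) : ℂ) := by
  rw [complexCoord_apply, if_neg (by simp [inrIdx]; omega)]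
  simp [realCoord]

theorem complexCoord_exp (T s : ℝ) (x : EuclideanSpace ℝ (Fin (n₁ + 1)))
    (u : EuclideanSpace ℝ (Fin n₂)) :
    complexCoord T (Circle.exp s) x u = twist (firstBlock n₁ n₂) s (realVec (realCoord T x u)) := by
  ext k
  rw [complexCoord_apply, twist_apply, realVec_apply, firstBlock, Circle.coe_exp]
  split_ifs <;> simp

theorem norm_complexCoord (T : ℝ) (c : Circle) (x : EuclideanSpace ℝ (Fin (n₁ + 1)))
    (u : EuclideanSpace ℝ (Fin n₂)) : ‖complexCoord T c x u‖ = ‖realCoord T x u‖ := by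
  rw [← Circle.exp_arg c, complexCoord_exp, norm_twist, norm_realVec]

theorem complexCoord_neg (T : ℝ) (c : ℂ) (x : EuclideanSpace ℝ (Fin (n₁ + 1)))
    (u : EuclideanSpace ℝ (Fin n₂)) : complexCoord T (-c) (-x) u = complexCoord T c x u := by
  ext k
  rcases idx_cases k with ⟨i, rfl⟩ | ⟨j, rfl⟩
  · simp [complexCoord_inl]
  · simp [complexCoord_inr]

theorem contDiff_complexCoord (T : ℝ) : ContDiff ℝ ∞
    fun z : ℂ × EuclideanSpace ℝ (Fin (n₁ + 1)) × EuclideanSpace ℝ (Fin n₂) =>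
      complexCoord T z.1 z.2.1 z.2.2 := by
  rw [contDiff_piLp]
  intro k
  have h1 : ContDiff ℝ ∞
      fun z : ℂ × EuclideanSpace ℝ (Fin (n₁ + 1)) × EuclideanSpace ℝ (Fin n₂) =>
        ((realCoord T z.2.1 z.2.2 k : ℝ) : ℂ) :=
    Complex.ofRealCLM.contDiff.comp
      ((contDiff_euclidean.mp (contDiff_realCoord T) k).comp contDiff_snd)
  simp only [complexCoord_apply]
  split_ifs
  · exact contDiff_fst.mul h1
  · exact contDiff_const.mul h1

/-- The immersion of the quotient. -/
def immersion (ρ : ℝ) : Quot3 n₁ n₂ → CH (n₁ + n₂ + 1) :=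
  Quotient.lift (fun p : Prod3 n₁ n₂ =>
    ofBall (complexCoord (Real.tanh ρ) p.1 p.2.1.1 (rhHomeo n₂ p.2.2))) (by
      rintro _ p ⟨u, rfl⟩
      rcases Int.units_eq_one_or u with rfl | rfl
      · simp
      · simp only [neg_one_smul_eq, invol]
        congr 1
        exact complexCoord_neg _ _ _ _)

theorem norm_complexCoord_lt (ρ : ℝ) (p : Prod3 n₁ n₂) :
    ‖complexCoord (Real.tanh ρ) p.1 p.2.1.1 (rhHomeo n₂ p.2.2)‖ < 1 := by
  rw [norm_complexCoord]
  exact norm_realCoord_lt ρ (mem_sphere_zero_iff_norm.mp p.2.1.2) _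

theorem affineCoord_immersion (ρ : ℝ) (p : Prod3 n₁ n₂) :
    affineCoord (immersion ρ (proj3 p)) =
      complexCoord (Real.tanh ρ) p.1 p.2.1.1 (rhHomeo n₂ p.2.2) :=
  (ballChart (n₁ + n₂ + 1)).right_inv (mem_ball_zero_iff.mpr (norm_complexCoord_lt ρ p))

theorem contMDiff_immersion (ρ : ℝ) : ContMDiff (model3 n₁ n₂)
    𝓘(ℝ, EuclideanSpace ℂ (Fin (n₁ + n₂ + 1))) ∞ (immersion (n₁ := n₁) (n₂ := n₂) ρ) := by
  have := Fact.mk (@finrank_euclideanSpace_fin ℝ _ (n₁ + 1))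
  have h1 : ContMDiff (model3 n₁ n₂) 𝓘(ℝ, ℂ) ∞ fun p : Prod3 n₁ n₂ => (p.1 : ℂ) :=
    contMDiff_coe_circle.comp contMDiff_fst
  have h2 : ContMDiff (model3 n₁ n₂) 𝓘(ℝ, EuclideanSpace ℝ (Fin (n₁ + 1))) ∞
      fun p : Prod3 n₁ n₂ => (p.2.1 : EuclideanSpace ℝ (Fin (n₁ + 1))) :=
    contMDiff_coe_sphere.comp (contMDiff_fst.comp contMDiff_snd)
  have h3 : ContMDiff (model3 n₁ n₂) 𝓘(ℝ, EuclideanSpace ℝ (Fin n₂)) ∞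
      fun p : Prod3 n₁ n₂ => rhHomeo n₂ p.2.2 :=
    contMDiff_rhHomeo.comp (contMDiff_snd.comp contMDiff_snd)
  have h4 : ContMDiff (model3 n₁ n₂) 𝓘(ℝ, EuclideanSpace ℂ (Fin (n₁ + n₂ + 1))) ∞
      fun p : Prod3 n₁ n₂ => complexCoord (Real.tanh ρ) p.1 p.2.1.1 (rhHomeo n₂ p.2.2) :=
    (contDiff_complexCoord (Real.tanh ρ)).contMDiff.comp (h1.prodMk_space (h2.prodMk_space h3))
  have h5 : ContMDiff (model3 n₁ n₂) 𝓘(ℝ, EuclideanSpace ℂ (Fin (n₁ + n₂ + 1))) ∞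
      fun p : Prod3 n₁ n₂ =>
        ofBall (complexCoord (Real.tanh ρ) p.1 p.2.1.1 (rhHomeo n₂ p.2.2)) := fun p =>
    contMDiffAt_of_affineCoord (m := ⊤) (h4 p) (norm_complexCoord_lt ρ p)
  exact contMDiff_of_comp_quotient_mk h5

theorem affine_lift (ρ s : ℝ) (x : Metric.sphere (0 : EuclideanSpace ℝ (Fin (n₁ + 1))) 1)
    (y : RH n₂) : affine (lift ρ s x y) =
      complexCoord (Real.tanh ρ) (Circle.exp s) x (rhHomeo n₂ y) := by
  have hlast : (lift ρ s x y).1 (Fin.last (n₁ + n₂ + 1)) =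
      (Real.cosh ρ : ℂ) * Complex.exp (Complex.I * s * (Real.sinh ρ : ℂ) ^ 2) *
        (y.1 (Fin.last n₂) : ℂ) := by
    have h : Fin.cast (by omega : n₁ + n₂ + 1 + 1 = (n₁ + 1) + (n₂ + 1))
        (Fin.last (n₁ + n₂ + 1)) = Fin.natAdd (n₁ + 1) (Fin.last n₂) := by
      ext
      simp
    simp only [lift, liftVec, h, Fin.append_right]
  have hne : (lift ρ s x y).1 (Fin.last (n₁ + n₂ + 1)) ≠ 0 := (lift ρ s x y).last_ne_zero
  have hy : (invLast (rhHomeo n₂ y) : ℂ) * (y.1 (Fin.last n₂) : ℂ) = 1 := by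
    exact_mod_cast invLast_rhHomeo y
  ext k
  change (lift ρ s x y).1 k.castSucc / (lift ρ s x y).1 (Fin.last (n₁ + n₂ + 1)) = _
  rw [div_eq_iff hne, hlast]
  rcases idx_cases k with ⟨i, rfl⟩ | ⟨j, rfl⟩
  · have h : Fin.cast (by omega : n₁ + n₂ + 1 + 1 = (n₁ + 1) + (n₂ + 1))
        (inlIdx (n₂ := n₂) i).castSucc = Fin.castAdd (n₂ + 1) i := by
      ext
      simp [inlIdx]
    have hT : (Real.tanh ρ : ℂ) * (Real.cosh ρ : ℂ) = (Real.sinh ρ : ℂ) := by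
      rw [← Complex.ofReal_mul, Real.tanh_eq_sinh_div_cosh, div_mul_cancel₀ _ (Real.cosh_pos ρ).ne']
    have hexp : Complex.exp (Complex.I * s * (Real.cosh ρ : ℂ) ^ 2) =
        Complex.exp (s * Complex.I) * Complex.exp (Complex.I * s * (Real.sinh ρ : ℂ) ^ 2) := by
      rw [← Complex.exp_add, ← Complex.ofReal_pow, Real.cosh_sq]
      congr 1
      push_cast
      ring
    simp only [lift, liftVec, h, Fin.append_left, complexCoord_inl, Circle.coe_exp]
    rw [hexp, Complex.ofReal_mul, Complex.ofReal_mul]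
    linear_combination (-(Complex.exp (s * Complex.I) *
      Complex.exp (Complex.I * s * (Real.sinh ρ : ℂ) ^ 2) * (x.1 i : ℂ))) * hT -
      (Real.tanh ρ : ℂ) * Real.cosh ρ * Complex.exp (s * Complex.I) *
      Complex.exp (Complex.I * s * (Real.sinh ρ : ℂ) ^ 2) * (x.1 i : ℂ) * hy
  · have h : Fin.cast (by omega : n₁ + n₂ + 1 + 1 = (n₁ + 1) + (n₂ + 1))
        (inrIdx (n₁ := n₁) j).castSucc = Fin.natAdd (n₁ + 1) j.castSucc := by
      ext
      simp [inrIdx]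
    have hj : rhHomeo n₂ y j = y.1 j.castSucc := rfl
    simp only [lift, liftVec, h, Fin.append_right, complexCoord_inr, hj]
    rw [Complex.ofReal_mul]
    linear_combination (-(Real.cosh ρ : ℂ) *
      Complex.exp (Complex.I * s * (Real.sinh ρ : ℂ) ^ 2) * (y.1 j.castSucc : ℂ)) * hy

theorem immersion_exp (ρ s : ℝ) (x : Metric.sphere (0 : EuclideanSpace ℝ (Fin (n₁ + 1))) 1)
    (y : RH n₂) : immersion ρ (proj3 (Circle.exp s, x, y)) = hopf (lift ρ s x y) := by
  rw [← ofBall_affine, affine_lift]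
  rfl

/-- The parametrizations of the quotient by an angle, stereographic coordinates and the global
chart of real hyperbolic space. -/
def quotParam (a : Metric.sphere (0 : EuclideanSpace ℝ (Fin (n₁ + 1))) 1)
    (z : ℝ × EuclideanSpace ℝ (Fin n₁) × EuclideanSpace ℝ (Fin n₂)) : Quot3 n₁ n₂ :=
  proj3 (Circle.exp z.1, sphereParam a z.2.1, (rhHomeo n₂).symm z.2.2)

theorem contMDiff_quotParam (a : Metric.sphere (0 : EuclideanSpace ℝ (Fin (n₁ + 1))) 1) :
    ContMDiff 𝓘(ℝ, ℝ × EuclideanSpace ℝ (Fin n₁) × EuclideanSpace ℝ (Fin n₂)) (model3 n₁ n₂) ∞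
      (quotParam (n₂ := n₂) a) := by
  have h1 : ContMDiff 𝓘(ℝ, ℝ × EuclideanSpace ℝ (Fin n₁) × EuclideanSpace ℝ (Fin n₂)) (𝓡 1) ∞
      fun z : ℝ × EuclideanSpace ℝ (Fin n₁) × EuclideanSpace ℝ (Fin n₂) => Circle.exp z.1 :=
    contMDiff_circleExp.comp contDiff_fst.contMDiff
  have h2 : ContMDiff 𝓘(ℝ, ℝ × EuclideanSpace ℝ (Fin n₁) × EuclideanSpace ℝ (Fin n₂)) (𝓡 n₁) ∞
      fun z : ℝ × EuclideanSpace ℝ (Fin n₁) × EuclideanSpace ℝ (Fin n₂) => sphereParam a z.2.1 :=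
    (contMDiff_sphereParam a).comp (contDiff_fst.comp contDiff_snd).contMDiff
  have h3 : ContMDiff 𝓘(ℝ, ℝ × EuclideanSpace ℝ (Fin n₁) × EuclideanSpace ℝ (Fin n₂)) (𝓡 n₂) ∞
      fun z : ℝ × EuclideanSpace ℝ (Fin n₁) × EuclideanSpace ℝ (Fin n₂) =>
        (rhHomeo n₂).symm z.2.2 :=
    contMDiff_rhHomeo_symm.comp (contDiff_snd.comp contDiff_snd).contMDiff
  exact contMDiff_proj3.comp (h1.prodMk (h2.prodMk h3))

theorem isOpenMap_quotParam (a : Metric.sphere (0 : EuclideanSpace ℝ (Fin (n₁ + 1))) 1) :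
    IsOpenMap (quotParam (n₂ := n₂) a) :=
  isOpenMap_proj3.comp (isLocalHomeomorph_circleExp.isOpenMap.prodMap
    ((isOpenMap_sphereParam a).prodMap (rhHomeo n₂).symm.isOpenMap))

theorem exists_quotParam_eq (q : Quot3 n₁ n₂) : ∃ a z, quotParam a z = q := by
  obtain ⟨⟨c, x, y⟩, rfl⟩ := proj3_surjective q
  obtain ⟨v, hv⟩ := exists_sphereParam_eq x
  exact ⟨-x, (Complex.arg c, v, rhHomeo n₂ y), by
    rw [quotParam, hv, Circle.exp_arg, Homeomorph.symm_apply_apply]⟩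

theorem isTwistedImmersion_immersion {ρ : ℝ} (hρ : 0 < ρ) :
    IsTwistedImmersion (model3 n₁ n₂) (immersion (n₁ := n₁) (n₂ := n₂) ρ) (firstBlock n₁ n₂)
      (Real.sinh ρ ^ 2) quotParam (profile ρ) where
  smooth := contMDiff_immersion ρ
  profile := isTwistProfile_profile hρ
  smooth_param := contMDiff_quotParam
  isOpenMap := isOpenMap_quotParam
  cover := exists_quotParam_eq
  coord a z := by
    rw [quotParam, affineCoord_immersion, Homeomorph.apply_symm_apply, complexCoord_exp]
    rfl
  finrank_model := by
    simp
    ring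
  finrank_param := by simp

theorem isRotation_quotParam : IsRotation (quotParam (n₁ := n₁) (n₂ := n₂)) where
  smul_param a s x τ := by
    rw [quotParam, quotParam, smul_proj3]
    simp [Circle.exp_add, mul_comm]

/-! ### The immersion is an embedding -/

/-- The map `[(c, x, y)] ↦ (c x, u)`, where `u` is the coordinate of `y`. -/
def polar : Quot3 n₁ n₂ → EuclideanSpace ℂ (Fin (n₁ + 1)) × EuclideanSpace ℝ (Fin n₂) :=
  Quotient.lift (fun p : Prod3 n₁ n₂ => ((p.1 : ℂ) • realVec p.2.1.1, rhHomeo n₂ p.2.2)) (by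
    rintro _ p ⟨u, rfl⟩
    rcases Int.units_eq_one_or u with rfl | rfl
    · simp
    · simp only [neg_one_smul_eq, invol]
      refine Prod.ext ?_ rfl
      ext i
      simp)

theorem polar_proj3 (p : Prod3 n₁ n₂) :
    polar (proj3 p) = ((p.1 : ℂ) • realVec p.2.1.1, rhHomeo n₂ p.2.2) := rfl

theorem isProperMap_polar_comp_proj3 : IsProperMap (polar ∘ proj3 (n₁ := n₁) (n₂ := n₂)) := by
  have h1 : Continuous fun p : Circle × Metric.sphere (0 : EuclideanSpace ℝ (Fin (n₁ + 1))) 1 =>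
      (p.1 : ℂ) • realVec p.2.1 := by fun_prop
  exact (h1.isProperMap.prodMap (rhHomeo n₂).isProperMap).comp
    (Homeomorph.prodAssoc _ _ _).symm.isProperMap

theorem polar_injective : Function.Injective (polar (n₁ := n₁) (n₂ := n₂)) := by
  intro q q' h
  obtain ⟨⟨c, x, y⟩, rfl⟩ := proj3_surjective q
  obtain ⟨⟨c', x', y'⟩, rfl⟩ := proj3_surjective q'
  rw [polar_proj3, polar_proj3, Prod.mk.injEq] at h
  obtain ⟨h1, h2⟩ := h
  have hy : y = y' := (rhHomeo n₂).injective h2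
  have hi : ∀ i, (c : ℂ) * (x.1 i : ℂ) = c' * (x'.1 i : ℂ) := fun i =>
    congrArg (fun v => v i) h1
  have hsq : ∀ (c : Circle) (x : Metric.sphere (0 : EuclideanSpace ℝ (Fin (n₁ + 1))) 1),
      ∑ i, ((c : ℂ) * (x.1 i : ℂ)) ^ 2 = (c : ℂ) ^ 2 := by
    intro c x
    have h3 := EuclideanSpace.real_norm_sq_eq x.1
    rw [mem_sphere_zero_iff_norm.mp x.2] at h3
    have h4 : ∑ i, (x.1 i : ℂ) ^ 2 = 1 := by
      have h5 : ∑ i, x.1 i ^ 2 = 1 := by linarith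
      exact_mod_cast h5
    simp only [mul_pow, ← Finset.mul_sum, h4, mul_one]
  have hc : (c : ℂ) ^ 2 = (c' : ℂ) ^ 2 := by
    rw [← hsq c x, ← hsq c' x']
    simp only [hi]
  subst hy
  rw [proj3_eq_iff]
  rcases sq_eq_sq_iff_eq_or_eq_neg.mp hc with hc | hc
  · left
    have hx : x = x' := by
      apply Subtype.ext
      ext i
      have h3 := hi i
      rw [hc] at h3
      exact_mod_cast mul_left_cancel₀ c'.coe_ne_zero h3
    rw [Circle.ext hc, hx]
  · right
    have hx : x = -x' := by
      apply Subtype.ext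
      ext i
      have h3 := hi i
      rw [hc, neg_mul, ← mul_neg] at h3
      have h4 : -(x.1 i : ℂ) = (x'.1 i : ℂ) := mul_left_cancel₀ c'.coe_ne_zero h3
      have h5 : -(x.1 i) = x'.1 i := by exact_mod_cast h4
      simp [← h5]
    have hc' : c = -c' := Circle.ext hc
    rw [hc', hx, invol]

theorem isEmbedding_polar : Topology.IsEmbedding (polar (n₁ := n₁) (n₂ := n₂)) := by
  have hc : Continuous (polar (n₁ := n₁) (n₂ := n₂)) :=
    Continuous.quotient_lift isProperMap_polar_comp_proj3.continuous _
  refine (Topology.IsClosedEmbedding.of_continuous_injective_isClosedMap hc polar_injective ?_).isEmbedding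
  intro A hA
  have h1 : polar '' A = (polar ∘ proj3 (n₁ := n₁) (n₂ := n₂)) '' (proj3 ⁻¹' A) := by
    rw [Set.image_comp, Set.image_preimage_eq _ proj3_surjective]
  rw [h1]
  exact isProperMap_polar_comp_proj3.isClosedMap _ (hA.preimage contMDiff_proj3.continuous)

theorem isEmbedding_immersion {ρ : ℝ} (hρ : 0 < ρ) :
    Topology.IsEmbedding (immersion (n₁ := n₁) (n₂ := n₂) ρ) := by
  let Z : CH (n₁ + n₂ + 1) → ℝ := fun q => Real.cosh ρ * √(1 - ‖affineCoord q‖ ^ 2)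
  have hT : 0 < Real.tanh ρ := by
    rw [Real.tanh_eq_sinh_div_cosh]
    exact div_pos (Real.sinh_pos_iff.mpr hρ) (Real.cosh_pos ρ)
  have hZ0 : ∀ q, Z q ≠ 0 := fun q => mul_ne_zero (Real.cosh_pos ρ).ne'
    (Real.sqrt_pos.mpr (one_sub_norm_sq_pos (norm_affineCoord_lt q))).ne'
  let F : CH (n₁ + n₂ + 1) → EuclideanSpace ℂ (Fin (n₁ + 1)) × EuclideanSpace ℝ (Fin n₂) :=
    fun q => (WithLp.toLp 2 fun i => (((Real.tanh ρ * Z q)⁻¹ : ℝ) : ℂ) * affineCoord q (inlIdx i),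
      WithLp.toLp 2 fun j => (Z q)⁻¹ * (affineCoord q (inrIdx j)).re)
  have ha : Continuous (affineCoord (n := n₁ + n₂ + 1)) := contMDiff_affineCoord.continuous
  have hZ : Continuous Z := by fun_prop
  have hF : Continuous F := by
    refine Continuous.prodMk ?_ ?_
    · refine (PiLp.continuous_toLp 2 _).comp (continuous_pi fun i => ?_)
      refine (Complex.continuous_ofReal.comp ((continuous_const.mul hZ).inv₀ fun q =>
        mul_ne_zero hT.ne' (hZ0 q))).mul (by fun_prop)
    · refine (PiLp.continuous_toLp 2 _).comp (continuous_pi fun j => ?_)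
      exact (hZ.inv₀ hZ0).mul (by fun_prop)
  have hFi : F ∘ immersion (n₁ := n₁) (n₂ := n₂) ρ = polar := by
    funext q
    obtain ⟨⟨c, x, y⟩, rfl⟩ := proj3_surjective q
    set u := rhHomeo n₂ y with hu
    have hZq : Z (immersion ρ (proj3 (c, x, y))) = invLast u := by
      have h1 : 1 - Real.tanh ρ ^ 2 = (Real.cosh ρ ^ 2)⁻¹ := by
        rw [Real.tanh_eq_sinh_div_cosh, div_pow, eq_comm, inv_eq_iff_eq_inv, eq_comm,
          inv_eq_iff_eq_inv]
        have h2 := Real.cosh_sq ρ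
        have h3 := (Real.cosh_pos ρ).ne'
        field_simp
        linarith
      simp only [Z, affineCoord_immersion, norm_complexCoord]
      rw [norm_sq_realCoord _ (mem_sphere_zero_iff_norm.mp x.2), sub_sub_cancel, h1,
        ← inv_pow, ← mul_pow, Real.sqrt_sq (mul_nonneg (inv_nonneg.mpr (Real.cosh_pos ρ).le)
          (invLast_pos _).le), ← mul_assoc, mul_inv_cancel₀ (Real.cosh_pos ρ).ne', one_mul]
    have hne : (Real.tanh ρ * invLast u) ≠ 0 := mul_ne_zero hT.ne' (invLast_pos u).ne'
    rw [polar_proj3]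
    refine Prod.ext ?_ ?_
    · ext i
      simp only [Function.comp_apply, F, hZq, affineCoord_immersion, complexCoord_inl]
      rw [← hu, mul_left_comm, ← Complex.ofReal_mul, ← mul_assoc, inv_mul_cancel₀ hne, one_mul]
      rfl
    · ext j
      simp only [Function.comp_apply, F, hZq, affineCoord_immersion, complexCoord_inr,
        Complex.ofReal_re]
      rw [← hu, ← mul_assoc, inv_mul_cancel₀ (invLast_pos u).ne', one_mul]
  exact Topology.IsEmbedding.of_comp (contMDiff_immersion ρ).continuous hF (hFi ▸ isEmbedding_polar)

end

end HMinLag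

/-- For every `ρ > 0`, the map
`[(e^{is}, x, y)] ↦ [(sinh ρ exp(i s cosh² ρ) x, cosh ρ exp(i s sinh² ρ) y)]` is a well defined
H-minimal Lagrangian embedding of `(S^1 × S^{n₁} × RH^{n₂}) / Z_2` into `CH^{n₁ + n₂ + 1}`. -/
theorem corollary9 (n₁ n₂ : ℕ) (ρ : ℝ) (hρ : 0 < ρ) :
    ∃ Φ : HMinLag.Quot3 n₁ n₂ → HMinLag.CH (n₁ + n₂ + 1),
      (∀ (s : ℝ) (x : Metric.sphere (0 : EuclideanSpace ℝ (Fin (n₁ + 1))) 1) (y : HMinLag.RH n₂),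
        Φ (HMinLag.proj3 (Circle.exp s, x, y)) = HMinLag.hopf (HMinLag.lift ρ s x y)) ∧
      Manifold.IsSmoothEmbedding (HMinLag.model3 n₁ n₂)
        𝓘(ℝ, EuclideanSpace ℂ (Fin (n₁ + n₂ + 1))) ∞ Φ ∧
      HMinLag.IsLagrangianImmersion (HMinLag.model3 n₁ n₂) Φ ∧
      HMinLag.IsHMinimal (HMinLag.model3 n₁ n₂) Φ := by
  have h := HMinLag.isTwistedImmersion_immersion (n₁ := n₁) (n₂ := n₂) hρ
  let _ : MeasurableSpace (HMinLag.Quot3 n₁ n₂) := borel _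
  have : BorelSpace (HMinLag.Quot3 n₁ n₂) := ⟨rfl⟩
  have hmin := h.isHMinimal HMinLag.isRotation_quotParam HMinLag.contMDiff_smul_quot3
  exact ⟨HMinLag.immersion ρ, HMinLag.immersion_exp ρ,
    ⟨h.isLagrangianImmersion.isImmersion, HMinLag.isEmbedding_immersion hρ⟩,
    h.isLagrangianImmersion, hmin⟩
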